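/- A \emph{multi-budgeted cut instance} consists of a finite directed graph $G$, disjoint sets $X,Y\subseteq V(G)$, an integer $\ell\ge 0$, and for every $i\in[\ell]$ a set $E_i\subseteq E(G)$ of arcs of color $i$ and an integer $k_i\ge 1$; the sets $E_i$ need not be disjoint. Put $k=\sum_{i=1}^{\ell}k_i$. An \emph{$XY$-cut} is a set $C\subseteq E(G)$ such that $G-C$ has no directed path from a vertex of $X$ to a vertex of $Y$; it is \emph{minimal} if no proper subset of it is an $XY$-cut, \emph{budget-respecting} if $C\subseteq\bigcup_{i} E_i$ and $|C\cap E_i|\le k_i$ for every $i\in[\ell]$, and \emph{$Z$-respecting}, for $Z\subseteq E(G)$, if $C\subseteq Z$. For minimal $Z$-respecting budget-respecting $XY$-cuts $C_1,C_2$, we say that $C_1$ \emph{dominates} $C_2$ if every vertex reachable from $X$ in $G-C_2$ is reachable from $X$ in $G-C_1$, and $|C_1\cap E_i|\le|C_2\cap E_i|$ for every $i\in[\ell]$. A minimal $Z$-respecting budget-respecting $XY$-cut is \emph{important} if no other minimal $Z$-respecting budget-respecting $XY$-cut dominates it. \textbf{Theorem.} There are an algorithm (a single random access machine program with unit-cost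 operations) and an absolute constant $c$ such that the following holds. Given a multi-budgeted cut instance and a set $Z\subseteq\bigcup_{i=1}^{\ell}E_i$, the algorithm outputs, in time at most $c\cdot 2^{c k^2\log_2 k}\cdot\max(1,|V(G)|+|E(G)|)$, a list of at most $c\cdot 2^{c k^2\log_2 k}$ minimal $Z$-respecting budget-respecting $XY$-cuts that contains every important $Z$-respecting budget-respecting $XY$-cut. (Here $k^2\log_2 k$ is read as $0$ for $k=0$.) That is, the time is $2^{\mathcal O(k^2\log k)}(|V(G)|+|E(G)|)$ and the family has size $2^{\mathcal O(k^2\log k)}$. -/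

import Mathlib

/-- An instance of the multi-budgeted cut problem.  The digraph has vertex set `Fin n` and arc set
`Fin m`, the arc `e` going from `src e` to `tgt e` (loops and parallel arcs are allowed; a simple
digraph is the case where `e ↦ (src e, tgt e)` is injective).  An arc may have several colors
or none. -/
structure MBCut where
  n : ℕ
  m : ℕ
  src : Fin m → Fin n
  tgt : Fin m → Fin n
  X : Finset (Fin n)
  Y : Finset (Fin n)
  disjoint_XY : Disjoint X Y
  numColors : ℕ
  color : Fin numColors → Finset (Fin m)
  budget : Fin numColors → ℕ
  one_le_budget : ∀ i, 1 ≤ budget i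

namespace MBCut

/-- The total budget `k`. -/
def k (I : MBCut) : ℕ := ∑ i, I.budget i

/-- The union of all color classes. -/
def colored (I : MBCut) : Finset (Fin I.m) := Finset.univ.biUnion I.color

/-- `(u, v)` is joined by an arc of the digraph with the arc set `C` deleted. -/
def StepAvoiding (I : MBCut) (C : Finset (Fin I.m)) (u v : Fin I.n) : Prop :=
  ∃ e, e ∉ C ∧ I.src e = u ∧ I.tgt e = v

/-- The set of vertices reachable from `X` after deleting the arcs of `C`. -/
def reach (I : MBCut) (C : Finset (Fin I.m)) : Set (Fin I.n) :=
  {v | ∃ x ∈ I.X, Relation.ReflTransGen (I.StepAvoiding C) x v}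

/-- `C` is an `XY`-cut: no directed path from `X` to `Y` avoids `C`. -/
def IsCut (I : MBCut) (C : Finset (Fin I.m)) : Prop :=
  ∀ y ∈ I.Y, y ∉ I.reach C

/-- An inclusion-wise minimal `XY`-cut. -/
def IsMinimalCut (I : MBCut) (C : Finset (Fin I.m)) : Prop :=
  I.IsCut C ∧ ∀ D, D ⊂ C → ¬ I.IsCut D

def BudgetRespecting (I : MBCut) (C : Finset (Fin I.m)) : Prop :=
  C ⊆ I.colored ∧ ∀ i, (C ∩ I.color i).card ≤ I.budget i

/-- Minimal `Z`-respecting budget-respecting `XY`-cuts. -/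
def Admissible (I : MBCut) (Z C : Finset (Fin I.m)) : Prop :=
  I.IsMinimalCut C ∧ C ⊆ Z ∧ I.BudgetRespecting C

/-- `C₁` dominates `C₂`. -/
def Dominates (I : MBCut) (C₁ C₂ : Finset (Fin I.m)) : Prop :=
  I.reach C₂ ⊆ I.reach C₁ ∧ ∀ i, (C₁ ∩ I.color i).card ≤ (C₂ ∩ I.color i).card

/-- Important `Z`-respecting budget-respecting `XY`-cuts. -/
def Important (I : MBCut) (Z C : Finset (Fin I.m)) : Prop :=
  I.Admissible Z C ∧ ∀ D, I.Admissible Z D → D ≠ C → ¬ I.Dominates D C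

/-- The input word: `n, m, ℓ`, the pairs (tail, head) of the arcs, the indicator vectors of `X` and
`Y`, for every color its budget followed by the indicator vector of its arc set, and finally the
indicator vector of `Z`. -/
def encode (I : MBCut) (Z : Finset (Fin I.m)) : List ℕ :=
  [I.n, I.m, I.numColors]
  ++ (List.ofFn fun e : Fin I.m => [(I.src e : ℕ), (I.tgt e : ℕ)]).flatten
  ++ (List.ofFn fun v : Fin I.n => if v ∈ I.X then 1 else 0)
  ++ (List.ofFn fun v : Fin I.n => if v ∈ I.Y then 1 else 0)
  ++ (List.ofFn fun i : Fin I.numColors =>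
        I.budget i :: List.ofFn fun e : Fin I.m => if e ∈ I.color i then 1 else 0).flatten
  ++ (List.ofFn fun e : Fin I.m => if e ∈ Z then 1 else 0)

/-- The output word of a list of arc sets, each given by listing its arcs: every arc set is written
as its number of arcs followed by the indices of its arcs. -/
def encodeFamily (I : MBCut) (F : List (List (Fin I.m))) : List ℕ :=
  F.flatMap fun C => C.length :: C.map fun e => (e : ℕ)

end MBCut

/-! A random access machine.  A program uses finitely many registers and finitely many arrays of
natural numbers, accessed by index.  The arithmetic is restricted to `+ 1` and `- 1`, so that a
stored number exceeds the numbers of the input and of the program by at most the running time, and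
charging one time unit per operation is realistic. -/

structure RamState where
  reg : ℕ → ℕ
  arr : ℕ → ℕ → ℕ
  out : List ℕ

inductive RamExpr where
  | lit (c : ℕ)
  | reg (r : ℕ)
  | get (a : ℕ) (i : RamExpr)
  | succ (e : RamExpr)
  | pred (e : RamExpr)

namespace RamExpr

def eval (s : RamState) : RamExpr → ℕ
  | lit c => c
  | reg r => s.reg r
  | get a i => s.arr a (i.eval s)
  | succ e => e.eval s + 1
  | pred e => e.eval s - 1

/-- The number of operations for evaluating an expression. -/
def cost : RamExpr → ℕ
  | lit _ => 1
  | reg _ => 1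
  | get _ i => i.cost + 1
  | succ e => e.cost + 1
  | pred e => e.cost + 1

end RamExpr

inductive RamTest where
  | eq (e f : RamExpr)
  | lt (e f : RamExpr)

namespace RamTest

def Holds (s : RamState) : RamTest → Prop
  | eq e f => e.eval s = f.eval s
  | lt e f => e.eval s < f.eval s

def cost : RamTest → ℕ
  | eq e f => e.cost + f.cost + 1
  | lt e f => e.cost + f.cost + 1

end RamTest

/-- Programs.  `set r e` assigns to a register, `store a i e` assigns to entry `i` of array `a`,
`emit e` appends a number to the output, `loop b p` is a while loop. -/
inductive RamProg where
  | skip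
  | set (r : ℕ) (e : RamExpr)
  | store (a : ℕ) (i e : RamExpr)
  | emit (e : RamExpr)
  | seq (p q : RamProg)
  | ite (b : RamTest) (p q : RamProg)
  | loop (b : RamTest) (p : RamProg)

/-- `Runs p s t s'`: started in state `s`, the program `p` halts in state `s'` after exactly `t`
time units. -/
inductive RamProg.Runs : RamProg → RamState → ℕ → RamState → Prop where
  | skip (s : RamState) : Runs .skip s 1 s
  | set (r : ℕ) (e : RamExpr) (s : RamState) :
      Runs (.set r e) s (e.cost + 1) { s with reg := Function.update s.reg r (e.eval s) }
  | store (a : ℕ) (i e : RamExpr) (s : RamState) :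
      Runs (.store a i e) s (i.cost + e.cost + 1)
        { s with arr := Function.update s.arr a
                  (Function.update (s.arr a) (i.eval s) (e.eval s)) }
  | emit (e : RamExpr) (s : RamState) :
      Runs (.emit e) s (e.cost + 1) { s with out := s.out ++ [e.eval s] }
  | seq {p q : RamProg} {s s₁ s₂ : RamState} {t₁ t₂ : ℕ} :
      Runs p s t₁ s₁ → Runs q s₁ t₂ s₂ → Runs (.seq p q) s (t₁ + t₂) s₂
  | ite_true {b : RamTest} {p q : RamProg} {s s₁ : RamState} {t : ℕ} :
      b.Holds s → Runs p s t s₁ → Runs (.ite b p q) s (b.cost + t) s₁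
  | ite_false {b : RamTest} {p q : RamProg} {s s₁ : RamState} {t : ℕ} :
      ¬ b.Holds s → Runs q s t s₁ → Runs (.ite b p q) s (b.cost + t) s₁
  | loop_true {b : RamTest} {p : RamProg} {s s₁ s₂ : RamState} {t₁ t₂ : ℕ} :
      b.Holds s → Runs p s t₁ s₁ → Runs (.loop b p) s₁ t₂ s₂ →
      Runs (.loop b p) s (b.cost + t₁ + t₂) s₂
  | loop_false {b : RamTest} {p : RamProg} {s : RamState} :
      ¬ b.Holds s → Runs (.loop b p) s b.cost s

/-- The initial state: array `0` holds the input word, everything else is `0`, and nothing has been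
output. -/
def RamState.init (w : List ℕ) : RamState where
  reg := fun _ => 0
  arr := fun a i => if a = 0 then w.getD i 0 else 0
  out := []

-- Call an arc undeletable if it has infinite capacity, and give every other arc unit capacity.
-- Initially the arcs outside `Z` are undeletable. For a fixed important cut `C`, the procedure
-- keeps enlarging the set `und` of undeletable arcs while `C` stays disjoint from it, until a
-- particular minimum cut of the network equals `C`. Since `C` survives, the maximum flow value is
-- at most `|C| ≤ k` throughout.
--
-- Let `f` be a maximum flow, `W` the set of vertices from which `Y` is reachable in the residual
-- network, and `A = Wᶜ`. The arcs leaving `A` form the minimum cut farthest from `X`. Split `f`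
-- into at most `k` paths and label an arc by a path through it. On a saturated cut of size at most
-- `k` the labels are distinct and less than `k`, because each path crosses such a cut exactly once
-- (`Decomp.labOK`). Suppose the set of pairs (label, color) occurring on arcs of `C` with tail in
-- `A` is known; it has at most `k` elements (`pairs_card`). Every arc with tail in `A` having a
-- color whose pair is outside this set can be made undeletable, since it is not in `C`. Afterwards
-- one of three things holds. The flow value has grown, which happens at most `k` times. Or the flow
-- and the labels are unchanged but `A` has shrunk so far that the set of pairs is smaller. Or the
-- set of pairs is the same, and then every color of every arc of the minimum cut occurs, with the
-- same label, on an arc of `C` in front of that cut.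
--
-- In the last case an exchange argument finishes (`Important.eq_outArcs`). Let `R` be the set
-- reachable from `X` without `C`. The arcs leaving `A ∪ R` lie in `C` or in the minimum cut. An arc
-- `b` of the minimum cut outside `C` can be charged to an arc of `C` with the same label and color
-- and tail in `A`; the head of that arc is in `A` too, since otherwise it would cross the minimum
-- cut with the label of `b`. So no color count increases, and a minimal cut among the arcs leaving
-- `A ∪ R` dominates `C`. Importance makes it equal to `C`, and minimality of `C` then makes `C`
-- equal to the minimum cut.
--
-- The unknown sets of pairs are guessed. An advice word drives the procedure: a symbol below `k *
-- numColors` toggles one pair, the symbol `k * numColors` performs the refinement, and the next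
-- symbol does nothing. A potential function (`Ready.progress`) shows that `3 * (k + 1) ^ 2` symbols
-- suffice for every important cut. All words over the alphabet of `k * numColors + 2 ≤ k ^ 2 + 2`
-- symbols are tried, hence `2 ^ O(k ^ 2 log k)` of them. Each one yields at most one cut, which is
-- output only if it is admissible, and takes time polynomial in `k` and linear in the size of the
-- graph.
--
-- For the machine, every word is executed after resetting the working memory, so that the outcome
-- depends only on the word. Guarded stores keep the memory to be reset small, and `Runs.plug` shows
-- that the advice and earlier output do not influence the single steps.

infixr:60 " ;; " => RamProg.seq

/-! ### Program logic: determinism, frames, and total correctness with running time -/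

namespace RamState

def setReg (s : RamState) (r v : ℕ) : RamState := { s with reg := Function.update s.reg r v }

def write (s : RamState) (a i v : ℕ) : RamState :=
  { s with arr := Function.update s.arr a (Function.update (s.arr a) i v) }

def put (s : RamState) (v : ℕ) : RamState := { s with out := s.out ++ [v] }

variable (s : RamState) (r a i v : ℕ)

@[simp] theorem setReg_reg (x : ℕ) :
    (s.setReg r v).reg x = if x = r then v else s.reg x := by
  simp [setReg, Function.update_apply]

@[simp] theorem setReg_arr : (s.setReg r v).arr = s.arr := rfl

@[simp] theorem setReg_out : (s.setReg r v).out = s.out := rfl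

@[simp] theorem write_reg : (s.write a i v).reg = s.reg := rfl

@[simp] theorem write_arr (b : ℕ) :
    (s.write a i v).arr b = if b = a then Function.update (s.arr a) i v else s.arr b := by
  simp [write, Function.update_apply]

@[simp] theorem write_out : (s.write a i v).out = s.out := rfl

@[simp] theorem put_reg : (s.put v).reg = s.reg := rfl

@[simp] theorem put_arr : (s.put v).arr = s.arr := rfl

@[simp] theorem put_out : (s.put v).out = s.out ++ [v] := rfl

end RamState

namespace RamProg

/-- In every state exactly one rule applies. This identifies the run whose result is output with the
run that a good advice word is known to have. -/
theorem Runs.det {p : RamProg} {s s₁ : RamState} {t₁ : ℕ} (h₁ : p.Runs s t₁ s₁) :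
    ∀ {t₂ : ℕ} {s₂ : RamState}, p.Runs s t₂ s₂ → t₁ = t₂ ∧ s₁ = s₂ := by
  induction h₁ with
  | skip | set | store | emit => intro _ _ h; cases h; exact ⟨rfl, rfl⟩
  | seq _ _ ih₁ ih₂ =>
    intro _ _ h
    cases h with
    | seq a b =>
      obtain ⟨rfl, rfl⟩ := ih₁ a
      obtain ⟨rfl, rfl⟩ := ih₂ b
      exact ⟨rfl, rfl⟩
  | ite_true hb _ ih =>
    intro _ _ h
    cases h with
    | ite_true _ a => obtain ⟨rfl, rfl⟩ := ih a; exact ⟨rfl, rfl⟩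
    | ite_false hb' _ => exact absurd hb hb'
  | ite_false hb _ ih =>
    intro _ _ h
    cases h with
    | ite_true hb' _ => exact absurd hb' hb
    | ite_false _ a => obtain ⟨rfl, rfl⟩ := ih a; exact ⟨rfl, rfl⟩
  | loop_true hb _ _ ih₁ ih₂ =>
    intro _ _ h
    cases h with
    | loop_true _ a b =>
      obtain ⟨rfl, rfl⟩ := ih₁ a
      obtain ⟨rfl, rfl⟩ := ih₂ b
      exact ⟨rfl, rfl⟩
    | loop_false hb' => exact absurd hb hb'
  | loop_false hb =>
    intro _ _ h
    cases h with
    | loop_true hb' _ _ => exact absurd hb' hb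
    | loop_false => exact ⟨rfl, rfl⟩

/-- The registers that a program may write. -/
def wr : RamProg → ℕ → Bool
  | set r _, x => r == x
  | seq p q, x => p.wr x || q.wr x
  | ite _ p q, x => p.wr x || q.wr x
  | loop _ p, x => p.wr x
  | _, _ => false

/-- The arrays that a program may write. -/
def wa : RamProg → ℕ → Bool
  | store a _ _, x => a == x
  | seq p q, x => p.wa x || q.wa x
  | ite _ p q, x => p.wa x || q.wa x
  | loop _ p, x => p.wa x
  | _, _ => false

/-- Whether a program may produce output. -/
def emits : RamProg → Bool
  | emit _ => true
  | seq p q => p.emits || q.emits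
  | ite _ p q => p.emits || q.emits
  | loop _ p => p.emits
  | _ => false

/-- `s'` differs from `s` at most in what `p` may write. -/
structure Frame (p : RamProg) (s s' : RamState) : Prop where
  reg : ∀ r, p.wr r = false → s'.reg r = s.reg r
  arr : ∀ a, p.wa a = false → s'.arr a = s.arr a
  out : p.emits = false → s'.out = s.out

theorem Frame.refl (p : RamProg) (s : RamState) : Frame p s s :=
  ⟨fun _ _ => rfl, fun _ _ => rfl, fun _ => rfl⟩

theorem Frame.trans {p : RamProg} {s₁ s₂ s₃ : RamState} (h : Frame p s₁ s₂) (h' : Frame p s₂ s₃) :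
    Frame p s₁ s₃ :=
  ⟨fun r hr => (h'.reg r hr).trans (h.reg r hr), fun a ha => (h'.arr a ha).trans (h.arr a ha),
    fun ho => (h'.out ho).trans (h.out ho)⟩

theorem Frame.mono {p q : RamProg} {s₁ s₂ : RamState} (h : Frame p s₁ s₂)
    (hr : ∀ r, q.wr r = false → p.wr r = false) (ha : ∀ a, q.wa a = false → p.wa a = false)
    (ho : q.emits = false → p.emits = false) : Frame q s₁ s₂ :=
  ⟨fun r h' => h.reg r (hr r h'), fun a h' => h.arr a (ha a h'), fun h' => h.out (ho h')⟩

theorem Runs.frame {p : RamProg} {s s' : RamState} {t : ℕ} (h : p.Runs s t s') :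
    Frame p s s' := by
  induction h with
  | skip => exact Frame.refl _ _
  | set r e s =>
    refine ⟨fun x hx => ?_, fun _ _ => rfl, fun _ => rfl⟩
    have : x ≠ r := by rintro rfl; simp [wr] at hx
    simp [Function.update_of_ne this]
  | store a i e s =>
    refine ⟨fun _ _ => rfl, fun x hx => ?_, fun _ => rfl⟩
    have : x ≠ a := by rintro rfl; simp [wa] at hx
    simp [Function.update_of_ne this]
  | emit e s => exact ⟨fun _ _ => rfl, fun _ _ => rfl, fun h => by simp [emits] at h⟩
  | seq _ _ ih₁ ih₂ =>
    refine Frame.trans (ih₁.mono ?_ ?_ ?_) (ih₂.mono ?_ ?_ ?_) <;> simp +contextual [wr, wa, emits]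
  | ite_true _ _ ih => refine ih.mono ?_ ?_ ?_ <;> simp +contextual [wr, wa, emits]
  | ite_false _ _ ih => refine ih.mono ?_ ?_ ?_ <;> simp +contextual [wr, wa, emits]
  | loop_true _ _ _ ih₁ ih₂ =>
    refine Frame.trans (ih₁.mono ?_ ?_ ?_) ih₂ <;> simp +contextual [wr, wa, emits]
  | loop_false => exact Frame.refl _ _

/-- Total correctness with exact running time. -/
def wp (p : RamProg) (s : RamState) (Q : ℕ → RamState → Prop) : Prop :=
  ∃ t s', p.Runs s t s' ∧ Q t s'

/-- The frame comes for free in the continuation, so a specification only has to mention what the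
program changes. -/
theorem wp_mono {p : RamProg} {s : RamState} {Q Q' : ℕ → RamState → Prop} (h : p.wp s Q)
    (hQ : ∀ t s', Frame p s s' → Q t s' → Q' t s') : p.wp s Q' := by
  obtain ⟨t, s', hr, hq⟩ := h
  exact ⟨t, s', hr, hQ t s' hr.frame hq⟩

theorem wp_skip {s : RamState} {Q : ℕ → RamState → Prop} (h : Q 1 s) : wp skip s Q :=
  ⟨_, _, .skip s, h⟩

theorem wp_set {r : ℕ} {e : RamExpr} {s : RamState} {Q : ℕ → RamState → Prop}
    (h : Q (e.cost + 1) (s.setReg r (e.eval s))) :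
    wp (set r e) s Q := ⟨_, _, .set r e s, h⟩

theorem wp_store {a : ℕ} {i e : RamExpr} {s : RamState} {Q : ℕ → RamState → Prop}
    (h : Q (i.cost + e.cost + 1) (s.write a (i.eval s) (e.eval s))) :
    wp (store a i e) s Q := ⟨_, _, .store a i e s, h⟩

theorem wp_emit {e : RamExpr} {s : RamState} {Q : ℕ → RamState → Prop}
    (h : Q (e.cost + 1) (s.put (e.eval s))) :
    wp (emit e) s Q := ⟨_, _, .emit e s, h⟩

theorem wp_seq {p q : RamProg} {s : RamState} {Q : ℕ → RamState → Prop}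
    (h : p.wp s fun t₁ s₁ => q.wp s₁ fun t₂ s₂ => Q (t₁ + t₂) s₂) : wp (p ;; q) s Q := by
  obtain ⟨t₁, s₁, h₁, t₂, s₂, h₂, hQ⟩ := h
  exact ⟨_, _, .seq h₁ h₂, hQ⟩

theorem wp_ite {b : RamTest} {p q : RamProg} {s : RamState} {Q : ℕ → RamState → Prop}
    (ht : b.Holds s → p.wp s fun t s' => Q (b.cost + t) s')
    (hf : ¬ b.Holds s → q.wp s fun t s' => Q (b.cost + t) s') : wp (ite b p q) s Q := by
  by_cases hb : b.Holds s
  · obtain ⟨t, s', h, hq⟩ := ht hb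
    exact ⟨_, _, .ite_true hb h, hq⟩
  · obtain ⟨t, s', h, hq⟩ := hf hb
    exact ⟨_, _, .ite_false hb h, hq⟩

theorem RamTest_cost_pos (b : RamTest) : 1 ≤ b.cost := by
  cases b <;> simp [RamTest.cost]

/-- The number `φ` is the time still available, recorded by the invariant. Each round pays for its
test and its body out of `φ`, and as a test costs at least one unit, `φ` also proves termination.
Only the final failing test is charged separately. -/
theorem wp_loop {b : RamTest} {p : RamProg} {s : RamState} (Inv : ℕ → RamState → Prop) (φ : ℕ)
    (h0 : Inv φ s)
    (hstep : ∀ φ s', Frame p s s' → Inv φ s' → b.Holds s' →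
      p.wp s' fun t s'' => ∃ φ', Inv φ' s'' ∧ b.cost + t + φ' ≤ φ) :
    (loop b p).wp s fun t s' => t ≤ φ + b.cost ∧ ¬ b.Holds s' ∧ ∃ φ', Inv φ' s' := by
  have key : ∀ φ s', Frame p s s' → Inv φ s' →
      (loop b p).wp s' fun t s' => t ≤ φ + b.cost ∧ ¬ b.Holds s' ∧ ∃ φ', Inv φ' s' := by
    intro φ
    induction φ using Nat.strong_induction_on with
    | _ φ ih =>
      intro s' hf hi
      by_cases hb : b.Holds s'
      · obtain ⟨t, s'', hr, φ', hi', hle⟩ := hstep φ s' hf hi hb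
        have := RamTest_cost_pos b
        obtain ⟨t₂, s₂, hr₂, ht₂, hrest⟩ := ih φ' (by omega) s'' (hf.trans hr.frame) hi'
        exact ⟨_, _, .loop_true hb hr hr₂, by omega, hrest⟩
      · exact ⟨_, _, .loop_false hb, by omega, hb, φ, hi⟩
  exact key φ s (Frame.refl _ _) h0

/-- `for i in [0, N)`. -/
def forLoop (i : ℕ) (N : RamExpr) (p : RamProg) : RamProg :=
  set i (.lit 0) ;; loop (.lt (.reg i) N) (p ;; set i (.succ (.reg i)))

/-- The counter is written between two rounds, so the invariant must not depend on it (`hInv`); its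
value is tracked here instead. A round costs `B` for the body, `N.cost + 2` for the test and `3` for
the increment. The initialization and the last test fit into one additional round. -/
theorem wp_for {i : ℕ} {N : RamExpr} {p : RamProg} {s : RamState} (n B : ℕ)
    (Inv : ℕ → RamState → Prop) (hi : p.wr i = false)
    (hN : ∀ s', Frame (forLoop i N p) s s' → N.eval s' = n)
    (hInv : ∀ j s v, Inv j s → Inv j (s.setReg i v))
    (h0 : Inv 0 s)
    (hb : ∀ j s', j < n → Frame (forLoop i N p) s s' → s'.reg i = j → Inv j s' →
      p.wp s' fun t s'' => t ≤ B ∧ Inv (j + 1) s'') :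
    (forLoop i N p).wp s fun t s' => t ≤ (n + 1) * (B + N.cost + 5) ∧ Inv n s' := by
  refine wp_seq (wp_set ?_)
  set s₀ : RamState := s.setReg i ((RamExpr.lit 0).eval s) with hs₀
  have hF₀ : Frame (forLoop i N p) s s₀ := by
    refine (Runs.frame (Runs.set i (.lit 0) s)).mono ?_ ?_ ?_ <;>
      simp +contextual [forLoop, wr, wa, emits]
  have hF₁ : ∀ s', Frame (p ;; set i (.succ (.reg i))) s₀ s' → Frame (forLoop i N p) s s' := by
    intro s' h
    refine hF₀.trans (h.mono ?_ ?_ ?_) <;> simp +contextual [forLoop, wr, wa, emits]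
  refine wp_mono (wp_loop (fun φ s' => ∃ j, j ≤ n ∧ s'.reg i = j ∧ Inv j s' ∧
    φ = (n - j) * (B + N.cost + 5)) (n * (B + N.cost + 5)) ?_ ?_) ?_
  · exact ⟨0, Nat.zero_le _, by simp [hs₀, RamExpr.eval], by simpa [hs₀] using hInv _ _ _ h0, by simp⟩
  · rintro φ s' hF ⟨j, hj, hij, hI, rfl⟩ hlt
    have hF' := hF₁ s' hF
    simp only [RamTest.Holds, RamExpr.eval, hN s' hF', hij] at hlt
    obtain ⟨t, s'', hr, ht, hI'⟩ := hb j s' hlt hF' hij hI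
    have hij' : s''.reg i = j := by rw [hr.frame.reg i hi, hij]
    refine wp_seq ⟨t, s'', hr, wp_set ?_⟩
    refine ⟨(n - (j + 1)) * (B + N.cost + 5), ⟨j + 1, hlt, ?_, ?_, rfl⟩, ?_⟩
    · simp [RamExpr.eval, hij']
    · exact hInv _ _ _ hI'
    · simp only [RamTest.cost, RamExpr.cost]
      have : n - j = (n - (j + 1)) + 1 := by omega
      rw [this, Nat.add_mul]
      omega
  · rintro t s' hF ⟨ht, hnb, φ', j, hj, hij, hI, -⟩
    simp only [RamTest.Holds, RamExpr.eval, hN s' (hF₁ s' (hF.mono (by simp [wr]) (by simp [wa])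
      (by simp [emits]))), hij] at hnb
    obtain rfl : j = n := by omega
    refine ⟨?_, hI⟩
    simp only [RamTest.cost, RamExpr.cost] at ht ⊢
    rw [Nat.add_mul]
    omega

end RamProg

/-! ### Independence of an unmentioned array, and stores with bounded index -/

/-- Whether an expression reads the array `a`. -/
def RamExpr.uses : RamExpr → ℕ → Bool
  | get b i, a => b == a || i.uses a
  | succ e, a => e.uses a
  | pred e, a => e.uses a
  | _, _ => false

def RamTest.uses : RamTest → ℕ → Bool
  | eq e f, a => e.uses a || f.uses a
  | lt e f, a => e.uses a || f.uses a

/-- Replace the array `a` by `x` and put the word `o` in front of the output. -/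
def RamState.plug (s : RamState) (a : ℕ) (x : ℕ → ℕ) (o : List ℕ) : RamState where
  reg := s.reg
  arr := Function.update s.arr a x
  out := o ++ s.out

theorem RamExpr.eval_plug {e : RamExpr} {a : ℕ} (h : e.uses a = false) (s : RamState) (x : ℕ → ℕ)
    (o : List ℕ) : e.eval (s.plug a x o) = e.eval s := by
  induction e with
  | lit | reg => rfl
  | get b i ih =>
    simp only [uses, Bool.or_eq_false_iff, beq_eq_false_iff_ne] at h
    simp only [eval, ih h.2]
    simp [RamState.plug, Function.update_of_ne h.1]
  | succ e ih | pred e ih => simp only [uses] at h; simp [eval, ih h]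

theorem RamTest.holds_plug {b : RamTest} {a : ℕ} (h : b.uses a = false) (s : RamState) (x : ℕ → ℕ)
    (o : List ℕ) : b.Holds (s.plug a x o) ↔ b.Holds s := by
  cases b <;> simp only [uses, Bool.or_eq_false_iff] at h <;>
    simp [Holds, RamExpr.eval_plug h.1, RamExpr.eval_plug h.2]

namespace RamProg

/-- Whether a program mentions the array `a`. -/
def uses : RamProg → ℕ → Bool
  | skip, _ => false
  | set _ e, a => e.uses a
  | store b i e, a => b == a || (i.uses a || e.uses a)
  | emit e, a => e.uses a
  | seq p q, a => p.uses a || q.uses a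
  | ite b p q, a => b.uses a || (p.uses a || q.uses a)
  | loop b p, a => b.uses a || p.uses a

/-- No expression reads the output, so a program that does not mention `a` runs in the same way, and
equally long, for all contents of `a` and every earlier output. It is applied to the advice array: a
run found for one advice content carries over to all others. -/
theorem Runs.plug {p : RamProg} {s s' : RamState} {t a : ℕ} (hr : p.Runs s t s')
    (h : p.uses a = false) (x : ℕ → ℕ) (o : List ℕ) :
    p.Runs (s.plug a x o) t (s'.plug a x o) := by
  induction hr with
  | skip s => exact .skip _
  | set r e s =>
    have := Runs.set r e (s.plug a x o)
    rwa [RamExpr.eval_plug h] at this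
  | store b i e s =>
    simp only [uses, Bool.or_eq_false_iff, beq_eq_false_iff_ne] at h
    have := Runs.store b i e (s.plug a x o)
    rw [RamExpr.eval_plug h.2.1, RamExpr.eval_plug h.2.2] at this
    convert this using 1
    simp only [RamState.plug, RamState.mk.injEq, true_and, and_true]
    rw [Function.update_of_ne h.1, Function.update_comm h.1]
  | emit e s =>
    have := Runs.emit e (s.plug a x o)
    rw [RamExpr.eval_plug h] at this
    convert this using 1
    simp [RamState.plug]
  | seq _ _ ih₁ ih₂ =>
    simp only [uses, Bool.or_eq_false_iff] at h
    exact .seq (ih₁ h.1) (ih₂ h.2)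
  | ite_true hb _ ih =>
    simp only [uses, Bool.or_eq_false_iff] at h
    exact .ite_true ((RamTest.holds_plug h.1 _ _ _).2 hb) (ih h.2.1)
  | ite_false hb _ ih =>
    simp only [uses, Bool.or_eq_false_iff] at h
    exact .ite_false (by rwa [RamTest.holds_plug h.1]) (ih h.2.2)
  | loop_true hb _ _ ih₁ ih₂ =>
    have h' := h
    simp only [uses, Bool.or_eq_false_iff] at h'
    exact .loop_true ((RamTest.holds_plug h'.1 _ _ _).2 hb) (ih₁ h'.2) (ih₂ h)
  | loop_false hb =>
    simp only [uses, Bool.or_eq_false_iff] at h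
    exact .loop_false (by rwa [RamTest.holds_plug h.1])

/-- A store that has an effect only below the bound in register `8`. -/
def gst (a : ℕ) (i e : RamExpr) : RamProg := ite (.lt i (.reg 8)) (store a i e) skip

theorem wp_gst {a : ℕ} {i e : RamExpr} {s : RamState} {Q : ℕ → RamState → Prop}
    (hi : i.eval s < s.reg 8)
    (h : Q (2 * i.cost + e.cost + 3) (s.write a (i.eval s) (e.eval s))) :
    wp (gst a i e) s Q := by
  refine wp_ite (fun _ => wp_store ?_) fun h' => absurd hi h'
  convert h using 1
  simp only [RamTest.cost, RamExpr.cost]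
  omega

/-- All stores are bounded, and the bound is never changed. -/
inductive Guarded : RamProg → Prop where
  | skip : Guarded skip
  | set {r e} : r ≠ 8 → Guarded (set r e)
  | emit {e} : Guarded (emit e)
  | gst {a i e} : Guarded (gst a i e)
  | seq {p q} : Guarded p → Guarded q → Guarded (seq p q)
  | ite {b p q} : Guarded p → Guarded q → Guarded (ite b p q)
  | loop {b p} : Guarded p → Guarded (loop b p)

theorem Guarded.forLoop {i : ℕ} {N : RamExpr} {p : RamProg} (hi : i ≠ 8) (h : Guarded p) :
    Guarded (forLoop i N p) := .seq (.set hi) (.loop (.seq h (.set hi)))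

/-- Bounds what a run can soil: whatever happens, clearing the entries below the bound in register
`8` restores the arrays. -/
theorem Guarded.arr_eq {p : RamProg} (h : Guarded p) {s s' : RamState} {t : ℕ}
    (hr : p.Runs s t s') :
    s'.reg 8 = s.reg 8 ∧ ∀ a i, s.reg 8 ≤ i → s'.arr a i = s.arr a i := by
  induction h generalizing s s' t with
  | skip => cases hr; exact ⟨rfl, fun _ _ _ => rfl⟩
  | set hr8 => cases hr; exact ⟨by simp [Function.update_of_ne hr8.symm], fun _ _ _ => rfl⟩
  | emit => cases hr; exact ⟨rfl, fun _ _ _ => rfl⟩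
  | @gst a i e =>
    cases hr with
    | ite_true hb h' =>
      cases h'
      refine ⟨rfl, fun b x hx => ?_⟩
      simp only [RamTest.Holds, RamExpr.eval] at hb
      by_cases hba : b = a
      · subst hba
        simp [Function.update_of_ne (show x ≠ i.eval s by omega)]
      · simp [Function.update_of_ne hba]
    | ite_false _ h' => cases h'; exact ⟨rfl, fun _ _ _ => rfl⟩
  | seq _ _ ih₁ ih₂ =>
    cases hr with
    | seq a b =>
      have h₁ := ih₁ a
      have h₂ := ih₂ b
      exact ⟨h₂.1.trans h₁.1, fun x i hi =>
        (h₂.2 x i (h₁.1 ▸ hi)).trans (h₁.2 x i hi)⟩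
  | ite _ _ ih₁ ih₂ =>
    cases hr with
    | ite_true _ a => exact ih₁ a
    | ite_false _ a => exact ih₂ a
  | @loop b p _ ih =>
    generalize hq : RamProg.loop b p = q at hr
    induction hr with
    | skip | set | store | emit | seq | ite_true | ite_false => simp at hq
    | loop_true _ a _ _ ih₂ =>
      obtain ⟨rfl, rfl⟩ := by simpa using hq
      have h₁ := ih a
      have h₂ := ih₂ rfl
      exact ⟨h₂.1.trans h₁.1, fun x i hi =>
        (h₂.2 x i (h₁.1 ▸ hi)).trans (h₁.2 x i hi)⟩
    | loop_false => exact ⟨rfl, fun _ _ _ => rfl⟩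

end RamProg

/-! ### Flows, saturated cuts, the exchange argument, and path labels -/

namespace MBCut

open Finset

variable (I : MBCut)

def outArcs (A : Finset (Fin I.n)) : Finset (Fin I.m) :=
  univ.filter fun e => I.src e ∈ A ∧ I.tgt e ∉ A

def excess (f : Fin I.m → ℕ) (v : Fin I.n) : ℤ :=
  ∑ e, ((if I.src e = v then (f e : ℤ) else 0) - (if I.tgt e = v then (f e : ℤ) else 0))

/-- The value of a flow from `X` to `Y`. -/
def val (f : Fin I.m → ℕ) : ℤ := ∑ v ∈ I.X, I.excess f v

/-- Flow conservation outside `X ∪ Y`. -/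
def Conserves (f : Fin I.m → ℕ) : Prop := ∀ v, v ∉ I.X → v ∉ I.Y → I.excess f v = 0

/-- A flow in the network in which the arcs of `und` have infinite capacity and the others unit
capacity. -/
structure IsFlow (und : Finset (Fin I.m)) (f : Fin I.m → ℕ) : Prop where
  cap : ∀ e, e ∉ und → f e ≤ 1
  cons : I.Conserves f

/-- A vertex set containing `X` but nothing of `Y`, all of whose outgoing arcs carry one unit of
flow and all of whose incoming arcs carry none. -/
structure SatCut (f : Fin I.m → ℕ) (A : Finset (Fin I.n)) : Prop where
  X_sub : I.X ⊆ A
  disj : Disjoint A I.Y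
  out : ∀ e, I.src e ∈ A → I.tgt e ∉ A → f e = 1
  inn : ∀ e, I.src e ∉ A → I.tgt e ∈ A → f e = 0

/-- A vertex set containing `Y` that no arc of the residual network enters. -/
structure Closed (und : Finset (Fin I.m)) (f : Fin I.m → ℕ) (W : Finset (Fin I.n)) : Prop where
  Y_sub : I.Y ⊆ W
  fwd : ∀ e, I.tgt e ∈ W → (e ∈ und ∨ f e = 0) → I.src e ∈ W
  bwd : ∀ e, I.src e ∈ W → f e ≠ 0 → I.tgt e ∈ W

/-- The labels are distinct and less than `k` on every small saturated cut. -/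
def LabOK (f lab : Fin I.m → ℕ) : Prop :=
  ∀ A, I.SatCut f A → (I.outArcs A).card ≤ I.k →
    Set.InjOn lab (I.outArcs A) ∧ ∀ e ∈ I.outArcs A, lab e < I.k

variable {I}

theorem mem_outArcs {A : Finset (Fin I.n)} {e : Fin I.m} :
    e ∈ I.outArcs A ↔ I.src e ∈ A ∧ I.tgt e ∉ A := by simp [outArcs]

theorem X_sub_reach (C : Finset (Fin I.m)) {x : Fin I.n} (hx : x ∈ I.X) : x ∈ I.reach C :=
  ⟨x, hx, .refl⟩

theorem reach_step {C : Finset (Fin I.m)} {e : Fin I.m} (he : e ∉ C) (h : I.src e ∈ I.reach C) :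
    I.tgt e ∈ I.reach C := by
  obtain ⟨x, hx, hp⟩ := h
  exact ⟨x, hx, hp.tail ⟨e, he, rfl, rfl⟩⟩

theorem reach_subset {C : Finset (Fin I.m)} {S : Set (Fin I.n)} (hX : ∀ x ∈ I.X, x ∈ S)
    (h : ∀ e, e ∉ C → I.src e ∈ S → I.tgt e ∈ S) : I.reach C ⊆ S := by
  rintro v ⟨x, hx, hp⟩
  induction hp with
  | refl => exact hX x hx
  | tail _ hs ih =>
    obtain ⟨e, he, rfl, rfl⟩ := hs
    exact h e he ih

theorem isCut_of_outArcs {C : Finset (Fin I.m)} {A : Finset (Fin I.n)} (hX : I.X ⊆ A)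
    (hY : Disjoint A I.Y) (h : I.outArcs A ⊆ C) : I.IsCut C := by
  intro y hy hr
  have : I.reach C ⊆ (A : Set (Fin I.n)) := reach_subset (fun x hx => hX hx) fun e he hs => by
    by_contra ht
    exact he (h (mem_outArcs.2 ⟨hs, ht⟩))
  exact Finset.disjoint_left.1 hY (this hr) hy

open Classical in
/-- The set of reachable vertices as a finset. -/
noncomputable def reachF (C : Finset (Fin I.m)) : Finset (Fin I.n) :=
  univ.filter (· ∈ I.reach C)

theorem mem_reachF {C : Finset (Fin I.m)} {v : Fin I.n} : v ∈ reachF C ↔ v ∈ I.reach C := by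
  simp [reachF]

theorem outArcs_reachF (C : Finset (Fin I.m)) : I.outArcs (reachF C) ⊆ C := by
  intro e he
  rw [mem_outArcs, mem_reachF, mem_reachF] at he
  by_contra hc
  exact he.2 (reach_step hc he.1)

theorem disjoint_reachF {C : Finset (Fin I.m)} (h : I.IsCut C) : Disjoint (reachF C) I.Y :=
  Finset.disjoint_left.2 fun v hv hy => h v hy (mem_reachF.1 hv)

theorem X_sub_reachF (C : Finset (Fin I.m)) : I.X ⊆ reachF C := fun _ hx =>
  mem_reachF.2 (X_sub_reach C hx)

theorem exists_minimal_cut {D : Finset (Fin I.m)} (h : I.IsCut D) :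
    ∃ C ⊆ D, I.IsMinimalCut C := by
  induction D using Finset.strongInduction with
  | _ D ih =>
    by_cases hm : ∃ E, E ⊂ D ∧ I.IsCut E
    · obtain ⟨E, hE, hc⟩ := hm
      obtain ⟨C, hC, hm⟩ := ih E hE hc
      exact ⟨C, hC.trans hE.subset, hm⟩
    · exact ⟨D, Subset.rfl, h, fun E hE hc => hm ⟨E, hE, hc⟩⟩

/-- Between `X` and `A` the excess vanishes, so the value is the total excess of `A`, in which the
contributions of arcs inside `A` cancel. -/
theorem val_eq {f : Fin I.m → ℕ} (hf : I.Conserves f) {A : Finset (Fin I.n)} (hX : I.X ⊆ A)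
    (hY : Disjoint A I.Y) : I.val f = ∑ e ∈ I.outArcs A, (f e : ℤ) -
      ∑ e with I.src e ∉ A ∧ I.tgt e ∈ A, (f e : ℤ) := by
  have h1 : I.val f = ∑ v ∈ A, I.excess f v :=
    Finset.sum_subset hX fun v hv hx => hf v hx (Finset.disjoint_left.1 hY hv)
  rw [h1]
  simp only [excess, outArcs]
  rw [Finset.sum_comm, Finset.sum_filter, Finset.sum_filter, ← Finset.sum_sub_distrib]
  refine Finset.sum_congr rfl fun e _ => ?_
  rw [Finset.sum_sub_distrib, Finset.sum_ite_eq, Finset.sum_ite_eq]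
  by_cases h1 : I.src e ∈ A <;> by_cases h2 : I.tgt e ∈ A <;> simp [h1, h2]

theorem SatCut.val_eq_sum {f u : Fin I.m → ℕ} {A : Finset (Fin I.n)} (h : I.SatCut f A)
    (hu : I.Conserves u) (huf : ∀ e, u e ≤ f e) : I.val u = ∑ e ∈ I.outArcs A, (u e : ℤ) := by
  rw [val_eq hu h.X_sub h.disj]
  have : ∑ e with I.src e ∉ A ∧ I.tgt e ∈ A, (u e : ℤ) = 0 := by
    refine Finset.sum_eq_zero fun e he => ?_
    simp only [Finset.mem_filter, Finset.mem_univ, true_and] at he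
    have := huf e
    rw [h.inn e he.1 he.2] at this
    simpa using this
  rw [this, sub_zero]

theorem SatCut.val_eq_card {f : Fin I.m → ℕ} {A : Finset (Fin I.n)} (h : I.SatCut f A)
    (hf : I.Conserves f) : I.val f = (I.outArcs A).card := by
  have h1 : ∀ e ∈ I.outArcs A, (f e : ℤ) = 1 := fun e he => by
    rw [mem_outArcs] at he
    rw [h.out e he.1 he.2, Nat.cast_one]
  rw [h.val_eq_sum hf fun _ => le_rfl, Finset.sum_congr rfl h1]
  simp

/-- Weak duality at the set reachable without `C`: the arcs leaving it belong to `C` and hence have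
unit capacity. -/
theorem IsFlow.val_le_card {und : Finset (Fin I.m)} {f : Fin I.m → ℕ} (hf : I.IsFlow und f)
    {C : Finset (Fin I.m)} (hC : I.IsCut C) (hd : Disjoint C und) : I.val f ≤ C.card := by
  rw [val_eq hf.cons (X_sub_reachF C) (disjoint_reachF hC)]
  have h1 : ∑ e ∈ I.outArcs (reachF C), (f e : ℤ) ≤ ∑ e ∈ I.outArcs (reachF C), 1 := by
    refine Finset.sum_le_sum fun e he => ?_
    exact_mod_cast hf.cap e (Finset.disjoint_left.1 hd (outArcs_reachF C he))
  have h2 : 0 ≤ ∑ e with I.src e ∉ reachF C ∧ I.tgt e ∈ reachF C, (f e : ℤ) :=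
    Finset.sum_nonneg fun _ _ => by positivity
  have h3 := Finset.card_le_card (outArcs_reachF C)
  simp only [Finset.sum_const, nsmul_eq_mul, mul_one] at h1
  have : ((I.outArcs (reachF C)).card : ℤ) ≤ C.card := by exact_mod_cast h3
  linarith

/-- The converse half of max-flow min-cut: an arc into `W` from outside that is not saturated, or an
arc out of `W` that carries flow, would be a residual arc entering `W`. -/
theorem Closed.satCut {und : Finset (Fin I.m)} {f : Fin I.m → ℕ} {W : Finset (Fin I.n)}
    (hW : I.Closed und f W) (hf : I.IsFlow und f) (hX : Disjoint I.X W) : I.SatCut f Wᶜ := by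
  refine ⟨fun x hx => by simpa using Finset.disjoint_left.1 hX hx,
    Finset.disjoint_left.2 fun v hv hy => (Finset.mem_compl.1 hv) (hW.Y_sub hy), ?_, ?_⟩
  · intro e hs ht
    simp only [Finset.mem_compl, not_not] at hs ht
    have h1 : ¬ (e ∈ und ∨ f e = 0) := fun h => hs (hW.fwd e ht h)
    push Not at h1
    have := hf.cap e h1.1
    omega
  · intro e hs ht
    simp only [Finset.mem_compl, not_not] at hs ht
    by_contra h
    exact ht (hW.bwd e hs h)

theorem Closed.outArcs_disjoint {und : Finset (Fin I.m)} {f : Fin I.m → ℕ}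
    {W : Finset (Fin I.n)} (hW : I.Closed und f W) : Disjoint (I.outArcs Wᶜ) und := by
  refine Finset.disjoint_left.2 fun e he hu => ?_
  simp only [mem_outArcs, Finset.mem_compl, not_not] at he
  exact he.1 (hW.fwd e he.2 (.inl hu))

theorem SatCut.isCut {f : Fin I.m → ℕ} {A : Finset (Fin I.n)} (h : I.SatCut f A) :
    I.IsCut (I.outArcs A) := isCut_of_outArcs h.X_sub h.disj Subset.rfl

/-- A cut properly contained in it would also avoid `und` but have fewer arcs than the value of the
flow. -/
theorem SatCut.isMinimalCut {und : Finset (Fin I.m)} {f : Fin I.m → ℕ} {A : Finset (Fin I.n)}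
    (h : I.SatCut f A) (hf : I.IsFlow und f) (hd : Disjoint (I.outArcs A) und) :
    I.IsMinimalCut (I.outArcs A) := by
  refine ⟨h.isCut, fun D hD hc => ?_⟩
  have h1 := hf.val_le_card hc (hd.mono_left hD.subset)
  rw [h.val_eq_card hf.cons] at h1
  have := Finset.card_lt_card hD
  omega

theorem card_le_of_subset_colored {C : Finset (Fin I.m)} (h : I.BudgetRespecting C) :
    C.card ≤ ∑ i, (C ∩ I.color i).card ∧ ∑ i, (C ∩ I.color i).card ≤ I.k := by
  refine ⟨?_, Finset.sum_le_sum fun i _ => h.2 i⟩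
  have : C ⊆ univ.biUnion fun i => C ∩ I.color i := by
    intro e he
    have := h.1 he
    simp only [colored, Finset.mem_biUnion, Finset.mem_univ, true_and] at this ⊢
    obtain ⟨i, hi⟩ := this
    exact ⟨i, Finset.mem_inter.2 ⟨he, hi⟩⟩
  exact (Finset.card_le_card this).trans Finset.card_biUnion_le

/-- If every color of an arc in a minimum cut also occurs on an arc of `C` with the same label in
front of that cut, and `C` is important, then `C` is that cut. -/
theorem Important.eq_outArcs {Z C : Finset (Fin I.m)} (hZ : Z ⊆ I.colored) (hC : I.Important Z C)
    {f lab : Fin I.m → ℕ} {A : Finset (Fin I.n)} (hA : I.SatCut f A) (hBZ : I.outArcs A ⊆ Z)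
    (hinj : Set.InjOn lab (I.outArcs A))
    (hconf : ∀ b ∈ I.outArcs A, ∀ i, b ∈ I.color i →
      ∃ e ∈ C, I.src e ∈ A ∧ lab e = lab b ∧ e ∈ I.color i) : C = I.outArcs A := by
  classical
  obtain ⟨⟨hmin, hCZ, hCcol, hbud⟩, himp⟩ := hC
  set R := reachF C with hR
  -- The cut `outArcs S` is at least as far from `X` as `C`; the remaining task is to compare its
  -- color counts with those of `C`.
  set S := A ∪ R with hS
  have hcov : I.outArcs S ⊆ C ∪ I.outArcs A := by
    intro e he
    simp only [mem_outArcs, hS, Finset.mem_union, not_or] at he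
    rcases he.1 with h | h
    · exact Finset.mem_union_right _ (mem_outArcs.2 ⟨h, he.2.1⟩)
    · exact Finset.mem_union_left _ (outArcs_reachF C (mem_outArcs.2 ⟨h, he.2.2⟩))
  -- An arc of `C` that is charged for `b` has its head in `A`. Otherwise it would lie in the
  -- minimum cut with the label of `b`, hence be `b`, which is not in `C`.
  have hlost : ∀ b ∈ I.outArcs A, b ∉ C → ∀ e ∈ C, I.src e ∈ A → lab e = lab b → I.tgt e ∈ A := by
    intro b hb hbC e he hs hl
    by_contra ht
    have := hinj (mem_outArcs.2 ⟨hs, ht⟩) hb hl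
    exact hbC (this ▸ he)
  have hcount : ∀ i, (I.outArcs S ∩ I.color i).card ≤ (C ∩ I.color i).card := by
    intro i
    -- The hypotheses on `b` are put under the existential quantifier so that the choice function is
    -- total; elsewhere its value is the irrelevant `b`.
    have hex : ∀ b, ∃ e, b ∈ I.outArcs A → b ∉ C → b ∈ I.color i →
        e ∈ C ∧ I.src e ∈ A ∧ lab e = lab b ∧ e ∈ I.color i := by
      intro b
      by_cases hb : b ∈ I.outArcs A ∧ b ∈ I.color i
      · obtain ⟨e, h⟩ := hconf b hb.1 i hb.2
        exact ⟨e, fun _ _ _ => h⟩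
      · exact ⟨b, fun h1 _ h3 => absurd ⟨h1, h3⟩ hb⟩
    choose g hg using hex
    -- Arcs of `C` are kept and the others are charged to `g b`. The two kinds of images are
    -- distinct because `g b` ends inside `S` and so does not leave it; two charged arcs are told
    -- apart by their labels.
    refine Finset.card_le_card_of_injOn (fun b => if b ∈ C then b else g b) ?_ ?_
    · intro b hb
      have hb' := Finset.mem_inter.1 hb
      dsimp only
      split_ifs with hbC
      · exact Finset.mem_inter.2 ⟨hbC, hb'.2⟩
      · have := hg b ((Finset.mem_union.1 (hcov hb'.1)).resolve_left hbC) hbC hb'.2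
        exact Finset.mem_inter.2 ⟨this.1, this.2.2.2⟩
    · have hmix : ∀ a ∈ I.outArcs S ∩ I.color i, ∀ b ∈ I.outArcs S ∩ I.color i, a ∈ C → b ∉ C →
          a ≠ g b := by
        intro a ha b hb haC hbC hab
        have hb' := Finset.mem_inter.1 hb
        have hbA := (Finset.mem_union.1 (hcov hb'.1)).resolve_left hbC
        have h1 := hg b hbA hbC hb'.2
        have h2 := hlost b hbA hbC _ h1.1 h1.2.1 h1.2.2.1
        rw [← hab] at h2
        exact (mem_outArcs.1 (Finset.mem_inter.1 ha).1).2 (Finset.mem_union_left _ h2)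
      intro a ha b hb hab
      dsimp only at hab
      split_ifs at hab with h1 h2 h2
      · exact hab
      · exact absurd hab (hmix a ha b hb h1 h2)
      · exact absurd hab.symm (hmix b hb a ha h2 h1)
      · have ha' := Finset.mem_inter.1 ha
        have hb' := Finset.mem_inter.1 hb
        have haA := (Finset.mem_union.1 (hcov ha'.1)).resolve_left h1
        have hbA := (Finset.mem_union.1 (hcov hb'.1)).resolve_left h2
        have e1 := hg a haA h1 ha'.2
        have e2 := hg b hbA h2 hb'.2
        refine hinj haA hbA ?_
        rw [← e1.2.2.1, ← e2.2.2.1, hab]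
  have hScut : I.IsCut (I.outArcs S) := by
    refine isCut_of_outArcs (hA.X_sub.trans Finset.subset_union_left) ?_ Subset.rfl
    exact Finset.disjoint_union_left.2 ⟨hA.disj, disjoint_reachF hmin.1⟩
  obtain ⟨D, hDS, hD⟩ := exists_minimal_cut hScut
  have hDZ : D ⊆ Z := (hDS.trans hcov).trans (Finset.union_subset hCZ hBZ)
  have hDcount : ∀ i, (D ∩ I.color i).card ≤ (C ∩ I.color i).card := fun i =>
    (Finset.card_le_card (Finset.inter_subset_inter_right hDS)).trans (hcount i)
  have hDadm : I.Admissible Z D :=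
    ⟨hD, hDZ, hDZ.trans hZ, fun i => (hDcount i).trans (hbud i)⟩
  have hdom : I.Dominates D C := by
    refine ⟨?_, hDcount⟩
    -- The arcs of `D` leave `S ⊇ R`, whereas an arc outside `C` with tail in `R` ends in `R`. So
    -- deleting `D` does not obstruct the paths that avoid `C`.
    have hstay : ∀ e, e ∉ C → I.src e ∈ I.reach C → e ∉ D := by
      intro e he hs hd
      refine (mem_outArcs.1 (hDS hd)).2 (Finset.mem_union_right _ (mem_reachF.2 ?_))
      exact reach_step he hs
    have : I.reach C ⊆ I.reach C ∩ I.reach D :=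
      reach_subset (fun x hx => ⟨X_sub_reach C hx, X_sub_reach D hx⟩) fun e he hs =>
        ⟨reach_step he hs.1, reach_step (hstay e he hs.1) hs.2⟩
    exact fun v hv => (this hv).2
  have hDC : D = C := by
    by_contra h
    exact himp D hDadm h hdom
  rw [hDC] at hDS
  -- Now `C = D` consists of arcs leaving `S`. An arc of the minimum cut outside `C` would be
  -- charged to an arc of `C` that ends in `A`, which is impossible.
  have hBC : I.outArcs A ⊆ C := by
    intro b hb
    by_contra hbC
    have hcol := (hBZ.trans hZ) hb
    simp only [colored, Finset.mem_biUnion, Finset.mem_univ, true_and] at hcol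
    obtain ⟨i, hi⟩ := hcol
    obtain ⟨e, he, hs, hl, -⟩ := hconf b hb i hi
    exact (mem_outArcs.1 (hDS he)).2
      (Finset.mem_union_left _ (hlost b hb hbC e he hs hl))
  by_contra hne
  exact hmin.2 _ (Finset.ssubset_iff_subset_ne.2 ⟨hBC, fun h => hne h.symm⟩) hA.isCut

theorem val_augment {f f' : Fin I.m → ℕ} {x y : Fin I.n} (hx : x ∈ I.X) (hy : y ∈ I.Y)
    (h : ∀ v, I.excess f' v = I.excess f v + (if v = x then 1 else 0) - (if v = y then 1 else 0)) :
    I.val f' = I.val f + 1 := by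
  have hyX : y ∉ I.X := fun h' => Finset.disjoint_left.1 I.disjoint_XY h' hy
  simp only [val, h, Finset.sum_sub_distrib, Finset.sum_add_distrib, Finset.sum_ite_eq', hx, hyX,
    if_true, if_false, sub_zero]

theorem Conserves.augment {f f' : Fin I.m → ℕ} {x y : Fin I.n} (hf : I.Conserves f)
    (hx : x ∈ I.X) (hy : y ∈ I.Y)
    (h : ∀ v, I.excess f' v = I.excess f v + (if v = x then 1 else 0) - (if v = y then 1 else 0)) :
    I.Conserves f' := by
  intro v hvX hvY
  have h1 : v ≠ x := fun h => hvX (h ▸ hx)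
  have h2 : v ≠ y := fun h => hvY (h ▸ hy)
  simp [h, hf v hvX hvY, h1, h2]

/-- State of the path decomposition of the flow `f` when `j` paths have been looked for: `u` is the
part of the flow covered so far. -/
structure Decomp (f u lab : Fin I.m → ℕ) (j : ℕ) : Prop where
  le : ∀ e, u e ≤ f e
  cons : I.Conserves u
  val : (j : ℤ) ≤ I.val u ∨ I.val f ≤ I.val u
  lab : ∀ A, I.SatCut f A → (I.outArcs A).card ≤ I.k →
    (∀ e ∈ I.outArcs A, u e ≠ 0 → lab e < j) ∧
    ∀ e ∈ I.outArcs A, u e ≠ 0 → ∀ e' ∈ I.outArcs A, u e' ≠ 0 → lab e = lab e' → e = e'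

theorem Decomp.zero {f lab : Fin I.m → ℕ} : Decomp f (fun _ => 0) lab 0 where
  le := by simp
  cons := by intro v _ _; simp [excess]
  val := .inl (by simp [MBCut.val, excess])
  lab := by simp

/-- A saturated cut with at most `k` arcs forces the flow value to be at most `k`, so after `k`
attempts the covered part has the full value. Then it uses every arc of the cut. -/
theorem Decomp.labOK {f u lab : Fin I.m → ℕ} (h : Decomp f u lab I.k) (hf : I.Conserves f) :
    I.LabOK f lab := by
  intro A hA hk
  have hv : I.val f ≤ I.val u := by
    rcases h.val with h' | h'
    · rw [hA.val_eq_card hf]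
      have : ((I.outArcs A).card : ℤ) ≤ I.k := by exact_mod_cast hk
      exact this.trans h'
    · exact h'
  have hu : ∀ e ∈ I.outArcs A, u e ≠ 0 := by
    intro e he h0
    have he' := mem_outArcs.1 he
    rw [hA.val_eq_sum hf fun _ => le_rfl, hA.val_eq_sum h.cons h.le] at hv
    have : ∑ e ∈ I.outArcs A, (u e : ℤ) < ∑ e ∈ I.outArcs A, (f e : ℤ) := by
      refine Finset.sum_lt_sum (fun e _ => by exact_mod_cast h.le e) ⟨e, he, ?_⟩
      rw [h0, hA.out e he'.1 he'.2]
      norm_num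
    omega
  obtain ⟨h1, h2⟩ := h.lab A hA hk
  exact ⟨fun e he e' he' hl => h2 e he (hu e he) e' he' (hu e' he') hl, fun e he => h1 e he (hu e he)⟩

/-- If no path of uncovered flow is left, then `u = f` on the arcs entering `W` and `u ≤ f` on those
leaving it. Comparing across this cut gives `u` at least the value of `f`. -/
theorem Decomp.fail {f u lab : Fin I.m → ℕ} {j : ℕ} (h : Decomp f u lab j) (hf : I.Conserves f)
    {W : Finset (Fin I.n)} (hY : I.Y ⊆ W) (hX : Disjoint I.X W)
    (hW : ∀ e, I.tgt e ∈ W → u e < f e → I.src e ∈ W) : Decomp f u lab (j + 1) := by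
  refine ⟨h.le, h.cons, .inr ?_, fun A hA hk => ?_⟩
  · have hXA : I.X ⊆ Wᶜ := fun x hx => by simpa using Finset.disjoint_left.1 hX hx
    have hYA : Disjoint Wᶜ I.Y :=
      Finset.disjoint_left.2 fun v hv hy => (Finset.mem_compl.1 hv) (hY hy)
    rw [val_eq hf hXA hYA, val_eq h.cons hXA hYA]
    refine sub_le_sub (Finset.sum_le_sum fun e he => ?_)
      (Finset.sum_le_sum fun e _ => by exact_mod_cast h.le e)
    simp only [mem_outArcs, Finset.mem_compl, not_not] at he
    have : ¬ u e < f e := fun h' => he.1 (hW e he.2 h')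
    exact_mod_cast not_lt.1 this
  · obtain ⟨h1, h2⟩ := h.lab A hA hk
    exact ⟨fun e he hu => (h1 e he hu).trans (Nat.lt_succ_self _), h2⟩

/-- The new path raises the value by one, and no flow enters a saturated set, so the path crosses
each saturated cut exactly once. The arc crossed had flow one and was uncovered, so no older label
on the cut is overwritten. -/
theorem Decomp.succ {f u u' lab lab' : Fin I.m → ℕ} {j : ℕ} (h : Decomp f u lab j)
    {x y : Fin I.n} (hx : x ∈ I.X) (hy : y ∈ I.Y)
    (hex : ∀ v, I.excess u' v = I.excess u v + (if v = x then 1 else 0) - (if v = y then 1 else 0))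
    (harc : ∀ e, (u' e = u e ∧ lab' e = lab e) ∨ (u e < f e ∧ u' e = u e + 1 ∧ lab' e = j)) :
    Decomp f u' lab' (j + 1) := by
  have hle : ∀ e, u' e ≤ f e := fun e => by
    have := h.le e
    rcases harc e with ⟨h1, -⟩ | ⟨h1, h2, -⟩ <;> omega
  have hcons := h.cons.augment hx hy hex
  have hval := val_augment hx hy hex
  refine ⟨hle, hcons, ?_, fun A hA hk => ?_⟩
  · rcases h.val with h' | h'
    · left; push_cast; omega
    · right; omega
  · obtain ⟨h1, h2⟩ := h.lab A hA hk
    have hf1 : ∀ e ∈ I.outArcs A, f e = 1 := fun e he =>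
      hA.out e (mem_outArcs.1 he).1 (mem_outArcs.1 he).2
    rw [hA.val_eq_sum hcons hle, hA.val_eq_sum h.cons h.le] at hval
    -- Two arcs of the cut that both gain a unit would raise the covered flow through it by two.
    have hone : ∀ e ∈ I.outArcs A, u' e = u e + 1 → ∀ e' ∈ I.outArcs A, u' e' = u e' + 1 →
        e = e' := by
      intro e he hue e' he' hue'
      by_contra hne
      have hsub : ({e, e'} : Finset (Fin I.m)) ⊆ I.outArcs A := by
        intro a ha
        simp only [Finset.mem_insert, Finset.mem_singleton] at ha
        rcases ha with rfl | rfl <;> assumption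
      have hd : ∑ e ∈ I.outArcs A, ((u' e : ℤ) - u e) = 1 := by
        rw [Finset.sum_sub_distrib, hval]; ring
      have hge : ∑ a ∈ ({e, e'} : Finset (Fin I.m)), ((u' a : ℤ) - u a) ≤
          ∑ e ∈ I.outArcs A, ((u' e : ℤ) - u e) := by
        refine Finset.sum_le_sum_of_subset_of_nonneg hsub fun a _ _ => ?_
        rcases harc a with ⟨h, -⟩ | ⟨-, h, -⟩ <;> rw [h] <;> simp
      rw [Finset.sum_pair hne, hd, hue, hue'] at hge
      push_cast at hge
      omega
    have hnew : ∀ e, u' e ≠ 0 → (u e ≠ 0 ∧ lab' e = lab e) ∨ (u' e = u e + 1 ∧ lab' e = j) := by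
      intro e he
      rcases harc e with ⟨a, b⟩ | ⟨-, a, b⟩
      · exact .inl ⟨a ▸ he, b⟩
      · exact .inr ⟨a, b⟩
    refine ⟨fun e he hu => ?_, fun e he hu e' he' hu' hl => ?_⟩
    · rcases hnew e hu with ⟨a, b⟩ | ⟨a, b⟩
      · rw [b]; exact (h1 e he a).trans (Nat.lt_succ_self _)
      · omega
    · rcases hnew e hu with ⟨a, b⟩ | ⟨a, b⟩ <;> rcases hnew e' hu' with ⟨a', b'⟩ | ⟨a', b'⟩
      · exact h2 e he a e' he' a' (by rw [← b, ← b', hl])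
      · have := h1 e he a; omega
      · have := h1 e' he' a'; omega
      · exact hone e he a e' he' a'

/-- The (label, color) pairs, coded as numbers, that occur on the arcs of `C` with tail in `A`. -/
def pairs (C : Finset (Fin I.m)) (lab : Fin I.m → ℕ) (A : Finset (Fin I.n)) : Finset ℕ :=
  (univ.filter fun a : Fin I.m × Fin I.numColors =>
    a.1 ∈ C ∧ a.1 ∈ I.color a.2 ∧ I.src a.1 ∈ A ∧ lab a.1 < I.k).image
      fun a => lab a.1 * I.numColors + a.2

theorem mem_pairs {C : Finset (Fin I.m)} {lab : Fin I.m → ℕ} {A : Finset (Fin I.n)} {p : ℕ} :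
    p ∈ pairs C lab A ↔ ∃ e ∈ C, I.src e ∈ A ∧ lab e < I.k ∧ ∃ i, e ∈ I.color i ∧
      lab e * I.numColors + i = p := by
  simp only [pairs, Finset.mem_image, Finset.mem_filter, Finset.mem_univ, true_and, Prod.exists]
  constructor
  · rintro ⟨e, i, ⟨h1, h2, h3, h4⟩, rfl⟩
    exact ⟨e, h1, h3, h4, i, h2, rfl⟩
  · rintro ⟨e, h1, h3, h4, i, h2, rfl⟩
    exact ⟨e, i, ⟨h1, h2, h3, h4⟩, rfl⟩

theorem pairs_mono {C : Finset (Fin I.m)} {lab : Fin I.m → ℕ} {A A' : Finset (Fin I.n)}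
    (h : A ⊆ A') : pairs C lab A ⊆ pairs C lab A' := by
  intro p hp
  rw [mem_pairs] at hp ⊢
  obtain ⟨e, h1, h2, h3⟩ := hp
  exact ⟨e, h1, h h2, h3⟩

/-- A pair comes from an arc of `C` together with one of its colors, and there are at most as many
of these as the budgets allow. Multicolored arcs are thus counted once per color, which the total
budget pays for. -/
theorem pairs_card {C : Finset (Fin I.m)} (hC : I.BudgetRespecting C) (lab : Fin I.m → ℕ)
    (A : Finset (Fin I.n)) : (pairs C lab A).card ≤ I.k := by
  refine Finset.card_image_le.trans (le_trans ?_ (card_le_of_subset_colored hC).2)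
  calc _ ≤ (univ.sigma fun i => C ∩ I.color i).card := by
        refine Finset.card_le_card_of_injOn (fun a => ⟨a.2, a.1⟩) ?_ ?_
        · intro a ha
          simp only [Finset.coe_filter, Finset.mem_univ, true_and, Set.mem_ofPred_eq] at ha
          simp [ha.1, ha.2.1]
        · rintro ⟨a, b⟩ _ ⟨c, d⟩ _ h
          simp only [Sigma.mk.injEq, heq_eq_eq] at h
          simp [h.1, h.2]
    _ = _ := Finset.card_sigma _ _

theorem numColors_le_k : I.numColors ≤ I.k := by
  have : ∑ _i : Fin I.numColors, 1 ≤ I.k := Finset.sum_le_sum fun i _ => I.one_le_budget i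
  simpa using this

theorem pairs_lt {C : Finset (Fin I.m)} {lab : Fin I.m → ℕ} {A : Finset (Fin I.n)} {p : ℕ}
    (h : p ∈ pairs C lab A) : p < I.k * I.numColors := by
  rw [mem_pairs] at h
  obtain ⟨e, -, -, hl, i, -, rfl⟩ := h
  have := i.2
  calc lab e * I.numColors + i < lab e * I.numColors + I.numColors := by omega
    _ = (lab e + 1) * I.numColors := by ring
    _ ≤ _ := Nat.mul_le_mul_right _ hl

/-- The important cut is found once the set of (label, color) pairs allows no more arcs to be made
undeletable. -/
theorem Important.eq_of_pairs {Z C und : Finset (Fin I.m)} (hZ : Z ⊆ I.colored)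
    (hC : I.Important Z C) {f lab : Fin I.m → ℕ} {W : Finset (Fin I.n)} (hf : I.IsFlow und f)
    (hW : I.Closed und f W) (hX : Disjoint I.X W) (hCu : Disjoint C und)
    (hund : ∀ e, e ∉ und → e ∈ Z) (hlab : I.LabOK f lab)
    (hconf : ∀ e, e ∉ und → I.src e ∉ W → lab e < I.k → ∀ i : Fin I.numColors, e ∈ I.color i →
      lab e * I.numColors + i ∈ pairs C lab Wᶜ) : C = I.outArcs Wᶜ := by
  have hA := hW.satCut hf hX
  -- Needed to apply the label property: the minimum cut is no larger than the competing cut `C`,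
  -- which has at most `k` arcs.
  have hcard : (I.outArcs Wᶜ).card ≤ I.k := by
    have h1 := hf.val_le_card hC.1.1.1 hCu
    rw [hA.val_eq_card hf.cons] at h1
    have h2 := card_le_of_subset_colored hC.1.2.2
    omega
  obtain ⟨hinj, hlt⟩ := hlab _ hA hcard
  have hdisj := hW.outArcs_disjoint
  refine hC.eq_outArcs hZ hA (fun e he => hund e (Finset.disjoint_left.1 hdisj he)) hinj ?_
  intro b hb i hi
  have hbA := mem_outArcs.1 hb
  have := hconf b (Finset.disjoint_left.1 hdisj hb) (Finset.mem_compl.1 hbA.1) (hlt b hb) i hi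
  rw [mem_pairs] at this
  obtain ⟨e, heC, hs, -, i', hi', heq⟩ := this
  have hpos : 0 < I.numColors := i.pos
  -- Division by `numColors` recovers the label from the code of a pair; the remainder is the color.
  have hl : lab e = lab b := by
    have := congrArg (· / I.numColors) heq
    simpa [Nat.add_div_of_dvd_right, mul_comm _ I.numColors, Nat.mul_add_div hpos,
      Nat.div_eq_of_lt i.2, Nat.div_eq_of_lt i'.2] using this
  have hii : i' = i := by
    rw [hl] at heq
    exact Fin.ext (by omega)
  exact ⟨e, heC, hs, hl, hii ▸ hi'⟩

end MBCut

-- Layout of registers and arrays: registers `9` to `26` and arrays `10` to `19` are working memory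

notation "rN" => (0 : ℕ)
notation "rM" => (1 : ℕ)
notation "rL" => (2 : ℕ)
notation "rK" => (3 : ℕ)
notation "rCol" => (4 : ℕ)
notation "rHalf" => (5 : ℕ)
notation "rPairs" => (6 : ℕ)
notation "rLen" => (7 : ℕ)
notation "rBound" => (8 : ℕ)
notation "rI" => (9 : ℕ)
notation "rJ" => (10 : ℕ)
notation "rE" => (11 : ℕ)
notation "rMe" => (12 : ℕ)
notation "rQ" => (13 : ℕ)
notation "rP" => (14 : ℕ)
notation "rV" => (15 : ℕ)
notation "rH" => (16 : ℕ)
notation "rU" => (17 : ℕ)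
notation "rQh" => (18 : ℕ)
notation "rQt" => (19 : ℕ)
notation "rFound" => (20 : ℕ)
notation "rChg" => (21 : ℕ)
notation "rLab" => (22 : ℕ)
notation "rPos" => (23 : ℕ)
notation "rSym" => (24 : ℕ)
notation "rCnt" => (25 : ℕ)
notation "rGood" => (26 : ℕ)

notation "aIn" => (0 : ℕ)
notation "aSrc" => (1 : ℕ)
notation "aTgt" => (2 : ℕ)
notation "aX" => (3 : ℕ)
notation "aY" => (4 : ℕ)
notation "aZ" => (5 : ℕ)
notation "aHead" => (6 : ℕ)
notation "aNext" => (7 : ℕ)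
notation "aArc" => (8 : ℕ)
notation "aAdv" => (9 : ℕ)
notation "aUnd" => (10 : ℕ)
notation "aFlow" => (11 : ℕ)
notation "aLab" => (12 : ℕ)
notation "aSet" => (13 : ℕ)
notation "aOk" => (14 : ℕ)
notation "aVis" => (15 : ℕ)
notation "aPar" => (16 : ℕ)
notation "aQueue" => (17 : ℕ)
notation "aUsed" => (18 : ℕ)
notation "aCut" => (19 : ℕ)

open RamProg RamExpr

/-! ### Adjacency lists and breadth-first search towards `Y` -/

/-- `p` codes a linked list with successor function `nx` and entries `l`. -/
def Chain (nx : ℕ → ℕ) : ℕ → List ℕ → Prop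
  | p, [] => p = 0
  | p, h :: l => p = h + 1 ∧ Chain nx (nx h) l

theorem Chain.update {nx : ℕ → ℕ} {p h x : ℕ} {l : List ℕ} (hc : Chain nx p l) (hh : h ∉ l) :
    Chain (Function.update nx h x) p l := by
  induction l generalizing p with
  | nil => exact hc
  | cons a l ih =>
    obtain ⟨h1, h2⟩ := hc
    simp only [List.mem_cons, not_or] at hh
    exact ⟨h1, by rw [Function.update_of_ne (Ne.symm hh.1)]; exact ih h2 hh.2⟩

/-- The half arcs below `M` with head `v`, the last one first. -/
def adj (T : ℕ → ℕ) (M v : ℕ) : List ℕ := ((List.range M).filter (T · = v)).reverse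

theorem mem_adj {T : ℕ → ℕ} {M v h : ℕ} : h ∈ adj T M v ↔ h < M ∧ T h = v := by
  simp [adj]

theorem adj_succ (T : ℕ → ℕ) (M v : ℕ) :
    adj T (M + 1) v = if T M = v then M :: adj T M v else adj T M v := by
  simp only [adj, List.range_succ, List.filter_append, List.reverse_append]
  split_ifs with h <;> simp [h]

/-- Each half arc is in at most one of the lists. This makes the total cost of a search linear. -/
theorem sum_adj (T : ℕ → ℕ) (n M : ℕ) :
    ∑ v ∈ Finset.range n, (adj T M v).length ≤ M := by
  induction M with
  | zero => simp [adj]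
  | succ M ih =>
    have : ∀ v, (adj T (M + 1) v).length = (adj T M v).length + if T M = v then 1 else 0 := by
      intro v; rw [adj_succ]; split_ifs <;> simp
    simp only [this, Finset.sum_add_distrib]
    have : ∑ v ∈ Finset.range n, (if T M = v then 1 else 0) ≤ 1 := by
      rw [Finset.sum_ite_eq]; split_ifs <;> simp
    omega

/-- The array `a` starts with the entries of `l`. -/
def StoresList (a : ℕ → ℕ) (l : List ℕ) : Prop := ∀ i (h : i < l.length), a i = l[i]

theorem StoresList.push {a : ℕ → ℕ} {l : List ℕ} (h : StoresList a l) (x : ℕ) :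
    StoresList (Function.update a l.length x) (l ++ [x]) := by
  intro i hi
  rw [List.getElem_append]
  split_ifs with h'
  · rw [Function.update_of_ne h'.ne]; exact h i h'
  · simp only [List.length_append, List.length_singleton] at hi
    obtain rfl : i = l.length := by omega
    simp

/-- What the search needs to know about the graph. -/
structure SearchPre (n M : ℕ) (s : RamState) : Prop where
  n_eq : s.reg rN = n
  n_lt : n < s.reg rBound
  src_lt : ∀ h < M, s.arr aSrc h < n
  tgt_lt : ∀ h < M, s.arr aTgt h < n
  chain : ∀ v < n, Chain (s.arr aNext) (s.arr aHead v) (adj (s.arr aTgt) M v)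

/-- The list `q` of vertices found so far by a search. -/
structure QueueInv (Y S T ok vis par queue : ℕ → ℕ) (qt n M : ℕ) (q : List ℕ) : Prop where
  nodup : q.Nodup
  lt : ∀ v ∈ q, v < n
  len : qt = q.length
  queue : StoresList queue q
  vis : ∀ v < n, vis v = if v ∈ q then 1 else 0
  y : ∀ v < n, Y v = 1 → v ∈ q
  par : ∀ v ∈ q, Y v = 1 ∨ (par v < M ∧ ok (par v) = 1 ∧ S (par v) = v ∧ T (par v) ∈ q ∧
    q.idxOf (T (par v)) < q.idxOf v)

theorem QueueInv.length_le {Y S T ok vis par queue : ℕ → ℕ} {qt n M : ℕ} {q : List ℕ}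
    (h : QueueInv Y S T ok vis par queue qt n M q) : q.length ≤ n := by
  have : q.toFinset ⊆ Finset.range n := fun v hv => by
    simpa using h.lt v (List.mem_toFinset.1 hv)
  simpa [List.toFinset_card_of_nodup h.nodup] using Finset.card_le_card this

/-- The new vertex goes to the end of the queue, behind the head of its parent arc. The position in
the queue is therefore a rank that decreases along the search tree. -/
theorem QueueInv.push {Y S T ok vis par queue : ℕ → ℕ} {qt n M : ℕ} {q : List ℕ}
    (hq : QueueInv Y S T ok vis par queue qt n M q) {h u : ℕ} (hh : h < M) (hok : ok h = 1)
    (hT : T h ∈ q) (hu : S h = u) (hS : u ∉ q) (hn : u < n) :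
    QueueInv Y S T ok (Function.update vis u 1) (Function.update par u h)
      (Function.update queue qt u) (qt + 1) n M (q ++ [u]) where
  nodup := by
    rw [List.nodup_append]
    exact ⟨hq.nodup, List.nodup_singleton _, fun a ha b hb h' =>
      hS (by rwa [h', List.mem_singleton.1 hb] at ha)⟩
  lt := by
    intro v hv
    simp only [List.mem_append, List.mem_singleton] at hv
    rcases hv with hv | rfl
    · exact hq.lt v hv
    · exact hn
  len := by simp [hq.len]
  queue := by rw [hq.len]; exact hq.queue.push u
  vis := by
    intro v hv
    by_cases h' : v = u
    · simp [h']
    · simp [hq.vis v hv, h']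
  y := fun v hv h' => List.mem_append_left _ (hq.y v hv h')
  par := by
    intro v hv
    simp only [List.mem_append, List.mem_singleton] at hv
    rcases hv with hv | rfl
    · have hne : v ≠ u := fun h' => hS (h' ▸ hv)
      rw [Function.update_of_ne hne]
      refine (hq.par v hv).imp_right fun ⟨a, b, c, d, e⟩ => ⟨a, b, c, List.mem_append_left _ d, ?_⟩
      rwa [List.idxOf_append_of_mem d, List.idxOf_append_of_mem hv]
    · refine .inr ?_
      rw [Function.update_self]
      refine ⟨hh, hok, hu, List.mem_append_left _ hT, ?_⟩
      rw [List.idxOf_append_of_mem hT, List.idxOf_append_of_notMem hS]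
      have := List.idxOf_lt_length_iff.2 hT
      simp only [List.idxOf_cons_self]
      omega

namespace RamProg

def initVisited : RamProg :=
  forLoop rI (reg rN) (gst aVis (reg rI) (lit 0) ;;
    ite (.eq (get aY (reg rI)) (lit 1))
      (gst aVis (reg rI) (lit 1) ;; gst aQueue (reg rQt) (reg rI) ;; set rQt (succ (reg rQt))) skip)

def scanList : RamProg :=
  loop (.lt (lit 0) (reg rP))
    (set rH (pred (reg rP)) ;; set rU (get aSrc (reg rH)) ;;
      ite (.eq (get aOk (reg rH)) (lit 1))
        (ite (.eq (get aVis (reg rU)) (lit 0))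
          (gst aVis (reg rU) (lit 1) ;; gst aPar (reg rU) (reg rH) ;;
            gst aQueue (reg rQt) (reg rU) ;; set rQt (succ (reg rQt))) skip) skip ;;
      set rP (get aNext (reg rH)))

/-- Find all vertices from which `Y` can be reached by half arcs that are marked `ok`. -/
def search : RamProg :=
  set rQt (lit 0) ;; initVisited ;; set rQh (lit 0) ;;
    loop (.lt (reg rQh) (reg rQt))
      (set rV (get aQueue (reg rQh)) ;; set rQh (succ (reg rQh)) ;; set rP (get aHead (reg rV)) ;;
        scanList)

end RamProg

theorem wp_initVisited {n : ℕ} {s : RamState} {Y : ℕ → ℕ} (hy : s.arr aY = Y)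
    (hn : s.reg rN = n) (hb : n < s.reg rBound)
    (hq : s.reg rQt = 0) :
    initVisited.wp s fun t s' => t ≤ (n + 1) * 40 ∧
      s'.reg rQt = ((List.range n).filter (Y · = 1)).length ∧
      StoresList (s'.arr aQueue) ((List.range n).filter (Y · = 1)) ∧
      ∀ v < n, s'.arr aVis v = if Y v = 1 then 1 else 0 := by
  refine wp_mono (wp_for n 34 (fun j s' =>
    s'.reg rQt = ((List.range j).filter (Y · = 1)).length ∧
      StoresList (s'.arr aQueue) ((List.range j).filter (Y · = 1)) ∧
      ∀ v < j, s'.arr aVis v = if Y v = 1 then 1 else 0) rfl ?_ ?_ ?_ ?_) ?_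
  · intro s' hF
    simpa [eval, ← hn] using hF.reg rN rfl
  · intro j s' v h
    simpa using h
  · simp [hq, StoresList]
  · rintro j s' hj hF hi ⟨h1, h2, h3⟩
    have hY : s'.arr aY = Y := (hF.arr aY rfl).trans hy
    have hB : s'.reg rBound = s.reg rBound := hF.reg rBound rfl
    refine wp_seq (wp_gst (by simp only [eval, hi]; omega) (wp_ite ?_ ?_))
    · intro hh
      simp only [RamTest.Holds, eval, RamState.write_reg, RamState.write_arr, hi] at hh
      simp only [eval, hi]
      have hlen : ((List.range j).filter (Y · = 1)).length ≤ j := by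
        simpa using List.length_filter_le (Y · = 1) (List.range j)
      refine wp_seq (wp_gst (by simp [eval, hi, hB]; omega) (wp_seq (wp_gst (by
        simp [eval, h1, hB]; omega) (wp_set ?_))))
      have hY1 : Y j = 1 := by simpa [hY] using hh
      refine ⟨by simp [cost, RamTest.cost], ?_, ?_, ?_⟩
      · simp [eval, List.range_succ, hY1, h1]
      · simp [eval, List.range_succ, hY1, h1, hi]
        exact h2.push j
      · intro v hv
        simp only [eval]
        rcases Nat.lt_succ_iff_lt_or_eq.1 hv with hv | rfl
        · simp [hi, Function.update_of_ne hv.ne, h3 v hv]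
        · simp [hi, hY1]
    · intro hh
      simp only [RamTest.Holds, eval, RamState.write_reg, RamState.write_arr, hi] at hh
      simp only [eval, hi]
      have hY1 : Y j ≠ 1 := by simpa [hY] using hh
      refine wp_skip ⟨by simp [cost, RamTest.cost], ?_, ?_, ?_⟩
      · simp [List.range_succ, hY1, h1]
      · simpa [List.range_succ, hY1] using h2
      · intro v hv
        rcases Nat.lt_succ_iff_lt_or_eq.1 hv with hv | rfl
        · simp [Function.update_of_ne hv.ne, h3 v hv]
        · simp [hY1]
  · rintro t s' - ⟨ht, h⟩
    exact ⟨ht.trans (Nat.mul_le_mul_left _ (by simp [cost])), h⟩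

/-- In the loop invariant `l` is the part of the list not scanned yet; it measures both the time
left and the half arcs whose tails need not be in the queue yet. -/
theorem wp_scanList {n M v : ℕ} {q₀ : List ℕ} {s : RamState} (hs : SearchPre n M s)
    (hp : s.reg rP = s.arr aHead v) (hv : v ∈ q₀)
    (hq : QueueInv (s.arr aY) (s.arr aSrc) (s.arr aTgt) (s.arr aOk) (s.arr aVis) (s.arr aPar)
      (s.arr aQueue) (s.reg rQt) n M q₀) :
    scanList.wp s fun t s' => t ≤ 45 * (adj (s.arr aTgt) M v).length + 3 ∧
      ∃ q, q₀ <+: q ∧ QueueInv (s.arr aY) (s.arr aSrc) (s.arr aTgt) (s.arr aOk) (s'.arr aVis)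
        (s'.arr aPar) (s'.arr aQueue) (s'.reg rQt) n M q ∧
        ∀ h < M, s.arr aOk h = 1 → s.arr aTgt h = v → s.arr aSrc h ∈ q := by
  refine wp_mono (wp_loop (fun φ s' => ∃ q l, q₀ <+: q ∧
    QueueInv (s.arr aY) (s.arr aSrc) (s.arr aTgt) (s.arr aOk) (s'.arr aVis)
        (s'.arr aPar) (s'.arr aQueue) (s'.reg rQt) n M q ∧ Chain (s.arr aNext) (s'.reg rP) l ∧
    (∀ h ∈ l, h < M ∧ s.arr aTgt h = v) ∧
    (∀ h < M, s.arr aOk h = 1 → s.arr aTgt h = v → h ∉ l → s.arr aSrc h ∈ q) ∧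
    φ = 45 * l.length) (45 * (adj (s.arr aTgt) M v).length) ?_ ?_) ?_
  · refine ⟨q₀, adj (s.arr aTgt) M v, List.prefix_rfl, hq, ?_, fun h hh => mem_adj.1 hh, ?_, rfl⟩
    · rw [hp]; exact hs.chain v (hq.lt v hv)
    · intro h h1 _ h3 h4
      exact absurd (mem_adj.2 ⟨h1, h3⟩) h4
  · rintro φ s' hF ⟨q, l, hpre, hq', hch, hl, hdone, rfl⟩ hb
    have hS : s'.arr aSrc = s.arr aSrc := hF.arr aSrc rfl
    have hO : s'.arr aOk = s.arr aOk := hF.arr aOk rfl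
    have hN : s'.arr aNext = s.arr aNext := hF.arr aNext rfl
    have hB : s'.reg rBound = s.reg rBound := hF.reg rBound rfl
    have hnb := hs.n_lt
    simp only [RamTest.Holds, eval] at hb
    match l, hch, hl, hdone with
    | [], hch, _, _ => simp only [Chain] at hch; omega
    | h :: l, ⟨hph, hch⟩, hl, hdone =>
    obtain ⟨hhM, hhv⟩ := hl h (List.mem_cons_self ..)
    have hun : s.arr aSrc h < n := hs.src_lt h hhM
    have hlen := hq'.length_le
    have hql := hq'.len
    refine wp_seq (wp_set (wp_seq (wp_set (wp_seq (wp_ite ?_ ?_)))))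
    · intro h1
      simp [RamTest.Holds, eval, hph, hO] at h1
      refine wp_ite ?_ ?_
      · intro h2
        simp [RamTest.Holds, eval, hph, hS] at h2
        have hnot : s.arr aSrc h ∉ q := by
          intro hmem
          rw [hq'.vis _ hun, if_pos hmem] at h2
          omega
        refine wp_seq (wp_gst (by simp [eval, hph, hS, hB]; omega) (wp_seq (wp_gst (by
          simp [eval, hph, hS, hB]; omega) (wp_seq (wp_gst (by simp [eval, hB]; omega)
          (wp_set (wp_set ⟨45 * l.length, ⟨q ++ [s.arr aSrc h], l, ?_, ?_, ?_, ?_, ?_, rfl⟩,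
            ?_⟩)))))))
        · exact hpre.trans (List.prefix_append ..)
        · simpa [eval, hph, hS] using
            hq'.push hhM h1 (hhv ▸ hpre.subset hv) rfl hnot hun
        · simpa [eval, hph, hN] using hch
        · exact fun x hx => hl x (List.mem_cons_of_mem _ hx)
        · intro x hx hox htx hxl
          by_cases hxh : x = h
          · simp [hxh]
          · exact List.mem_append_left _ (hdone x hx hox htx (by simp [hxh, hxl]))
        · simp [cost, RamTest.cost]; omega
      · intro h2
        simp [RamTest.Holds, eval, hph, hS] at h2
        have hmem : s.arr aSrc h ∈ q := by
          by_contra hmem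
          rw [hq'.vis _ hun, if_neg hmem] at h2
          omega
        refine wp_skip (wp_set ⟨45 * l.length, ⟨q, l, hpre, ?_, ?_, ?_, ?_, rfl⟩, ?_⟩)
        · simpa [eval] using hq'
        · simpa [eval, hph, hN] using hch
        · exact fun x hx => hl x (List.mem_cons_of_mem _ hx)
        · intro x hx hox htx hxl
          by_cases hxh : x = h
          · rwa [hxh]
          · exact hdone x hx hox htx (by simp [hxh, hxl])
        · simp [cost, RamTest.cost]; omega
    · intro h1
      simp [RamTest.Holds, eval, hph, hO] at h1
      refine wp_skip (wp_set ⟨45 * l.length, ⟨q, l, hpre, ?_, ?_, ?_, ?_, rfl⟩, ?_⟩)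
      · simpa [eval] using hq'
      · simpa [eval, hph, hN] using hch
      · exact fun x hx => hl x (List.mem_cons_of_mem _ hx)
      · intro x hx hox htx hxl
        by_cases hxh : x = h
        · exact absurd (hxh ▸ hox) h1
        · exact hdone x hx hox htx (by simp [hxh, hxl])
      · simp [cost, RamTest.cost]; omega
  · rintro t s' hF ⟨ht, hb, φ, q, l, hpre, hq', hch, hl, hdone, rfl⟩
    simp only [RamTest.Holds, eval] at hb
    refine ⟨by simpa [RamTest.cost, cost] using ht, q, hpre, hq', fun h h1 h2 h3 => ?_⟩
    refine hdone h h1 h2 h3 fun hmem => ?_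
    match l, hch, hmem with
    | a :: l, ⟨h1, _⟩, _ => omega

/-- The result of a search with rank function `pos`. -/
structure SearchPost (n M : ℕ) (s : RamState) (pos : ℕ → ℕ) : Prop where
  vis : ∀ v < n, s.arr aVis v = 0 ∨ s.arr aVis v = 1
  y : ∀ v < n, s.arr aY v = 1 → s.arr aVis v = 1
  closed : ∀ h < M, s.arr aOk h = 1 → s.arr aVis (s.arr aTgt h) = 1 → s.arr aVis (s.arr aSrc h) = 1
  par : ∀ v < n, s.arr aVis v = 1 → s.arr aY v ≠ 1 → s.arr aPar v < M ∧
    s.arr aOk (s.arr aPar v) = 1 ∧ s.arr aSrc (s.arr aPar v) = v ∧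
    s.arr aVis (s.arr aTgt (s.arr aPar v)) = 1 ∧ pos (s.arr aTgt (s.arr aPar v)) < pos v
  pos_lt : ∀ v, s.arr aVis v = 1 → v < n → pos v < n

theorem SearchPre.frame {n M : ℕ} {s s' : RamState} {p : RamProg} (hs : SearchPre n M s)
    (hF : Frame p s s') (hr : p.wr rN = false ∧ p.wr rBound = false)
    (ha : p.wa aSrc = false ∧ p.wa aTgt = false ∧ p.wa aNext = false ∧ p.wa aHead = false) :
    SearchPre n M s' := by
  obtain ⟨h1, h2, h3, h4, h5⟩ := hs
  constructor
  · rw [hF.reg _ hr.1, h1]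
  · rw [hF.reg _ hr.2]; exact h2
  · rw [hF.arr _ ha.1]; exact h3
  · rw [hF.arr _ ha.2.1]; exact h4
  · rw [hF.arr _ ha.2.1, hF.arr _ ha.2.2.1, hF.arr _ ha.2.2.2]; exact h5

theorem wp_search {n M : ℕ} {s : RamState} (hs : SearchPre n M s) :
    search.wp s fun t s' => t ≤ 100 * n + 45 * M + 47 ∧ ∃ pos, SearchPost n M s' pos := by
  refine wp_seq (wp_set (wp_seq (wp_mono (wp_initVisited (n := n) (Y := s.arr aY) rfl (by simp [hs.n_eq])
    (by simpa using hs.n_lt) (by simp [eval])) ?_)))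
  rintro t₁ s₁ hF₁ ⟨ht₁, hqt, hqu, hvis⟩
  refine wp_seq (wp_set ?_)
  set q₀ := (List.range n).filter (s.arr aY · = 1) with hq₀
  set s₂ := s₁.setReg rQh (eval s₁ (lit 0)) with hs₂
  have hF₂ : Frame search s s₂ :=
    ((RamProg.Runs.set rQt (lit 0) s).frame.mono
      (by simp +contextual [search, wr]) (by simp [wa]) (by simp [emits])).trans
    ((hF₁.mono (by simp +contextual [search, wr]) (by simp +contextual [search, wa])
      (by simp +contextual [search, emits])).trans ((RamProg.Runs.set rQh (lit 0) s₁).frame.mono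
      (by simp +contextual [search, wr]) (by simp [wa]) (by simp [emits])))
  have hpre₂ : SearchPre n M s₂ := hs.frame hF₂ ⟨rfl, rfl⟩ ⟨rfl, rfl, rfl, rfl⟩
  have hY₂ : s₂.arr aY = s.arr aY := hF₂.arr aY rfl
  -- The cost charged to a vertex when it leaves the queue. The time left is the sum over the
  -- vertices that have not left it, which includes those never found.
  set c : ℕ → ℕ := fun v => 45 * (adj (s₂.arr aTgt) M v).length + 60
  refine wp_mono (wp_loop (fun φ s' => ∃ q, QueueInv (s₂.arr aY) (s₂.arr aSrc) (s₂.arr aTgt)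
    (s₂.arr aOk) (s'.arr aVis) (s'.arr aPar) (s'.arr aQueue) (s'.reg rQt) n M q ∧
    s'.reg rQh ≤ q.length ∧
    (∀ h < M, s₂.arr aOk h = 1 → s₂.arr aTgt h ∈ q.take (s'.reg rQh) → s₂.arr aSrc h ∈ q) ∧
    φ = ∑ v ∈ Finset.range n \ (q.take (s'.reg rQh)).toFinset, c v)
    (∑ v ∈ Finset.range n, c v) ?_ ?_) ?_
  · refine ⟨q₀, ?_, by simp [hs₂, eval], by simp [hs₂, eval], by simp [hs₂, eval]⟩
    constructor
    · exact (List.nodup_range).filter _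
    · intro v hv; simp [hq₀] at hv; exact hv.1
    · simpa [hs₂] using hqt
    · simpa [hs₂] using hqu
    · intro v hv
      simp [hs₂, hvis v hv, hq₀, hv]
    · intro v hv h1
      rw [hY₂] at h1
      simp [hq₀, hv, h1]
    · intro v hv
      left
      rw [hY₂]
      simp only [hq₀, List.mem_filter, decide_eq_true_eq] at hv
      exact hv.2
  · rintro φ s' hF ⟨q, hq, hqh, hdone, rfl⟩ hb
    simp only [RamTest.Holds, eval] at hb
    have hlt : s'.reg rQh < q.length := by rw [hq.len] at hb; exact hb
    have hpre' : SearchPre n M s' := hpre₂.frame hF ⟨rfl, rfl⟩ ⟨rfl, rfl, rfl, rfl⟩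
    have hv : s'.arr aQueue (s'.reg rQh) = q[s'.reg rQh] := hq.queue _ hlt
    have a1 : s'.arr aY = s₂.arr aY := hF.arr aY rfl
    have a2 : s'.arr aSrc = s₂.arr aSrc := hF.arr aSrc rfl
    have a3 : s'.arr aTgt = s₂.arr aTgt := hF.arr aTgt rfl
    have a4 : s'.arr aOk = s₂.arr aOk := hF.arr aOk rfl
    refine wp_seq (wp_set (wp_seq (wp_set (wp_seq (wp_set (wp_mono
      (wp_scanList (n := n) (M := M) (v := q[s'.reg rQh]) (q₀ := q) ?_ ?_ ?_ ?_) ?_))))))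
    · obtain ⟨h1, h2, h3, h4, h5⟩ := hpre'
      exact ⟨by simpa using h1, by simpa using h2, by simpa using h3, by simpa using h4,
        by simpa using h5⟩
    · simp [eval, hv]
    · exact List.getElem_mem hlt
    · simpa [eval, a1, a2, a3, a4] using hq
    · rintro t s'' hF'' ⟨ht, q', hpre, hq', hnew⟩
      have hQh : s''.reg rQh = s'.reg rQh + 1 := by
        rw [hF''.reg rQh rfl]; simp [eval]
      have htake : q'.take (s'.reg rQh + 1) = q.take (s'.reg rQh) ++ [q[s'.reg rQh]] := by
        obtain ⟨r, rfl⟩ := hpre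
        rw [List.take_append_of_le_length (by omega), List.take_append_getElem hlt]
      simp only [RamState.setReg_arr, a1, a2, a3, a4] at hq' hnew ht
      refine ⟨_, ⟨q', hq', ?_, ?_, rfl⟩, ?_⟩
      · rw [hQh]; exact hlt.trans_le hpre.length_le
      · intro h hh hok hT
        rw [hQh, htake, List.mem_append, List.mem_singleton] at hT
        rcases hT with hT | hT
        · exact hpre.subset (hdone h hh hok hT)
        · exact hnew h hh hok hT
      · rw [hQh, htake]
        have hnd : q[s'.reg rQh] ∉ q.take (s'.reg rQh) := by
          have := hq.nodup
          rw [← List.take_append_drop (s'.reg rQh + 1) q, ← List.take_append_getElem hlt] at this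
          have := (List.nodup_append.1 this).1
          intro hmem
          exact (List.nodup_append.1 this).2.2 _ hmem _ (List.mem_singleton_self _) rfl
        have hmem : q[s'.reg rQh] ∈ Finset.range n \ (q.take (s'.reg rQh)).toFinset := by
          simp only [Finset.mem_sdiff, Finset.mem_range, List.mem_toFinset]
          exact ⟨hq.lt _ (List.getElem_mem hlt), hnd⟩
        rw [← Finset.add_sum_erase _ _ hmem]
        have : Finset.range n \ (q.take (s'.reg rQh) ++ [q[s'.reg rQh]]).toFinset =
            (Finset.range n \ (q.take (s'.reg rQh)).toFinset).erase q[s'.reg rQh] := by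
          ext x
          simp only [Finset.mem_sdiff, Finset.mem_range, List.mem_toFinset, List.mem_append,
            List.mem_singleton, Finset.mem_erase]
          tauto
        rw [this]
        simp only [c, cost, RamTest.cost]
        omega
  · rintro t s' hF ⟨ht, hb, φ, q, hq, hqh, hdone, -⟩
    simp only [RamTest.Holds, eval] at hb
    have hfull : q.take (s'.reg rQh) = q := List.take_of_length_le (by rw [← hq.len]; omega)
    rw [hfull] at hdone
    have a1 : s'.arr aY = s₂.arr aY := hF.arr aY rfl
    have a2 : s'.arr aSrc = s₂.arr aSrc := hF.arr aSrc rfl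
    have a3 : s'.arr aTgt = s₂.arr aTgt := hF.arr aTgt rfl
    have a4 : s'.arr aOk = s₂.arr aOk := hF.arr aOk rfl
    have hvis1 : ∀ v < n, (s'.arr aVis v = 1 ↔ v ∈ q) := by
      intro v hv; rw [hq.vis v hv]; split_ifs with h <;> simp [h]
    refine ⟨?_, fun v => q.idxOf v, ?_⟩
    · have h1 := sum_adj (s₂.arr aTgt) n M
      simp only [c, Finset.sum_add_distrib, ← Finset.mul_sum, Finset.sum_const,
        Finset.card_range, smul_eq_mul] at ht
      simp only [RamTest.cost, cost] at ht ⊢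
      omega
    · constructor
      · intro v hv; rw [hq.vis v hv]; split_ifs <;> simp
      · intro v hv h1; rw [a1] at h1; rw [hvis1 v hv]; exact hq.y v hv h1
      · rw [a2, a3, a4]
        intro h hh hok hT
        rw [hvis1 _ (hpre₂.tgt_lt h hh)] at hT
        rw [hvis1 _ (hpre₂.src_lt h hh)]
        exact hdone h hh hok hT
      · rw [a1, a2, a3, a4]
        intro v hv hvv hY
        obtain ⟨b1, b2, b3, b4, b5⟩ := (hq.par v ((hvis1 v hv).1 hvv)).resolve_left hY
        exact ⟨b1, b2, b3, (hvis1 _ (hpre₂.tgt_lt _ b1)).2 b4, b5⟩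
      · intro v hv hvn
        exact (List.idxOf_lt_length_iff.2 ((hvis1 v hvn).1 hv)).trans_le hq.length_le

/-! ### Prepared input, and changing the flow along a path of the search tree -/

namespace RamProg

/-- Look for a vertex of `X` among the visited vertices. -/
def findX : RamProg :=
  set rFound (lit 0) ;;
    forLoop rI (reg rN) (ite (.eq (get aX (reg rI)) (lit 1))
      (ite (.eq (get aVis (reg rI)) (lit 1)) (set rFound (succ (reg rI))) skip) skip)

/-- Follow the search tree from the vertex found to `Y`, changing the flow in the array `g` and
labeling the arcs used forwards. -/
def trace (g : ℕ) : RamProg :=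
  set rV (pred (reg rFound)) ;;
    loop (.eq (get aY (reg rV)) (lit 0))
      (set rH (get aPar (reg rV)) ;;
        ite (.lt (reg rH) (reg rM))
          (gst g (reg rH) (succ (get g (reg rH))) ;; gst aLab (reg rH) (reg rLab))
          (gst g (get aArc (reg rH)) (pred (get g (get aArc (reg rH))))) ;;
        set rV (get aTgt (reg rH)))

end RamProg

namespace MBCut

/-- The input data as prepared in the machine. -/
structure Static (I : MBCut) (Z : Finset (Fin I.m)) (s : RamState) : Prop where
  n : s.reg rN = I.n
  m : s.reg rM = I.m
  l : s.reg rL = I.numColors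
  k : s.reg rK = I.k
  half : s.reg rHalf = 2 * I.m
  pairs : s.reg rPairs = I.k * I.numColors
  len : s.reg rLen = 3 * (I.k + 1) ^ 2
  bound : s.reg rBound = I.n + 2 * I.m + I.k * I.numColors + 1
  srcF : ∀ e : Fin I.m, s.arr aSrc e = I.src e
  srcB : ∀ e : Fin I.m, s.arr aSrc (I.m + e) = I.tgt e
  tgtF : ∀ e : Fin I.m, s.arr aTgt e = I.tgt e
  tgtB : ∀ e : Fin I.m, s.arr aTgt (I.m + e) = I.src e
  arc : ∀ e : Fin I.m, s.arr aArc (I.m + e) = e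
  chain : ∀ v < I.n, Chain (s.arr aNext) (s.arr aHead v) (adj (s.arr aTgt) (2 * I.m) v)
  x : ∀ v : Fin I.n, s.arr aX v = if v ∈ I.X then 1 else 0
  y : ∀ v : Fin I.n, s.arr aY v = if v ∈ I.Y then 1 else 0
  z : ∀ e : Fin I.m, s.arr aZ e = if e ∈ Z then 1 else 0
  budget : ∀ i : Fin I.numColors, s.arr aIn (s.reg rCol + i * (I.m + 1)) = I.budget i
  color : ∀ (i : Fin I.numColors) (e : Fin I.m),
    s.arr aIn (s.reg rCol + i * (I.m + 1) + 1 + e) = if e ∈ I.color i then 1 else 0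

variable {I : MBCut} {Z : Finset (Fin I.m)} {s s' : RamState}

theorem Static.congr (h : I.Static Z s) (hr : ∀ r < 9, s'.reg r = s.reg r)
    (ha : ∀ a < 9, s'.arr a = s.arr a) : I.Static Z s' := by
  obtain ⟨h1, h2, h3, h4, h5, h6, h7, h8, h9, h10, h11, h12, h13, h14, h15, h16, h17, h18, h19⟩ := h
  constructor
  all_goals
    simp only [hr rN (by norm_num), hr rM (by norm_num), hr rL (by norm_num), hr rK (by norm_num),
      hr rCol (by norm_num), hr rHalf (by norm_num), hr rPairs (by norm_num),
      hr rLen (by norm_num), hr rBound (by norm_num), ha aIn (by norm_num), ha aSrc (by norm_num),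
      ha aTgt (by norm_num), ha aX (by norm_num), ha aY (by norm_num), ha aZ (by norm_num),
      ha aHead (by norm_num), ha aNext (by norm_num), ha aArc (by norm_num)]
    assumption

/-- A program that leaves the prepared input alone. -/
def _root_.RamProg.Safe (p : RamProg) : Prop :=
  (∀ r < 9, p.wr r = false) ∧ ∀ a < 9, p.wa a = false

theorem Static.frame (h : I.Static Z s) {p : RamProg} (hF : Frame p s s') (hp : p.Safe) :
    I.Static Z s' :=
  h.congr (fun r hr => hF.reg r (hp.1 r hr)) fun a ha => hF.arr a (hp.2 a ha)

theorem Static.setReg (h : I.Static Z s) {r v : ℕ} (hr : 9 ≤ r) : I.Static Z (s.setReg r v) :=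
  h.congr (fun x hx => by simp [show x ≠ r by omega]) fun _ _ => rfl

theorem half_cases {h : ℕ} (hh : h < 2 * I.m) :
    (∃ e : Fin I.m, h = e) ∨ ∃ e : Fin I.m, h = I.m + e := by
  by_cases h' : h < I.m
  · exact .inl ⟨⟨h, h'⟩, rfl⟩
  · exact .inr ⟨⟨h - I.m, by omega⟩, by simp; omega⟩

theorem Static.searchPre (h : I.Static Z s) : SearchPre I.n (2 * I.m) s where
  n_eq := h.n
  n_lt := by rw [h.bound]; omega
  src_lt := by
    intro x hx
    obtain ⟨e, rfl⟩ | ⟨e, rfl⟩ := half_cases hx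
    · rw [h.srcF]; exact (I.src e).2
    · rw [h.srcB]; exact (I.tgt e).2
  tgt_lt := by
    intro x hx
    obtain ⟨e, rfl⟩ | ⟨e, rfl⟩ := half_cases hx
    · rw [h.tgtF]; exact (I.tgt e).2
    · rw [h.tgtB]; exact (I.src e).2
  chain := h.chain

variable (I) in
/-- The contents of the array `a` as a function on arcs. -/
def arcs (a : ℕ) (s : RamState) : Fin I.m → ℕ := fun e => s.arr a e

theorem arcs_congr {a : ℕ} (h : s'.arr a = s.arr a) : I.arcs a s' = I.arcs a s := by
  unfold arcs
  rw [h]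

@[simp] theorem arcs_setReg (a r v : ℕ) : I.arcs a (s.setReg r v) = I.arcs a s := rfl

variable (I) in
def visited (s : RamState) : Finset (Fin I.n) := Finset.univ.filter fun v => s.arr aVis v = 1

theorem mem_visited {v : Fin I.n} : v ∈ I.visited s ↔ s.arr aVis v = 1 := by simp [visited]

/-- The register holds the vertex plus one, so that `0` can mean that no vertex of `X` has been
visited. -/
theorem Static.wp_findX (h : I.Static Z s) :
    findX.wp s fun t s' => t ≤ 30 * I.n + 32 ∧
      ((s'.reg rFound = 0 ∧ Disjoint I.X (I.visited s)) ∨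
        ∃ x ∈ I.X, x ∈ I.visited s ∧ s'.reg rFound = x + 1) := by
  refine wp_seq (wp_set (wp_mono (wp_for I.n 15 (fun j s' =>
    (s'.reg rFound = 0 ∧ ∀ x ∈ I.X, (x : ℕ) < j → x ∉ I.visited s) ∨
        ∃ x ∈ I.X, x ∈ I.visited s ∧ s'.reg rFound = x + 1) rfl ?_ ?_ ?_ ?_) ?_))
  · intro s' hF
    simpa [eval, ← h.n] using hF.reg rN rfl
  · intro j s' v h
    simpa using h
  · left; simp [eval]
  · rintro j s' hj hF hi hinv
    have aX' : s'.arr aX = s.arr aX := hF.arr aX rfl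
    have aV' : s'.arr aVis = s.arr aVis := hF.arr aVis rfl
    have hx := h.x ⟨j, hj⟩
    refine wp_ite (fun h1 => wp_ite (fun h2 => wp_set ?_) fun h2 => wp_skip ?_) fun h1 => wp_skip ?_
    · simp only [RamTest.Holds, eval, hi, aX', aV', hx] at h1 h2
      refine ⟨by simp [RamTest.cost, cost], .inr ⟨⟨j, hj⟩, ?_, mem_visited.2 h2, by simp [eval, hi]⟩⟩
      by_contra hc
      simp [hc] at h1
    · simp only [RamTest.Holds, eval, hi, aX', aV', hx] at h1 h2
      refine ⟨by simp [RamTest.cost, cost], hinv.imp_left fun ⟨a, b⟩ => ⟨a, fun x hxX hxj hv => ?_⟩⟩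
      rcases Nat.lt_succ_iff_lt_or_eq.1 hxj with h' | h'
      · exact b x hxX h' hv
      · exact h2 (h' ▸ mem_visited.1 hv)
    · simp only [RamTest.Holds, eval, hi, aX', hx] at h1
      refine ⟨by simp [RamTest.cost, cost], hinv.imp_left fun ⟨a, b⟩ => ⟨a, fun x hxX hxj hv => ?_⟩⟩
      rcases Nat.lt_succ_iff_lt_or_eq.1 hxj with h' | h'
      · exact b x hxX h' hv
      · have : (⟨j, hj⟩ : Fin I.n) = x := Fin.ext h'.symm
        rw [this] at h1
        simp [hxX] at h1
  · rintro t s' - ⟨ht, hinv⟩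
    simp only [cost] at ht ⊢
    refine ⟨by omega, hinv.imp_left fun ⟨a, b⟩ => ⟨a, ?_⟩⟩
    exact Finset.disjoint_left.2 fun x hx => b x hx x.2

theorem excess_single {f f' : Fin I.m → ℕ} {e : Fin I.m} {d : ℤ} (h : ∀ e', e' ≠ e → f' e' = f e')
    (he : (f' e : ℤ) = f e + d) (u : Fin I.n) :
    I.excess f' u = I.excess f u + (if I.src e = u then d else 0) -
      (if I.tgt e = u then d else 0) := by
  have : I.excess f' u - I.excess f u = ∑ a, if a = e then
      ((if I.src e = u then d else 0) - (if I.tgt e = u then d else 0)) else 0 := by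
    rw [excess, excess, ← Finset.sum_sub_distrib]
    refine Finset.sum_congr rfl fun a _ => ?_
    by_cases ha : a = e
    · subst ha
      rw [he, if_pos rfl]
      split_ifs <;> ring
    · rw [h a ha, if_neg ha, sub_self]
  rw [Finset.sum_ite_eq' Finset.univ e, if_pos (Finset.mem_univ e)] at this
  linarith

/-- How the flow array and the labels change along a path. -/
def ArcChange (ok : ℕ → ℕ) (m j : ℕ) (e g g' l l' : ℕ) : Prop :=
  (g' = g ∧ l' = l) ∨ (ok e = 1 ∧ g' = g + 1 ∧ l' = j) ∨ (ok (m + e) = 1 ∧ g' + 1 = g ∧ l' = l)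

/-- The invariant moves the unit of demand from the current vertex to its parent, so at the end only
the excess at the two end vertices has changed. Ranks decrease along the tree; they prove
termination and, through the clause that arcs between vertices of rank at most `pos v` are
untouched, that no arc is changed twice. The hypothesis `hback` makes the truncated predecessor on
backward half arcs a true subtraction. -/
theorem Static.wp_trace (h : I.Static Z s) {g : ℕ} (hg : g = aFlow ∨ g = aUsed) {pos : ℕ → ℕ}
    (hpost : SearchPost I.n (2 * I.m) s pos) {x : Fin I.n} (hx : x ∈ I.visited s)
    (hfound : s.reg rFound = x + 1)
    (hback : ∀ e : Fin I.m, s.arr aOk (I.m + e) = 1 → I.arcs g s e ≠ 0) :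
    (trace g).wp s fun t s' => t ≤ 40 * I.n + 10 ∧ ∃ y ∈ I.Y,
      (∀ v, I.excess (I.arcs g s') v =
        I.excess (I.arcs g s) v + (if v = x then 1 else 0) - (if v = y then 1 else 0)) ∧
      ∀ e : Fin I.m, ArcChange (s.arr aOk) I.m (s.reg rLab) e (I.arcs g s e) (I.arcs g s' e)
        (I.arcs aLab s e) (I.arcs aLab s' e) := by
  have hgl : g ≠ aLab := by rcases hg with rfl | rfl <;> norm_num
  refine wp_seq (wp_set (wp_mono (wp_loop (fun φ s' => ∃ v : Fin I.n, s'.reg rV = v ∧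
    s.arr aVis v = 1 ∧
    (∀ u, I.excess (I.arcs g s') u =
        I.excess (I.arcs g s) u + (if u = x then 1 else 0) - (if u = v then 1 else 0)) ∧
    (∀ e : Fin I.m, ArcChange (s.arr aOk) I.m (s.reg rLab) e (I.arcs g s e) (I.arcs g s' e)
        (I.arcs aLab s e) (I.arcs aLab s' e)) ∧
    (∀ e : Fin I.m, pos (I.src e) ≤ pos v → pos (I.tgt e) ≤ pos v →
      I.arcs g s' e = I.arcs g s e) ∧
    φ = 40 * pos v) (40 * pos x) ?_ ?_) ?_))
  · refine ⟨x, by simp [eval, hfound], mem_visited.1 hx, fun u => by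
      rw [show I.arcs g (s.setReg rV (eval s (reg rFound).pred)) = I.arcs g s from rfl]; ring,
      fun e => .inl ⟨rfl, rfl⟩, fun e _ _ => rfl, rfl⟩
  · rintro φ s' hF ⟨v, hv, hvis, hex, harc, hsame, rfl⟩ hb
    have b1 : s'.arr aY = s.arr aY := hF.arr aY (by rcases hg with rfl | rfl <;> rfl)
    have b2 : s'.arr aPar = s.arr aPar := hF.arr aPar (by rcases hg with rfl | rfl <;> rfl)
    have b3 : s'.arr aTgt = s.arr aTgt := hF.arr aTgt (by rcases hg with rfl | rfl <;> rfl)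
    have b4 : s'.arr aArc = s.arr aArc := hF.arr aArc (by rcases hg with rfl | rfl <;> rfl)
    have b5 : s'.reg rM = I.m := (hF.reg rM rfl).trans h.m
    have b6 : s'.reg rBound = s.reg rBound := hF.reg rBound rfl
    have b7 : s'.reg rLab = s.reg rLab := hF.reg rLab rfl
    have hbd := h.bound
    simp only [RamTest.Holds, eval, hv, b1] at hb
    obtain ⟨c1, c2, c3, c4, c5⟩ := hpost.par v v.2 hvis (by omega)
    set p := s.arr aPar v with hp
    refine wp_seq (wp_set (wp_seq (wp_ite ?_ ?_)))
    · intro h1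
      simp [RamTest.Holds, eval, hv, b2, b5, ← hp] at h1
      obtain ⟨e, he⟩ : ∃ e : Fin I.m, p = e := ⟨⟨p, h1⟩, rfl⟩
      rw [he] at c2 c3 c4 c5
      rw [h.srcF] at c3
      rw [h.tgtF] at c4 c5
      have hsv : I.src e = v := Fin.ext c3
      have hbe : (e : ℕ) < s.reg rBound := by rw [hbd]; have := e.2; omega
      have hge : I.arcs g s' e = I.arcs g s e := hsame e (by rw [hsv]) c5.le
      -- The flow on this arc still has its original value, which excludes both alternatives in
      -- which the arc has been changed.
      have hle : I.arcs aLab s' e = I.arcs aLab s e := by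
        rcases harc e with h' | h' | h'
        · exact h'.2
        · omega
        · omega
      refine wp_seq (wp_gst (by simpa [eval, hv, b2, ← hp, he, b6] using hbe) (wp_gst (by
        simpa [eval, hv, b2, ← hp, he, b6] using hbe) (wp_set ⟨40 * pos (I.tgt e),
        ⟨I.tgt e, ?_, c4, ?_, ?_, ?_, rfl⟩, ?_⟩)))
      · simp [eval, hv, b2, ← hp, he]
        rw [if_neg (by rcases hg with rfl | rfl <;> norm_num), b3, h.tgtF]
      · intro u
        rw [excess_single (f := I.arcs g s') (e := e) (d := 1), hex, hsv]
        · simp only [eq_comm (a := v), eq_comm (a := I.tgt e)]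
          ring
        · intro e' he'
          have : (e' : ℕ) ≠ e := fun h' => he' (Fin.ext h')
          simp [arcs, eval, hv, b2, ← hp, he, hgl, Function.update_of_ne this]
        · simp [arcs, eval, hv, b2, ← hp, he, hgl]
      · intro e'
        by_cases hee : e' = e
        · subst hee
          refine .inr (.inl ⟨c2, ?_, ?_⟩)
          · rw [← hge]
            simp [arcs, eval, hv, b2, ← hp, he, hgl]
          · simp [arcs, eval, hv, b2, ← hp, he, b7]
        · have : (e' : ℕ) ≠ e := fun h' => hee (Fin.ext h')
          have := harc e'
          simpa [arcs, eval, hv, b2, ← hp, he, hgl, hgl.symm,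
            Function.update_of_ne ‹(e' : ℕ) ≠ e›] using this
      · intro e' h2 h3
        have hee : (e' : ℕ) ≠ e := by
          intro h'
          rw [Fin.ext h', hsv] at h2
          omega
        rw [← hsame e' (by omega) (by omega)]
        simp [arcs, eval, hv, b2, ← hp, he, hgl, Function.update_of_ne hee]
      · simp only [RamTest.cost, cost]; omega
    · intro h1
      simp [RamTest.Holds, eval, hv, b2, b5, ← hp] at h1
      obtain ⟨e, he⟩ : ∃ e : Fin I.m, p = I.m + e := ⟨⟨p - I.m, by omega⟩, by simp; omega⟩
      rw [he] at c2 c3 c4 c5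
      rw [h.srcB] at c3
      rw [h.tgtB] at c4 c5
      have hsv : I.tgt e = v := Fin.ext c3
      have hbe : (e : ℕ) < s.reg rBound := by rw [hbd]; have := e.2; omega
      have hge : I.arcs g s' e = I.arcs g s e := hsame e c5.le (by rw [hsv])
      have hle : I.arcs aLab s' e = I.arcs aLab s e := by
        rcases harc e with h' | h' | h'
        · exact h'.2
        · omega
        · omega
      have hne := hback e c2
      have hnew : ∀ e' : Fin I.m, Function.update (s'.arr g) e (s'.arr g e - 1) e' =
          if e' = e then I.arcs g s e - 1 else I.arcs g s' e' := by
        intro e'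
        by_cases hee : e' = e
        · subst hee; rw [if_pos rfl, ← hge]; simp [arcs]
        · rw [Function.update_of_ne (fun h' => hee (Fin.ext h')), if_neg hee]; rfl
      refine wp_gst (by simpa [eval, hv, b2, ← hp, he, b6, b4, h.arc] using hbe)
        (wp_set ⟨40 * pos (I.src e), ⟨I.src e, ?_, c4, ?_, ?_, ?_, rfl⟩, ?_⟩)
      · simp [eval, hv, b2, ← hp, he]
        rw [if_neg (by rcases hg with rfl | rfl <;> norm_num), b3, h.tgtB]
      · intro u
        rw [excess_single (f := I.arcs g s') (e := e) (d := -1), hex, hsv]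
        · simp only [eq_comm (a := v), eq_comm (a := I.src e)]
          split_ifs <;> ring
        · intro e' he'
          simp [arcs, eval, hv, b2, ← hp, he, b4, h.arc, hnew, he']
        · simp [arcs, eval, hv, b2, ← hp, he, b4, h.arc]
          have : s'.arr g e ≠ 0 := by rw [← hge] at hne; exact hne
          omega
      · intro e'
        by_cases hee : e' = e
        · subst hee
          refine .inr (.inr ⟨c2, ?_, ?_⟩)
          · simp [arcs, eval, hv, b2, ← hp, he, b4, h.arc]
            have h5 : s'.arr g e' = s.arr g e' := hge
            have h6 : s.arr g e' ≠ 0 := hne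
            omega
          · rw [← hle]; simp [arcs, eval, hgl.symm]
        · have := harc e'
          simpa [arcs, eval, hv, b2, ← hp, he, hgl.symm, b4, h.arc, hnew, hee] using this
      · intro e' h2 h3
        have hee : e' ≠ e := by
          rintro rfl
          rw [hsv] at h3
          omega
        rw [← hsame e' (by omega) (by omega)]
        simp [arcs, eval, hv, b2, ← hp, he, b4, h.arc, hnew, hee]
      · simp only [RamTest.cost, cost]; omega
  · rintro t s' hF ⟨ht, hb, φ, v, hv, hvis, hex, harc, -, -⟩
    have b1 : s'.arr aY = s.arr aY := hF.arr aY (by rcases hg with rfl | rfl <;> rfl)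
    simp only [RamTest.Holds, eval, hv, b1, h.y v] at hb
    have hpx := hpost.pos_lt x (mem_visited.1 hx) x.2
    refine ⟨by simp only [RamTest.cost, cost] at ht ⊢; omega, v, ?_, hex, harc⟩
    by_contra hc
    simp [hc] at hb

end MBCut

/-! ### Maximum flow by augmentation, path decomposition, and the main invariant -/

namespace RamProg

/-- Mark the half arcs of the residual network. -/
def flagsResidual : RamProg :=
  set rMe (reg rM) ;;
    forLoop rI (reg rM)
      (ite (.eq (get aUnd (reg rI)) (lit 1)) (gst aOk (reg rI) (lit 1))
          (ite (.eq (get aFlow (reg rI)) (lit 0)) (gst aOk (reg rI) (lit 1))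
            (gst aOk (reg rI) (lit 0))) ;;
        ite (.eq (get aFlow (reg rI)) (lit 0)) (gst aOk (reg rMe) (lit 0))
          (gst aOk (reg rMe) (lit 1)) ;;
        set rMe (succ (reg rMe)))

/-- Mark the arcs whose flow is not yet covered by paths. -/
def flagsUncovered : RamProg :=
  set rMe (reg rM) ;;
    forLoop rI (reg rM)
      (ite (.lt (get aUsed (reg rI)) (get aFlow (reg rI))) (gst aOk (reg rI) (lit 1))
          (gst aOk (reg rI) (lit 0)) ;;
        gst aOk (reg rMe) (lit 0) ;;
        set rMe (succ (reg rMe)))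

/-- Search for a path and change the flow in the array `g` along it. -/
def attempt (g : ℕ) : RamProg :=
  search ;; findX ;; ite (.eq (reg rFound) (lit 0)) skip (trace g ;; set rChg (lit 1))

def augment : RamProg :=
  set rChg (lit 0) ;; forLoop rJ (succ (reg rK)) (flagsResidual ;; attempt aFlow)

def relabel : RamProg :=
  forLoop rI (reg rM) (gst aUsed (reg rI) (lit 0)) ;;
    forLoop rLab (reg rK) (flagsUncovered ;; attempt aUsed)

def clearSet : RamProg := forLoop rI (reg rPairs) (gst aSet (reg rI) (lit 0))

/-- Augment the flow, find new labels if this succeeds, and find the vertices that reach `Y` in the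
residual network. -/
def reflow : RamProg :=
  augment ;; ite (.eq (reg rChg) (lit 1)) (relabel ;; clearSet) skip ;;
    flagsResidual ;; search ;; findX

end RamProg

namespace MBCut

variable {I : MBCut} {Z : Finset (Fin I.m)} {s s' : RamState}

variable (I) in
/-- The set of undeletable arcs. -/
def und (s : RamState) : Finset (Fin I.m) := Finset.univ.filter fun e => s.arr aUnd e = 1

theorem mem_und {e : Fin I.m} : e ∈ I.und s ↔ s.arr aUnd e = 1 := by simp [und]

theorem Static.wp_flagsResidual (h : I.Static Z s) :
    flagsResidual.wp s fun t s' => t ≤ 50 * I.m + 60 ∧ ∀ e : Fin I.m,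
      (s'.arr aOk e = 1 ↔ e ∈ I.und s ∨ I.arcs aFlow s e = 0) ∧
      (s'.arr aOk (I.m + e) = 1 ↔ I.arcs aFlow s e ≠ 0) := by
  refine wp_seq (wp_set (wp_mono (wp_for I.m 40 (fun j s' =>
    s'.reg rMe = I.m + j ∧ ∀ e : Fin I.m, (e : ℕ) < j →
      (s'.arr aOk e = 1 ↔ e ∈ I.und s ∨ I.arcs aFlow s e = 0) ∧
      (s'.arr aOk (I.m + e) = 1 ↔ I.arcs aFlow s e ≠ 0)) rfl ?_ ?_ ?_ ?_) ?_))
  · intro s' hF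
    simpa [eval, ← h.m] using hF.reg rM rfl
  · intro j s' v h
    simpa using h
  · simp [eval, h.m]
  · rintro j s' hj hF hi ⟨hme, hinv⟩
    have aU' : s'.arr aUnd = s.arr aUnd := hF.arr aUnd rfl
    have aF' : s'.arr aFlow = s.arr aFlow := hF.arr aFlow rfl
    have hB : s'.reg rBound = I.n + 2 * I.m + I.k * I.numColors + 1 :=
      (hF.reg rBound rfl).trans (by simpa using h.bound)
    have hbd := h.bound
    set e₀ : Fin I.m := ⟨j, hj⟩ with he₀
    have hund : e₀ ∈ I.und s ↔ s.arr aUnd j = 1 := mem_und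
    have hflow : I.arcs aFlow s e₀ = s.arr aFlow j := rfl
    have hfin : ∀ b c : ℕ, (b = 1 ↔ e₀ ∈ I.und s ∨ I.arcs aFlow s e₀ = 0) →
        (c = 1 ↔ I.arcs aFlow s e₀ ≠ 0) → ∀ A : ℕ → ℕ,
        A = Function.update (Function.update (s'.arr aOk) j b) (I.m + j) c →
        ∀ e : Fin I.m, (e : ℕ) < j + 1 → (A e = 1 ↔ e ∈ I.und s ∨ I.arcs aFlow s e = 0) ∧
      (A (I.m + e) = 1 ↔ I.arcs aFlow s e ≠ 0) := by
      rintro b c hb hc A rfl e he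
      have he2 := e.2
      rw [Function.update_of_ne (show (e : ℕ) ≠ I.m + j by omega)]
      rcases Nat.lt_succ_iff_lt_or_eq.1 he with he | he
      · rw [Function.update_of_ne (by omega), Function.update_of_ne (by omega),
          Function.update_of_ne (by omega)]
        exact hinv e he
      · obtain rfl : e = e₀ := Fin.ext he
        rw [he, Function.update_self, Function.update_self]
        exact ⟨hb, hc⟩
    have second : ∀ (b t₀ : ℕ), t₀ ≤ 20 → (b = 1 ↔ e₀ ∈ I.und s ∨ I.arcs aFlow s e₀ = 0) →
        (RamProg.ite (.eq (get aFlow (reg rI)) (lit 0)) (gst aOk (reg rMe) (lit 0))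
          (gst aOk (reg rMe) (lit 1)) ;;
        RamProg.set rMe (succ (reg rMe))).wp (s'.write aOk j b) fun t s'' => t₀ + t ≤ 40 ∧
          s''.reg rMe = I.m + (j + 1) ∧ ∀ e : Fin I.m, (e : ℕ) < j + 1 →
      (s''.arr aOk e = 1 ↔ e ∈ I.und s ∨ I.arcs aFlow s e = 0) ∧
      (s''.arr aOk (I.m + e) = 1 ↔ I.arcs aFlow s e ≠ 0) := by
      intro b t₀ ht₀ hb
      refine wp_seq (wp_ite (fun h1 => wp_gst ?_ (wp_set ⟨?_, ?_, ?_⟩))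
        fun h1 => wp_gst ?_ (wp_set ⟨?_, ?_, ?_⟩))
      · simp [eval, hme, hB]; omega
      · simp [RamTest.cost, cost]; omega
      · simp [eval, hme]; omega
      · refine hfin b 0 hb ?_ _ (by simp [eval, hme])
        simpa [RamTest.Holds, eval, hi, aF', hflow] using h1
      · simp [eval, hme, hB]; omega
      · simp [RamTest.cost, cost]; omega
      · simp [eval, hme]; omega
      · refine hfin b 1 hb ?_ _ (by simp [eval, hme])
        simpa [RamTest.Holds, eval, hi, aF', hflow] using h1
    have hjB : j < s'.reg rBound := by omega
    refine wp_seq (wp_ite (fun h1 => wp_gst (by simpa [eval, hi] using hjB) ?_) fun h1 =>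
      wp_ite (fun h2 => wp_gst (by simpa [eval, hi] using hjB) ?_)
      fun h2 => wp_gst (by simpa [eval, hi] using hjB) ?_)
    all_goals simp only [eval, hi]
    · refine second 1 _ (by simp [RamTest.cost, cost]) ?_
      simp [RamTest.Holds, eval, hi, aU'] at h1
      simp [hund, h1]
    · refine second 1 _ (by simp [RamTest.cost, cost]) ?_
      simp [RamTest.Holds, eval, hi, aF'] at h2
      simp [hflow, h2]
    · refine second 0 _ (by simp [RamTest.cost, cost]) ?_
      simp [RamTest.Holds, eval, hi, aU'] at h1
      simp [RamTest.Holds, eval, hi, aF'] at h2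
      simp [hflow, hund, h1, h2]
  · rintro t s' - ⟨ht, -, hinv⟩
    simp only [cost] at ht ⊢
    exact ⟨by omega, fun e => hinv e e.2⟩

theorem Static.wp_flagsUncovered (h : I.Static Z s) :
    flagsUncovered.wp s fun t s' => t ≤ 50 * I.m + 60 ∧ ∀ e : Fin I.m,
      (s'.arr aOk e = 1 ↔ I.arcs aUsed s e < I.arcs aFlow s e) ∧ s'.arr aOk (I.m + e) ≠ 1 := by
  refine wp_seq (wp_set (wp_mono (wp_for I.m 40 (fun j s' =>
    s'.reg rMe = I.m + j ∧ ∀ e : Fin I.m, (e : ℕ) < j →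
      (s'.arr aOk e = 1 ↔ I.arcs aUsed s e < I.arcs aFlow s e) ∧ s'.arr aOk (I.m + e) ≠ 1)
      rfl ?_ ?_ ?_ ?_) ?_))
  · intro s' hF
    simpa [eval, ← h.m] using hF.reg rM rfl
  · intro j s' v h
    simpa using h
  · simp [eval, h.m]
  · rintro j s' hj hF hi ⟨hme, hinv⟩
    have aU' : s'.arr aUsed = s.arr aUsed := hF.arr aUsed rfl
    have aF' : s'.arr aFlow = s.arr aFlow := hF.arr aFlow rfl
    have hB : s'.reg rBound = I.n + 2 * I.m + I.k * I.numColors + 1 :=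
      (hF.reg rBound rfl).trans (by simpa using h.bound)
    set e₀ : Fin I.m := ⟨j, hj⟩ with he₀
    have hfin : ∀ b : ℕ, (b = 1 ↔ I.arcs aUsed s e₀ < I.arcs aFlow s e₀) → ∀ A : ℕ → ℕ,
        A = Function.update (Function.update (s'.arr aOk) j b) (I.m + j) 0 →
        ∀ e : Fin I.m, (e : ℕ) < j + 1 → (A e = 1 ↔ I.arcs aUsed s e < I.arcs aFlow s e) ∧
          A (I.m + e) ≠ 1 := by
      rintro b hb A rfl e he
      have he2 := e.2
      rw [Function.update_of_ne (show (e : ℕ) ≠ I.m + j by omega)]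
      rcases Nat.lt_succ_iff_lt_or_eq.1 he with he | he
      · rw [Function.update_of_ne (by omega), Function.update_of_ne (by omega),
          Function.update_of_ne (by omega)]
        exact hinv e he
      · obtain rfl : e = e₀ := Fin.ext he
        rw [he, Function.update_self, Function.update_self]
        exact ⟨hb, by norm_num⟩
    refine wp_seq (wp_ite (fun h1 => wp_gst ?_ (wp_seq (wp_gst ?_ (wp_set ⟨?_, ?_, ?_⟩))))
        fun h1 => wp_gst ?_ (wp_seq (wp_gst ?_ (wp_set ⟨?_, ?_, ?_⟩))))
    · simp [eval, hi, hB]; omega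
    · simp [eval, hme, hB]; omega
    · simp [RamTest.cost, cost]
    · simp [eval, hme]; omega
    · refine hfin 1 ?_ _ (by simp [eval, hme, hi])
      simpa [RamTest.Holds, eval, hi, aF', aU', arcs] using h1
    · simp [eval, hi, hB]; omega
    · simp [eval, hme, hB]; omega
    · simp [RamTest.cost, cost]
    · simp [eval, hme]; omega
    · refine hfin 0 ?_ _ (by simp [eval, hme, hi])
      simpa [RamTest.Holds, eval, hi, aF', aU', arcs] using h1
  · rintro t s' - ⟨ht, -, hinv⟩
    simp only [cost] at ht ⊢
    exact ⟨by omega, fun e => hinv e e.2⟩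

variable (I) in
/-- A vertex set containing `Y` that is not entered by half arcs marked in `ok`. -/
structure OkClosed (ok : ℕ → ℕ) (W : Finset (Fin I.n)) : Prop where
  Y_sub : I.Y ⊆ W
  fwd : ∀ e : Fin I.m, ok e = 1 → I.tgt e ∈ W → I.src e ∈ W
  bwd : ∀ e : Fin I.m, ok (I.m + e) = 1 → I.src e ∈ W → I.tgt e ∈ W

theorem Static.okClosed {pos : ℕ → ℕ} (h : I.Static Z s)
    (hp : SearchPost I.n (2 * I.m) s pos) : I.OkClosed (s.arr aOk) (I.visited s) where
  Y_sub := fun y hy => mem_visited.2 (hp.y y y.2 (by rw [h.y, if_pos hy]))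
  fwd := fun e he ht => by
    have := hp.closed e (by have := e.2; omega) he
    rw [h.srcF, h.tgtF] at this
    exact mem_visited.2 (this (mem_visited.1 ht))
  bwd := fun e he ht => by
    have := hp.closed (I.m + e) (by have := e.2; omega) he
    rw [h.srcB, h.tgtB] at this
    exact mem_visited.2 (this (mem_visited.1 ht))

/-- By induction on the rank, each visited vertex lies in every closed set, since its parent does.
So the search finds the least closed set, that is, the minimum cut farthest from `X`; it also
follows that a path exists whenever `X` is hit. -/
theorem Static.visited_least {pos : ℕ → ℕ} (h : I.Static Z s)
    (hp : SearchPost I.n (2 * I.m) s pos) {W : Finset (Fin I.n)}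
    (hW : I.OkClosed (s.arr aOk) W) : I.visited s ⊆ W := by
  have key : ∀ N, ∀ v : Fin I.n, pos v < N → v ∈ I.visited s → v ∈ W := by
    intro N
    induction N with
    | zero => intro v hv; omega
    | succ N ih =>
      intro v hv hvis
      by_cases hy : s.arr aY v = 1
      · refine hW.Y_sub ?_
        by_contra hc
        rw [h.y, if_neg hc] at hy
        omega
      · obtain ⟨c1, c2, c3, c4, c5⟩ := hp.par v v.2 (mem_visited.1 hvis) hy
        obtain ⟨e, he⟩ | ⟨e, he⟩ := half_cases c1
        · rw [he] at c2 c3 c4 c5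
          rw [h.srcF] at c3
          rw [h.tgtF] at c4 c5
          have := hW.fwd e c2 (ih _ (by omega) (mem_visited.2 c4))
          rwa [Fin.ext c3] at this
        · rw [he] at c2 c3 c4 c5
          rw [h.srcB] at c3
          rw [h.tgtB] at c4 c5
          have := hW.bwd e c2 (ih _ (by omega) (mem_visited.2 c4))
          rwa [Fin.ext c3] at this
  exact fun v hv => key _ v (Nat.lt_succ_self _) hv

theorem safe_search : search.Safe := ⟨by decide, by decide⟩
theorem safe_findX : findX.Safe := ⟨by decide, by decide⟩

/-- The search together with the test whether `X` has been reached. -/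
theorem Static.wp_searchFind (h : I.Static Z s) {q : RamProg} {Q : ℕ → RamState → Prop}
    (hq : ∀ t s', Frame (search ;; findX) s s' → I.Static Z s' → t ≤ 130 * I.n + 90 * I.m + 79 →
      (∃ pos, SearchPost I.n (2 * I.m) s' pos) →
      ((s'.reg rFound = 0 ∧ Disjoint I.X (I.visited s')) ∨
        ∃ x ∈ I.X, x ∈ I.visited s' ∧ s'.reg rFound = x + 1) →
      q.wp s' fun t' s'' => Q (t + t') s'') : (search ;; findX ;; q).wp s Q := by
  refine wp_seq (wp_mono (wp_search h.searchPre) ?_)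
  rintro t₁ s₁ hF₁ ⟨ht₁, pos, hpos⟩
  have h₁ := h.frame hF₁ safe_search
  refine wp_seq (wp_mono h₁.wp_findX ?_)
  rintro t₂ s₂ hF₂ ⟨ht₂, hfound⟩
  have hF : Frame (search ;; findX) s s₂ :=
    (hF₁.mono (by simp +contextual [wr]) (by simp +contextual [wa])
      (by simp +contextual [emits])).trans (hF₂.mono (by simp +contextual [wr])
      (by simp +contextual [wa]) (by simp +contextual [emits]))
  have hv : I.visited s₂ = I.visited s₁ := by
    simp only [visited, hF₂.arr aVis rfl]
  have := hq (t₁ + t₂) s₂ hF (h₁.frame hF₂ safe_findX) (by omega) ⟨pos, ?_⟩ (by rwa [hv])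
  · refine wp_mono this fun t s' _ hQ => ?_
    rwa [← add_assoc]
  · obtain ⟨a1, a2, a3, a4, a5⟩ := hpos
    constructor <;> simp only [hF₂.arr aVis rfl, hF₂.arr aY rfl, hF₂.arr aOk rfl,
      hF₂.arr aTgt rfl, hF₂.arr aSrc rfl, hF₂.arr aPar rfl] <;> assumption

/-- Failure exhibits a closed set missing `X`, and success shows that there is none. Callers use the
latter to know that no earlier attempt with the same flow can have failed. -/
theorem Static.wp_attempt (h : I.Static Z s) {g : ℕ} (hg : g = aFlow ∨ g = aUsed)
    (hback : ∀ e : Fin I.m, s.arr aOk (I.m + e) = 1 → I.arcs g s e ≠ 0) :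
    (attempt g).wp s fun t s' => t ≤ 170 * I.n + 90 * I.m + 100 ∧
      ((s'.reg rChg = s.reg rChg ∧ I.arcs g s' = I.arcs g s ∧ I.arcs aLab s' = I.arcs aLab s ∧
          ∃ W, I.OkClosed (s.arr aOk) W ∧ Disjoint I.X W) ∨
        (s'.reg rChg = 1 ∧ ∃ x ∈ I.X, ∃ y ∈ I.Y,
          (∀ W, I.OkClosed (s.arr aOk) W → ¬ Disjoint I.X W) ∧
          (∀ v, I.excess (I.arcs g s') v =
            I.excess (I.arcs g s) v + (if v = x then 1 else 0) - (if v = y then 1 else 0)) ∧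
          ∀ e : Fin I.m, ArcChange (s.arr aOk) I.m (s.reg rLab) e (I.arcs g s e) (I.arcs g s' e)
            (I.arcs aLab s e) (I.arcs aLab s' e))) := by
  refine h.wp_searchFind fun t₁ s₁ hF₁ h₁ ht₁ ⟨pos, hpos⟩ hfound => ?_
  have b1 : s₁.arr aOk = s.arr aOk := hF₁.arr aOk rfl
  have b2 : I.arcs g s₁ = I.arcs g s := by
    exact arcs_congr (hF₁.arr g (by rcases hg with rfl | rfl <;> rfl))
  have b3 : I.arcs aLab s₁ = I.arcs aLab s := arcs_congr (hF₁.arr aLab rfl)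
  have b4 : s₁.reg rLab = s.reg rLab := hF₁.reg rLab rfl
  refine wp_ite (fun hz => ?_) fun hz => ?_
  · simp only [RamTest.Holds, eval] at hz
    have hd : Disjoint I.X (I.visited s₁) := by
      rcases hfound with hf | ⟨x, -, -, hf⟩
      · exact hf.2
      · omega
    refine wp_skip ⟨by simp only [RamTest.cost, cost]; omega, .inl ⟨hF₁.reg rChg rfl, b2, b3,
      I.visited s₁, b1 ▸ h₁.okClosed hpos, hd⟩⟩
  · simp only [RamTest.Holds, eval] at hz
    obtain ⟨x, hx, hxv, hf⟩ := hfound.resolve_left fun h => hz h.1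
    refine wp_seq (wp_mono (h₁.wp_trace hg hpos hxv hf (by rw [b1, b2]; exact hback)) ?_)
    rintro t₂ s₂ - ⟨ht₂, y, hy, hex, harc⟩
    rw [b1, b2, b3, b4] at harc
    rw [b2] at hex
    refine wp_set ⟨by simp only [RamTest.cost, cost]; omega, .inr ⟨by simp [eval], x, hx, y, hy,
      fun W hW hd => ?_, hex, harc⟩⟩
    exact Finset.disjoint_left.1 hd hx (h₁.visited_least hpos (b1 ▸ hW) hxv)

theorem safe_flagsResidual : flagsResidual.Safe := ⟨by decide, by decide⟩
theorem safe_flagsUncovered : flagsUncovered.Safe := ⟨by decide, by decide⟩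
theorem safe_augment : augment.Safe := ⟨by decide, by decide⟩
theorem safe_relabel : relabel.Safe := ⟨by decide, by decide⟩
theorem safe_clearSet : clearSet.Safe := ⟨by decide, by decide⟩

/-- Correct marks for the residual network. -/
def ResidualOk (I : MBCut) (und : Finset (Fin I.m)) (f : Fin I.m → ℕ) (ok : ℕ → ℕ) : Prop :=
  ∀ e : Fin I.m, (ok e = 1 ↔ e ∈ und ∨ f e = 0) ∧ (ok (I.m + e) = 1 ↔ f e ≠ 0)

theorem ResidualOk.closed_iff {und : Finset (Fin I.m)} {f : Fin I.m → ℕ} {ok : ℕ → ℕ}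
    (h : I.ResidualOk und f ok) {W : Finset (Fin I.n)} :
    I.OkClosed ok W ↔ I.Closed und f W := by
  constructor
  · rintro ⟨h1, h2, h3⟩
    exact ⟨h1, fun e a b => h2 e ((h e).1.2 b) a, fun e a b => h3 e ((h e).2.2 b) a⟩
  · rintro ⟨h1, h2, h3⟩
    exact ⟨h1, fun e a b => h2 e b ((h e).1.1 a), fun e a b => h3 e b ((h e).2.1 a)⟩

/-- The number of augmentations is cut off at `k + 1`: then either the flow is maximum, or its value
exceeds `k` and no cut of interest avoids the undeletable arcs any more. -/
theorem Static.wp_augment (h : I.Static Z s) (hf : I.IsFlow (I.und s) (I.arcs aFlow s)) :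
    augment.wp s fun t s' => t ≤ (I.k + 2) * (170 * I.n + 140 * I.m + 170) + 2 ∧
      I.IsFlow (I.und s) (I.arcs aFlow s') ∧
      ((s'.reg rChg ≠ 1 ∧ I.arcs aFlow s' = I.arcs aFlow s ∧ I.arcs aLab s' = I.arcs aLab s) ∨
        (s'.reg rChg = 1 ∧ I.val (I.arcs aFlow s) + 1 ≤ I.val (I.arcs aFlow s'))) ∧
      (I.val (I.arcs aFlow s) + (I.k + 1) ≤ I.val (I.arcs aFlow s') ∨
        ∃ W, I.Closed (I.und s) (I.arcs aFlow s') W ∧ Disjoint I.X W) := by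
  refine wp_seq (wp_set (wp_mono (wp_for (I.k + 1) (170 * I.n + 140 * I.m + 163) (fun j s' =>
      I.IsFlow (I.und s) (I.arcs aFlow s') ∧
      ((s'.reg rChg ≠ 1 ∧ I.arcs aFlow s' = I.arcs aFlow s ∧ I.arcs aLab s' = I.arcs aLab s) ∨
        (s'.reg rChg = 1 ∧ I.val (I.arcs aFlow s) + 1 ≤ I.val (I.arcs aFlow s'))) ∧
      (I.val (I.arcs aFlow s) + j ≤ I.val (I.arcs aFlow s') ∨
        ∃ W, I.Closed (I.und s) (I.arcs aFlow s') W ∧ Disjoint I.X W)) rfl ?_ ?_ ?_ ?_) ?_))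
  · intro s' hF
    simp only [eval, hF.reg rK rfl]
    simpa using h.k
  · intro j s' v h
    simpa using h
  · exact ⟨hf, .inl ⟨by simp [eval], rfl, rfl⟩, .inl (by simp)⟩
  · rintro j s' hj hF hi ⟨hflow, hchg, hval⟩
    have h' : I.Static Z s' := (h.setReg (by norm_num)).frame hF ⟨by decide, by decide⟩
    have hund : I.und s' = I.und s := by simp only [und, hF.arr aUnd rfl]; rfl
    refine wp_seq (wp_mono h'.wp_flagsResidual ?_)
    rintro t₁ s₁ hF₁ ⟨ht₁, hok⟩
    have h₁ := h'.frame hF₁ safe_flagsResidual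
    have c1 : I.arcs aFlow s₁ = I.arcs aFlow s' := arcs_congr (hF₁.arr aFlow rfl)
    have c2 : I.arcs aLab s₁ = I.arcs aLab s' := arcs_congr (hF₁.arr aLab rfl)
    have c3 : s₁.reg rChg = s'.reg rChg := hF₁.reg rChg rfl
    have hok' : I.ResidualOk (I.und s) (I.arcs aFlow s') (s₁.arr aOk) := hund ▸ hok
    refine wp_mono (h₁.wp_attempt (.inl rfl) fun e he => ?_) ?_
    · rw [c1]; exact (hok' e).2.1 he
    rintro t₂ s₂ hF₂ ⟨ht₂, hres⟩
    refine ⟨by omega, ?_⟩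
    rcases hres with ⟨r1, r2, r3, W, hW, hd⟩ | ⟨r1, x, hx, y, hy, hno, hex, harc⟩
    · rw [r1, r2, r3, c1, c2, c3]
      exact ⟨hflow, hchg, .inr ⟨W, hok'.closed_iff.1 hW, hd⟩⟩
    · rw [c1] at hex harc
      have hv := val_augment hx hy hex
      have hv0 : I.val (I.arcs aFlow s) ≤ I.val (I.arcs aFlow s') := by
        rcases hchg with ⟨-, h2, -⟩ | ⟨-, h2⟩
        · rw [h2]
        · omega
      -- A success now refutes the closed set of an earlier failure, so all previous rounds have
      -- succeeded as well.
      have hvj : I.val (I.arcs aFlow s) + j ≤ I.val (I.arcs aFlow s') :=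
        hval.resolve_right fun ⟨W, hW, hd⟩ => hno W (hok'.closed_iff.2 hW) hd
      refine ⟨⟨fun e he => ?_, hflow.cons.augment hx hy hex⟩, .inr ⟨r1, by omega⟩,
        .inl (by push_cast; omega)⟩
      have := hflow.cap e he
      rcases harc e with ⟨a, -⟩ | ⟨a, b, -⟩ | ⟨-, a, -⟩
      · omega
      · have := ((hok' e).1.1 a).resolve_left he
        omega
      · omega
  · rintro t s' hF ⟨ht, h1, h2, h3⟩
    simp only [cost] at ht ⊢
    refine ⟨?_, h1, h2, by push_cast at h3; exact h3⟩
    have : (I.k + 1 + 1) * (170 * I.n + 140 * I.m + 163 + (1 + 1) + 5) =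
        (I.k + 2) * (170 * I.n + 140 * I.m + 170) := by ring
    rw [this] at ht
    omega

/-- Only forward half arcs are marked, so a path never takes back covered flow and each round is a
step of `Decomp`, by success or by failure. -/
theorem Static.wp_relabel (h : I.Static Z s) (hf : I.Conserves (I.arcs aFlow s)) :
    relabel.wp s fun t s' => t ≤ (I.k + 1) * (170 * I.n + 140 * I.m + 166) + (I.m + 1) * 12 ∧
      I.LabOK (I.arcs aFlow s) (I.arcs aLab s') := by
  refine wp_seq (wp_mono (wp_for I.m 6 (fun j s' => ∀ i < j, s'.arr aUsed i = 0) rfl ?_ ?_ ?_ ?_)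
    ?_)
  · intro s' hF
    simpa [eval, ← h.m] using hF.reg rM rfl
  · intro j s' v h
    simpa using h
  · simp
  · intro j s' hj hF hi hinv
    have hB : s'.reg rBound = I.n + 2 * I.m + I.k * I.numColors + 1 :=
      (hF.reg rBound rfl).trans h.bound
    refine wp_gst (by simp only [eval, hi]; omega) ⟨by simp [cost], fun i hij => ?_⟩
    simp only [eval, hi, RamState.write_arr, if_true]
    rcases Nat.lt_succ_iff_lt_or_eq.1 hij with hij | rfl
    · rw [Function.update_of_ne hij.ne, hinv i hij]
    · rw [Function.update_self]
  · rintro t₀ s₀ hF₀ ⟨ht₀, hzero⟩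
    have h₀ := h.frame hF₀ ⟨by decide, by decide⟩
    have f₀ : I.arcs aFlow s₀ = I.arcs aFlow s := arcs_congr (hF₀.arr aFlow rfl)
    refine wp_mono (wp_for I.k (170 * I.n + 140 * I.m + 160) (fun j s' =>
      Decomp (I.arcs aFlow s) (I.arcs aUsed s') (I.arcs aLab s') j) rfl ?_ ?_ ?_ ?_) ?_
    · intro s' hF
      simpa [eval, ← h₀.k] using hF.reg rK rfl
    · intro j s' v h
      simpa using h
    · have : I.arcs aUsed s₀ = fun _ => 0 := funext fun e => hzero e e.2
      rw [this]
      exact Decomp.zero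
    · intro j s' hj hF hi hinv
      have h' : I.Static Z s' := h₀.frame hF ⟨by decide, by decide⟩
      refine wp_seq (wp_mono h'.wp_flagsUncovered ?_)
      rintro t₁ s₁ hF₁ ⟨ht₁, hok⟩
      have h₁ := h'.frame hF₁ safe_flagsUncovered
      have c1 : I.arcs aUsed s₁ = I.arcs aUsed s' := arcs_congr (hF₁.arr aUsed rfl)
      have c2 : I.arcs aLab s₁ = I.arcs aLab s' := arcs_congr (hF₁.arr aLab rfl)
      have c3 : s₁.reg rLab = j := (hF₁.reg rLab rfl).trans hi
      have c4 : I.arcs aFlow s' = I.arcs aFlow s := by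
        rw [← f₀]; exact arcs_congr (hF.arr aFlow rfl)
      rw [c4] at hok
      refine wp_mono (h₁.wp_attempt (.inr rfl) fun e he => absurd he (hok e).2) ?_
      rintro t₂ s₂ hF₂ ⟨ht₂, hres⟩
      refine ⟨by omega, ?_⟩
      rcases hres with ⟨-, r2, r3, W, hW, hd⟩ | ⟨-, x, hx, y, hy, hno, hex, harc⟩
      · rw [r2, r3, c1, c2]
        exact hinv.fail hf hW.Y_sub hd fun e ht hu => hW.fwd e ((hok e).1.2 hu) ht
      · rw [c1] at hex
        refine hinv.succ hx hy hex fun e => ?_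
        have := harc e
        rw [c1, c2, c3] at this
        rcases this with a | ⟨a, b⟩ | ⟨a, -⟩
        · exact .inl a
        · exact .inr ⟨(hok e).1.1 a, b⟩
        · exact absurd a (hok e).2
    · rintro t s' - ⟨ht, hdec⟩
      simp only [cost] at ht ht₀ ⊢
      refine ⟨?_, hdec.labOK hf⟩
      have : 170 * I.n + 140 * I.m + 160 + 1 + 5 = 170 * I.n + 140 * I.m + 166 := by ring
      rw [this] at ht
      omega

theorem Static.wp_clearSet (h : I.Static Z s) :
    clearSet.wp s fun t s' => t ≤ (I.k * I.numColors + 1) * 12 ∧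
      ∀ p < I.k * I.numColors, s'.arr aSet p = 0 := by
  refine wp_mono (wp_for (I.k * I.numColors) 6 (fun j s' => ∀ i < j, s'.arr aSet i = 0)
    rfl ?_ ?_ ?_ ?_) ?_
  · intro s' hF
    simpa [eval, ← h.pairs] using hF.reg rPairs rfl
  · intro j s' v h
    simpa using h
  · simp
  · intro j s' hj hF hi hinv
    have hB : s'.reg rBound = I.n + 2 * I.m + I.k * I.numColors + 1 :=
      (hF.reg rBound rfl).trans h.bound
    refine wp_gst (by simp only [eval, hi]; omega) ⟨by simp [cost], fun i hij => ?_⟩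
    simp only [eval, hi, RamState.write_arr, if_true]
    rcases Nat.lt_succ_iff_lt_or_eq.1 hij with hij | rfl
    · rw [Function.update_of_ne hij.ne, hinv i hij]
    · rw [Function.update_self]
  · rintro t s' - ⟨ht, hi⟩
    simpa [cost] using ⟨ht, hi⟩

/-- The invariant of the main loop. -/
structure Good (I : MBCut) (Z : Finset (Fin I.m)) (s : RamState) : Prop where
  static : I.Static Z s
  flow : I.IsFlow (I.und s) (I.arcs aFlow s)
  nonneg : 0 ≤ I.val (I.arcs aFlow s)
  und_Z : ∀ e, e ∉ I.und s → e ∈ Z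
  labOK : I.LabOK (I.arcs aFlow s) (I.arcs aLab s)
  closed : I.Closed (I.und s) (I.arcs aFlow s) (I.visited s)
  least : ∀ W, I.Closed (I.und s) (I.arcs aFlow s) W → I.visited s ⊆ W
  found : s.reg rFound = 0 ↔ Disjoint I.X (I.visited s)

/-- It matters that an unsuccessful augmentation leaves flow, labels and guessed pairs untouched:
then the required set of pairs can be compared with the previous one. After a success the labels are
new and the old guesses are meaningless, so the set of pairs is emptied. -/
theorem Static.wp_reflow (h : I.Static Z s) (hf : I.IsFlow (I.und s) (I.arcs aFlow s))
    (h0 : 0 ≤ I.val (I.arcs aFlow s)) (hu : ∀ e, e ∉ I.und s → e ∈ Z)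
    (hl : I.LabOK (I.arcs aFlow s) (I.arcs aLab s)) :
    reflow.wp s fun t s' => t ≤ 800 * ((I.k + 2) ^ 2 * (I.n + I.m + 1)) ∧ I.Good Z s' ∧
      I.und s' = I.und s ∧
      ((I.arcs aFlow s' = I.arcs aFlow s ∧ I.arcs aLab s' = I.arcs aLab s ∧
          s'.arr aSet = s.arr aSet) ∨
        (I.val (I.arcs aFlow s) + 1 ≤ I.val (I.arcs aFlow s') ∧
          ∀ p < I.k * I.numColors, s'.arr aSet p = 0)) ∧
      (Disjoint I.X (I.visited s') ∨ (I.k : ℤ) + 1 ≤ I.val (I.arcs aFlow s')) := by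
  refine wp_seq (wp_mono (h.wp_augment hf) ?_)
  rintro t₁ s₁ hF₁ ⟨ht₁, hf₁, hch, hfin⟩
  have h₁ := h.frame hF₁ safe_augment
  have hund₁ : I.und s₁ = I.und s := by simp only [und, hF₁.arr aUnd rfl]
  have hset₁ : s₁.arr aSet = s.arr aSet := hF₁.arr aSet rfl
  have hT1 : (I.k + 2) * (170 * I.n + 140 * I.m + 170) ≤
      170 * ((I.k + 2) ^ 2 * (I.n + I.m + 1)) := by
    have : (I.k + 2) * (170 * I.n + 140 * I.m + 170) ≤
        (I.k + 2) * ((I.k + 2) * (170 * (I.n + I.m + 1))) :=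
      Nat.mul_le_mul_left _ (by nlinarith [Nat.zero_le (I.k * (170 * (I.n + I.m + 1)))])
    calc _ ≤ _ := this
      _ = _ := by ring
  have hT2 : (I.k * I.numColors + 1) ≤ (I.k + 2) ^ 2 * (I.n + I.m + 1) := by
    have h1 := numColors_le_k (I := I)
    have h2 : I.k * I.numColors + 1 ≤ (I.k + 2) ^ 2 := by nlinarith
    exact h2.trans (Nat.le_mul_of_pos_right _ (by omega))
  have hT3 : 4 * (I.n + I.m + 1) ≤ (I.k + 2) ^ 2 * (I.n + I.m + 1) :=
    Nat.mul_le_mul_right _ (by nlinarith)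
  set N := (I.k + 2) ^ 2 * (I.n + I.m + 1) with hN
  -- The final search is the same in both branches of the test; `t₁ + (t₂ + t)` is the time
  -- accumulated there.
  have rest : ∀ t₂ s₂, t₂ ≤ 400 * N → I.Static Z s₂ → I.und s₂ = I.und s →
      I.IsFlow (I.und s) (I.arcs aFlow s₂) → I.LabOK (I.arcs aFlow s₂) (I.arcs aLab s₂) →
      ((I.arcs aFlow s₂ = I.arcs aFlow s ∧ I.arcs aLab s₂ = I.arcs aLab s ∧
          s₂.arr aSet = s.arr aSet) ∨
        (I.val (I.arcs aFlow s) + 1 ≤ I.val (I.arcs aFlow s₂) ∧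
          ∀ p < I.k * I.numColors, s₂.arr aSet p = 0)) →
      (I.val (I.arcs aFlow s) + (I.k + 1) ≤ I.val (I.arcs aFlow s₂) ∨
        ∃ W, I.Closed (I.und s) (I.arcs aFlow s₂) W ∧ Disjoint I.X W) →
      (flagsResidual ;; search ;; findX).wp s₂ fun t s' => t₁ + (t₂ + t) ≤ 800 * N ∧
      I.Good Z s' ∧ I.und s' = I.und s ∧
      ((I.arcs aFlow s' = I.arcs aFlow s ∧ I.arcs aLab s' = I.arcs aLab s ∧
          s'.arr aSet = s.arr aSet) ∨
        (I.val (I.arcs aFlow s) + 1 ≤ I.val (I.arcs aFlow s') ∧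
          ∀ p < I.k * I.numColors, s'.arr aSet p = 0)) ∧
      (Disjoint I.X (I.visited s') ∨ (I.k : ℤ) + 1 ≤ I.val (I.arcs aFlow s')) := by
    intro t₂ s₂ ht₂ h₂ hund₂ hf₂ hl₂ hres hend
    refine wp_seq (wp_mono h₂.wp_flagsResidual ?_)
    rintro t₃ s₃ hF₃ ⟨ht₃, hok⟩
    have h₃ := h₂.frame hF₃ safe_flagsResidual
    rw [hund₂] at hok
    have hok : I.ResidualOk (I.und s) (I.arcs aFlow s₂) (s₃.arr aOk) := hok
    refine wp_seq (wp_mono (wp_search h₃.searchPre) ?_)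
    rintro t₄ s₄ hF₄ ⟨ht₄, pos, hpos⟩
    have h₄ := h₃.frame hF₄ safe_search
    refine wp_mono h₄.wp_findX ?_
    rintro t₅ s₅ hF₅ ⟨ht₅, hfound⟩
    have h₅ := h₄.frame hF₅ safe_findX
    have e1 : I.arcs aFlow s₅ = I.arcs aFlow s₂ := by
      exact ((arcs_congr (hF₅.arr aFlow rfl)).trans (arcs_congr (hF₄.arr aFlow rfl))).trans
        (arcs_congr (hF₃.arr aFlow rfl))
    have e2 : I.arcs aLab s₅ = I.arcs aLab s₂ := by
      exact ((arcs_congr (hF₅.arr aLab rfl)).trans (arcs_congr (hF₄.arr aLab rfl))).trans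
        (arcs_congr (hF₃.arr aLab rfl))
    have e3 : I.und s₅ = I.und s := by
      rw [← hund₂]
      simp only [und, hF₅.arr aUnd rfl, hF₄.arr aUnd rfl, hF₃.arr aUnd rfl]
    have e4 : s₅.arr aSet = s₂.arr aSet := by
      simp only [hF₅.arr aSet rfl, hF₄.arr aSet rfl, hF₃.arr aSet rfl]
    have e5 : I.visited s₅ = I.visited s₄ := by simp only [visited, hF₅.arr aVis rfl]
    have hok₄ : I.ResidualOk (I.und s) (I.arcs aFlow s₂) (s₄.arr aOk) := by
      rw [hF₄.arr aOk rfl]; exact hok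
    have hleast : ∀ W, I.Closed (I.und s) (I.arcs aFlow s₂) W → I.visited s₄ ⊆ W := fun W hW =>
      h₄.visited_least hpos (hok₄.closed_iff.2 hW)
    refine ⟨by omega, ⟨h₅, by rwa [e3, e1], ?_, by rwa [e3], by rwa [e1, e2], ?_, ?_, ?_⟩, e3,
      by rwa [e1, e2, e4], ?_⟩
    · rw [e1]
      rcases hres with ⟨a, -⟩ | ⟨a, -⟩
      · rwa [a]
      · omega
    · rw [e3, e1, e5]
      exact hok₄.closed_iff.1 (h₄.okClosed hpos)
    · rw [e3, e1, e5]; exact hleast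
    · rw [e5]
      rcases hfound with ⟨a, b⟩ | ⟨x, hx, hxv, a⟩
      · simp [a, b]
      · have hnd : ¬ Disjoint I.X (I.visited s₄) := fun hd => Finset.disjoint_left.1 hd hx hxv
        simp [a, hnd]
    · rw [e1, e5]
      rcases hend with a | ⟨W, hW, hd⟩
      · right; omega
      · exact .inl (hd.mono_right (hleast W hW))
  refine wp_seq (wp_ite (fun hc => ?_) fun hc => ?_)
  · simp only [RamTest.Holds, eval] at hc
    have hval := (hch.resolve_left fun h => h.1 hc).2
    refine wp_seq (wp_mono (h₁.wp_relabel hf₁.cons) ?_)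
    rintro t₂ s₂ hF₂ ⟨ht₂, hl₂⟩
    have h₂ := h₁.frame hF₂ safe_relabel
    refine wp_mono h₂.wp_clearSet ?_
    rintro t₃ s₃ hF₃ ⟨ht₃, hset⟩
    have e1 : I.arcs aFlow s₃ = I.arcs aFlow s₁ := by
      exact (arcs_congr (hF₃.arr aFlow rfl)).trans (arcs_congr (hF₂.arr aFlow rfl))
    have e2 : I.arcs aLab s₃ = I.arcs aLab s₂ := arcs_congr (hF₃.arr aLab rfl)
    have e3 : I.und s₃ = I.und s := by
      rw [← hund₁]; simp only [und, hF₃.arr aUnd rfl, hF₂.arr aUnd rfl]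
    have hT4 : (I.k + 1) * (170 * I.n + 140 * I.m + 166) ≤
        (I.k + 2) * (170 * I.n + 140 * I.m + 170) := Nat.mul_le_mul (by omega) (by omega)
    refine rest _ s₃ ?_ (h₂.frame hF₃ safe_clearSet) e3 (by rwa [e1]) (by rwa [e1, e2])
      (.inr ⟨by rwa [e1], hset⟩) (by rwa [e1])
    simp only [RamTest.cost, cost]
    omega
  · simp only [RamTest.Holds, eval] at hc
    obtain ⟨-, a, b⟩ := hch.resolve_right fun h => hc h.1
    refine wp_skip (rest _ s₁ ?_ h₁ hund₁ hf₁ (by rwa [a, b]) (.inl ⟨a, b, hset₁⟩) hfin)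
    simp only [RamTest.cost, cost]
    omega

end MBCut

/-! ### Refinement of the undeletable arcs, and the potential argument -/

namespace RamProg

/-- Make undeletable the arcs in front of the current cut all of whose (label, color) pairs are
outside the current set of pairs. -/
def refineUnd : RamProg :=
  set rP (lit 0) ;;
    forLoop rJ (reg rK)
      (set rQ (reg rCol) ;;
        forLoop rI (reg rL)
          (set rQ (succ (reg rQ)) ;;
            forLoop rE (reg rM)
              (ite (.eq (get aIn (reg rQ)) (lit 1))
                  (ite (.eq (get aLab (reg rE)) (reg rJ))
                    (ite (.eq (get aVis (get aSrc (reg rE))) (lit 1)) skip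
                      (ite (.eq (get aSet (reg rP)) (lit 0)) (gst aUnd (reg rE) (lit 1)) skip))
                    skip)
                  skip ;;
                set rQ (succ (reg rQ))) ;;
            set rP (succ (reg rP))))

def toggle : RamProg :=
  ite (.eq (get aSet (reg rSym)) (lit 0)) (gst aSet (reg rSym) (lit 1))
    (gst aSet (reg rSym) (lit 0))

/-- Execute the symbol in register `rSym` of the advice word. -/
def step : RamProg :=
  ite (.lt (reg rSym) (reg rPairs)) toggle
    (ite (.eq (reg rSym) (reg rPairs)) (refineUnd ;; reflow) skip)

end RamProg

namespace MBCut

variable {I : MBCut} {Z : Finset (Fin I.m)} {s s' : RamState}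

variable (I) in
/-- The arcs that `refineUnd` makes undeletable before it has reached arc `x`, color `i` and label
`j`. -/
def Marked (s : RamState) (j i x : ℕ) (e : Fin I.m) : Prop :=
  s.arr aUnd e = 1 ∨ (I.src e ∉ I.visited s ∧ ∃ c : Fin I.numColors, e ∈ I.color c ∧
    s.arr aSet (s.arr aLab e * I.numColors + c) = 0 ∧
    (s.arr aLab e < j ∨ (s.arr aLab e = j ∧ ((c : ℕ) < i ∨ ((c : ℕ) = i ∧ (e : ℕ) < x)))))

/-- Three nested loops over label, color and arc, with `Marked` recording the progress
lexicographically. The registers `rP` and `rQ` follow the code of the current pair and the position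
in the color table, so that no multiplication is needed. -/
theorem Static.wp_refineUnd (h : I.Static Z s) :
    refineUnd.wp s fun t s' => t ≤ 80 * ((I.k + 2) ^ 2 * (I.n + I.m + 1)) ∧
      ∀ e, e ∈ I.und s' ↔ e ∈ I.und s ∨ (I.src e ∉ I.visited s ∧ I.arcs aLab s e < I.k ∧
        ∃ c : Fin I.numColors, e ∈ I.color c ∧
          s.arr aSet (I.arcs aLab s e * I.numColors + c) = 0) := by
  -- The end of an inner loop is the start of the next round of the enclosing one.
  have hwrap : ∀ (j i : ℕ) (e : Fin I.m), I.Marked s j i I.m e ↔ I.Marked s j (i + 1) 0 e := by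
    intro j i e
    have := e.2
    refine or_congr_right (and_congr_right fun _ => exists_congr fun c => and_congr_right fun _ =>
      and_congr_right fun _ => or_congr_right (and_congr_right fun _ => ?_))
    omega
  have hwrap' : ∀ (j : ℕ) (e : Fin I.m),
      I.Marked s j I.numColors 0 e ↔ I.Marked s (j + 1) 0 0 e := by
    intro j e
    refine or_congr_right (and_congr_right fun _ => exists_congr fun c => and_congr_right fun _ =>
      and_congr_right fun _ => ?_)
    have := c.2
    omega
  refine wp_seq (wp_set (wp_mono (wp_for I.k ((I.numColors + 1) * ((I.m + 1) * 36 + 20) + 2)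
    (fun j s' => s'.reg rP = j * I.numColors ∧ ∀ e, s'.arr aUnd (e : Fin I.m) = 1 ↔
      I.Marked s j 0 0 e) rfl ?_ ?_ ?_ ?_) ?_))
  · intro s' hF
    rw [eval, hF.reg rK rfl]
    simpa using h.k
  · intro j s' v h
    simpa using h
  · refine ⟨by simp [eval], fun e => ?_⟩
    simp [Marked]
  · rintro j s₀ hj hF₀ hj₀ ⟨hp₀, hinv₀⟩
    have h₀ : I.Static Z s₀ := (h.setReg (by norm_num)).frame hF₀ ⟨by decide, by decide⟩
    refine wp_seq (wp_set (wp_mono (wp_for I.numColors ((I.m + 1) * 36 + 14)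
      (fun i s' => s'.reg rP = j * I.numColors + i ∧ s'.reg rQ = s.reg rCol + i * (I.m + 1) ∧
        ∀ e, s'.arr aUnd (e : Fin I.m) = 1 ↔ I.Marked s j i 0 e) rfl ?_ ?_ ?_ ?_) ?_))
    · intro s' hF
      rw [eval, hF.reg rL rfl]
      simpa using h₀.l
    · intro j s' v h
      simpa using h
    · refine ⟨by simpa using hp₀, ?_, by simpa using hinv₀⟩
      simp only [eval, RamState.setReg_reg, if_true]
      rw [hF₀.reg rCol rfl]
      simp
    · rintro i s₁ hi hF₁ hi₁ ⟨hp₁, hq₁, hinv₁⟩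
      have h₁ : I.Static Z s₁ := (h₀.setReg (by norm_num)).frame hF₁ ⟨by decide, by decide⟩
      have hj₁ : s₁.reg rJ = j := by rw [hF₁.reg rJ rfl]; simpa using hj₀
      refine wp_seq (wp_set (wp_seq (wp_mono (wp_for I.m 30 (fun x s' =>
        s'.reg rQ = s.reg rCol + i * (I.m + 1) + 1 + x ∧
        ∀ e, s'.arr aUnd (e : Fin I.m) = 1 ↔ I.Marked s j i x e) rfl ?_ ?_ ?_ ?_) ?_)))
      · intro s' hF
        rw [eval, hF.reg rM rfl]
        simpa using h₁.m
      · intro j s' v h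
        simpa using h
      · exact ⟨by simp [eval, hq₁], by simpa using hinv₁⟩
      · rintro x s₂ hx hF₂ hx₂ ⟨hq₂, hinv₂⟩
        have hp₂ : s₂.reg rP = j * I.numColors + i := by
          rw [hF₂.reg rP rfl]; simpa using hp₁
        have hj₂ : s₂.reg rJ = j := by rw [hF₂.reg rJ rfl]; simpa using hj₁
        have hcol : s₂.reg rCol = s.reg rCol := by
          rw [hF₂.reg rCol rfl]
          simp only [RamState.setReg_reg]
          rw [if_neg (by norm_num), hF₁.reg rCol rfl]
          simp only [RamState.setReg_reg]
          rw [if_neg (by norm_num), hF₀.reg rCol rfl]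
          simp
        have harr : ∀ a, a ≠ aUnd → refineUnd.wa a = false → s₂.arr a = s.arr a := by
          intro a ha ha'
          rw [hF₂.arr a (by simpa [refineUnd, forLoop, gst, wa] using ha')]
          simp only [RamState.setReg_arr]
          rw [hF₁.arr a (by simpa [refineUnd, forLoop, gst, wa] using ha')]
          simp only [RamState.setReg_arr]
          rw [hF₀.arr a (by simpa [refineUnd, forLoop, gst, wa] using ha')]
          simp only [RamState.setReg_arr]
        have r1 := harr aIn (by norm_num) rfl
        have r2 := harr aLab (by norm_num) rfl
        have r3 := harr aVis (by norm_num) rfl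
        have r4 := harr aSrc (by norm_num) rfl
        have r5 := harr aSet (by norm_num) rfl
        have hB : s₂.reg rBound = I.n + 2 * I.m + I.k * I.numColors + 1 := by
          rw [hF₂.reg rBound rfl]; simpa using h₁.bound
        set e₀ : Fin I.m := ⟨x, hx⟩ with he₀
        set c₀ : Fin I.numColors := ⟨i, hi⟩ with hc₀
        have hcolor := h.color c₀ e₀
        have hsrc : s.arr aSrc x = I.src e₀ := h.srcF e₀
        have hvis : I.src e₀ ∈ I.visited s ↔ s.arr aVis (I.src e₀) = 1 := mem_visited
        have hothers : ∀ e : Fin I.m, e ≠ e₀ → (I.Marked s j i (x + 1) e ↔ I.Marked s j i x e) := by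
          intro e he
          have : (e : ℕ) ≠ x := fun h => he (Fin.ext h)
          refine or_congr_right (and_congr_right fun _ => exists_congr fun c =>
            and_congr_right fun _ => and_congr_right fun _ =>
              or_congr_right (and_congr_right fun _ => ?_))
          omega
        have hno : ¬ (I.src e₀ ∉ I.visited s ∧ e₀ ∈ I.color c₀ ∧
            s.arr aSet (j * I.numColors + i) = 0 ∧ s.arr aLab x = j) →
            ∀ e : Fin I.m, I.Marked s j i (x + 1) e ↔ I.Marked s j i x e := by
          intro hn e
          by_cases he : e = e₀
          · subst he
            refine or_congr_right (and_congr_right fun hv => exists_congr fun c =>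
              and_congr_right fun hc => and_congr_right fun hs =>
                or_congr_right (and_congr_right fun hl => ?_))
            constructor
            · rintro (a | ⟨a, b⟩)
              · exact .inl a
              · refine absurd ⟨hv, ?_, ?_, hl⟩ hn
                · rwa [show c = c₀ from Fin.ext a] at hc
                · rw [← a, ← hl]; exact hs
            · rintro (a | ⟨a, b⟩)
              · exact .inl a
              · exact .inr ⟨a, by omega⟩
          · exact hothers e he
        have hskip : ∀ t₀, t₀ ≤ 26 → ¬ (I.src e₀ ∉ I.visited s ∧ e₀ ∈ I.color c₀ ∧
            s.arr aSet (j * I.numColors + i) = 0 ∧ s.arr aLab x = j) →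
            (RamProg.set rQ (succ (reg rQ))).wp s₂ fun t s' => t₀ + t ≤ 30 ∧
              s'.reg rQ = s.reg rCol + i * (I.m + 1) + 1 + (x + 1) ∧
              ∀ e, s'.arr aUnd (e : Fin I.m) = 1 ↔ I.Marked s j i (x + 1) e := by
          intro t₀ ht₀ hn
          refine wp_set ⟨by simp only [cost]; omega, by simp [eval, hq₂]; omega, fun e => ?_⟩
          rw [hno hn e]
          exact hinv₂ e
        refine wp_seq (wp_ite (fun a1 => wp_ite (fun a2 => wp_ite (fun a3 => wp_skip ?_)
          fun a3 => wp_ite (fun a4 => wp_gst ?_ ?_) fun a4 => wp_skip ?_) fun a2 => wp_skip ?_)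
          fun a1 => wp_skip ?_)
        · simp [RamTest.Holds, eval, hx₂, r3, r4, hsrc] at a3
          exact hskip _ (by simp [RamTest.cost, cost]) fun hh => hh.1 (hvis.2 a3)
        · simp only [eval, hx₂, hB]; omega
        · simp [RamTest.Holds, eval, hx₂, r3, r4, hsrc] at a3
          simp [RamTest.Holds, eval, r1, hq₂] at a1
          simp [RamTest.Holds, eval, r2, hx₂, hj₂] at a2
          simp [RamTest.Holds, eval, r5, hp₂] at a4
          rw [show i = (c₀ : ℕ) from rfl, show x = (e₀ : ℕ) from rfl, hcolor] at a1
          have a1' : e₀ ∈ I.color c₀ := by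
            by_contra hc
            simp [hc] at a1
          refine wp_set ⟨by simp [RamTest.cost, cost], by simp [eval, hq₂]; omega, fun e => ?_⟩
          by_cases he : e = e₀
          · subst he
            simp only [eval, hx₂, RamState.setReg_arr, RamState.write_arr, if_true]
            rw [show ((e₀ : Fin I.m) : ℕ) = x from rfl, Function.update_self]
            refine iff_of_true rfl (.inr ⟨fun hv => a3 (hvis.1 hv), c₀, a1', ?_, .inr ⟨a2, .inr
              ⟨rfl, Nat.lt_succ_self _⟩⟩⟩)
            rw [show s.arr aLab e₀ = j from a2]; exact a4
          · have : (e : ℕ) ≠ x := fun h => he (Fin.ext h)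
            simp only [eval, hx₂, RamState.setReg_arr, RamState.write_arr, if_true]
            rw [Function.update_of_ne this, hothers e he]
            exact hinv₂ e
        · simp [RamTest.Holds, eval, r5, hp₂] at a4
          exact hskip _ (by simp [RamTest.cost, cost]) fun hh => a4 hh.2.2.1
        · simp [RamTest.Holds, eval, r2, hx₂, hj₂] at a2
          exact hskip _ (by simp [RamTest.cost, cost]) fun hh => a2 hh.2.2.2
        · simp only [RamTest.Holds, eval, r1, hq₂] at a1
          rw [show i = (c₀ : ℕ) from rfl, show x = (e₀ : ℕ) from rfl, hcolor] at a1
          refine hskip _ (by simp [RamTest.cost, cost]) fun hh => a1 ?_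
          rw [if_pos hh.2.1]
      · rintro t₂ s₂ hF₂ ⟨ht₂, hq₂, hinv₂⟩
        have hp₂ : s₂.reg rP = j * I.numColors + i := by
          rw [hF₂.reg rP rfl]; simpa using hp₁
        refine wp_set ⟨?_, by simp [eval, hp₂]; omega, ?_, fun e => ?_⟩
        · simp only [cost] at ht₂ ⊢; omega
        · simp [hq₂]; ring
        · rw [← hwrap]; exact hinv₂ e
    · rintro t₁ s₁ hF₁ ⟨ht₁, hp₁, -, hinv₁⟩
      refine ⟨?_, by rw [hp₁]; ring, fun e => by rw [← hwrap']; exact hinv₁ e⟩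
      simp only [cost] at ht₁ ⊢
      have : (I.numColors + 1) * ((I.m + 1) * 36 + 14 + 1 + 5) =
        (I.numColors + 1) * ((I.m + 1) * 36 + 20) := by ring
      omega
  · rintro t₀ s₀ hF₀ ⟨ht₀, -, hinv₀⟩
    refine ⟨?_, fun e => ?_⟩
    · have hl := numColors_le_k (I := I)
      have h1 : (I.m + 1) * 36 + 20 ≤ 56 * (I.n + I.m + 1) := by omega
      have h2 : (I.numColors + 1) * ((I.m + 1) * 36 + 20) + 2 + 1 + 5 ≤
          64 * ((I.k + 1) * (I.n + I.m + 1)) := by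
        have : (I.numColors + 1) * ((I.m + 1) * 36 + 20) ≤ (I.k + 1) * (56 * (I.n + I.m + 1)) :=
          Nat.mul_le_mul (by omega) h1
        have h3 : 1 ≤ (I.k + 1) * (I.n + I.m + 1) := Nat.mul_pos (by omega) (by omega)
        calc _ ≤ (I.k + 1) * (56 * (I.n + I.m + 1)) + 8 := by omega
          _ = 56 * ((I.k + 1) * (I.n + I.m + 1)) + 8 := by ring
          _ ≤ _ := by omega
      simp only [cost] at ht₀ ⊢
      have h4 := ht₀.trans (Nat.mul_le_mul_left (I.k + 1) h2)
      have h5 : (I.k + 1) * (64 * ((I.k + 1) * (I.n + I.m + 1))) ≤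
          64 * ((I.k + 2) ^ 2 * (I.n + I.m + 1)) := by
        calc _ = 64 * ((I.k + 1) ^ 2 * (I.n + I.m + 1)) := by ring
          _ ≤ _ := by gcongr; omega
      have h6 : 1 ≤ (I.k + 2) ^ 2 * (I.n + I.m + 1) := Nat.mul_pos (by positivity) (by omega)
      omega
    · rw [mem_und, hinv₀, mem_und]
      refine or_congr_right (and_congr_right fun _ => ?_)
      constructor
      · rintro ⟨c, a, b, d⟩
        exact ⟨d.resolve_right fun h => by omega, c, a, b⟩
      · rintro ⟨d, c, a, b⟩
        exact ⟨c, a, b, .inl d⟩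

variable (I) in
/-- The current set of (label, color) pairs. -/
def pairSet (s : RamState) : Finset ℕ :=
  (Finset.range (I.k * I.numColors)).filter fun p => s.arr aSet p ≠ 0

theorem safe_refineUnd : refineUnd.Safe := ⟨by decide, by decide⟩

theorem Good.congr (h : I.Good Z s) (hst : I.Static Z s')
    (hr : s'.reg rFound = s.reg rFound) (h1 : s'.arr aUnd = s.arr aUnd)
    (h2 : s'.arr aFlow = s.arr aFlow) (h3 : s'.arr aLab = s.arr aLab)
    (h4 : s'.arr aVis = s.arr aVis) : I.Good Z s' := by
  obtain ⟨-, b, c, d, e, f, g, k⟩ := h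
  have e1 : I.und s' = I.und s := by simp only [und, h1]
  have e2 := arcs_congr (I := I) h2
  have e3 := arcs_congr (I := I) h3
  have e4 : I.visited s' = I.visited s := by simp only [visited, h4]
  exact ⟨hst, by rw [e1, e2]; exact b, by rw [e2]; exact c, by rw [e1]; exact d,
    by rw [e2, e3]; exact e, by rw [e1, e2, e4]; exact f, by rw [e1, e2, e4]; exact g,
    by rw [hr, e4]; exact k⟩

theorem Good.wp_toggle (h : I.Good Z s) (hp : s.reg rSym < I.k * I.numColors) :
    toggle.wp s fun t s' => t ≤ 11 ∧ I.Good Z s' ∧ I.und s' = I.und s ∧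
      I.visited s' = I.visited s ∧ I.arcs aFlow s' = I.arcs aFlow s ∧
      I.arcs aLab s' = I.arcs aLab s ∧
      I.pairSet s' = symmDiff (I.pairSet s) {s.reg rSym} := by
  have hB := h.static.bound
  have hkey : ∀ v, (v ≠ 0 ↔ s.arr aSet (s.reg rSym) = 0) →
      I.pairSet (s.write aSet (s.reg rSym) v) = symmDiff (I.pairSet s) {s.reg rSym} := by
    intro v hv
    ext p
    simp only [pairSet, Finset.mem_filter, Finset.mem_range, Finset.mem_symmDiff,
      Finset.mem_singleton, RamState.write_arr, if_true]
    by_cases hps : p = s.reg rSym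
    · subst hps
      rw [Function.update_self]
      tauto
    · rw [Function.update_of_ne hps]
      tauto
  have hst : ∀ v, I.Static Z (s.write aSet (s.reg rSym) v) := fun v =>
    h.static.congr (fun _ _ => rfl) fun a ha => by simp [show a ≠ aSet by omega]
  have hgood : ∀ v, I.Good Z (s.write aSet (s.reg rSym) v) := fun v =>
    h.congr (hst v) rfl (by simp) (by simp) (by simp) (by simp)
  have hrest : ∀ v, (v ≠ 0 ↔ s.arr aSet (s.reg rSym) = 0) →
      I.Good Z (s.write aSet (s.reg rSym) v) ∧ I.und (s.write aSet (s.reg rSym) v) = I.und s ∧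
      I.visited (s.write aSet (s.reg rSym) v) = I.visited s ∧
      I.arcs aFlow (s.write aSet (s.reg rSym) v) = I.arcs aFlow s ∧
      I.arcs aLab (s.write aSet (s.reg rSym) v) = I.arcs aLab s ∧
      I.pairSet (s.write aSet (s.reg rSym) v) = symmDiff (I.pairSet s) {s.reg rSym} := fun v hv =>
    ⟨hgood v, by simp [und], by simp [visited], arcs_congr (by simp), arcs_congr (by simp),
      hkey v hv⟩
  refine wp_ite (fun h1 => wp_gst (by simp only [eval]; omega) ⟨by simp [RamTest.cost, cost], ?_⟩)
    fun h1 => wp_gst (by simp only [eval]; omega) ⟨by simp [RamTest.cost, cost], ?_⟩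
  · exact hrest 1 (by simpa [RamTest.Holds, eval] using h1)
  · exact hrest 0 (by simpa [RamTest.Holds, eval] using h1)

/-- Enlarging `und` only relaxes the capacity constraints, so flow and labels remain valid and the
flow can be augmented from where it stands. -/
theorem Good.wp_refine (h : I.Good Z s) :
    (refineUnd ;; reflow).wp s fun t s' => t ≤ 880 * ((I.k + 2) ^ 2 * (I.n + I.m + 1)) ∧
      I.Good Z s' ∧
      (∀ e, e ∈ I.und s' ↔ e ∈ I.und s ∨ (I.src e ∉ I.visited s ∧ I.arcs aLab s e < I.k ∧
        ∃ c : Fin I.numColors, e ∈ I.color c ∧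
          s.arr aSet (I.arcs aLab s e * I.numColors + c) = 0)) ∧
      ((I.arcs aFlow s' = I.arcs aFlow s ∧ I.arcs aLab s' = I.arcs aLab s ∧
          I.pairSet s' = I.pairSet s) ∨
        (I.val (I.arcs aFlow s) + 1 ≤ I.val (I.arcs aFlow s') ∧ I.pairSet s' = ∅)) ∧
      (Disjoint I.X (I.visited s') ∨ (I.k : ℤ) + 1 ≤ I.val (I.arcs aFlow s')) := by
  refine wp_seq (wp_mono h.static.wp_refineUnd ?_)
  rintro t₁ s₁ hF₁ ⟨ht₁, hund⟩
  have h₁ := h.static.frame hF₁ safe_refineUnd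
  have e1 : I.arcs aFlow s₁ = I.arcs aFlow s := arcs_congr (hF₁.arr aFlow rfl)
  have e2 : I.arcs aLab s₁ = I.arcs aLab s := arcs_congr (hF₁.arr aLab rfl)
  have e3 : s₁.arr aSet = s.arr aSet := hF₁.arr aSet rfl
  refine wp_mono (h₁.wp_reflow (by
      rw [e1]
      exact ⟨fun e he => h.flow.cap e fun h' => he ((hund e).2 (.inl h')), h.flow.cons⟩)
    (by rw [e1]; exact h.nonneg)
    (fun e he => h.und_Z e fun h' => he ((hund e).2 (.inl h'))) (by rw [e1, e2]; exact h.labOK)) ?_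
  rintro t₂ s₂ - ⟨ht₂, hg, hu, hres, hfin⟩
  refine ⟨by omega, hg, by rw [hu]; exact hund, ?_, hfin⟩
  rw [e1, e2, e3] at hres
  refine hres.imp (fun ⟨a, b, c⟩ => ⟨a, b, by simp only [pairSet, c]⟩) fun ⟨a, b⟩ => ⟨a, ?_⟩
  refine Finset.filter_eq_empty_iff.2 fun p hp => ?_
  simpa using b p (Finset.mem_range.1 hp)

theorem Good.wp_step (h : I.Good Z s) :
    step.wp s fun t s' => t ≤ 900 * ((I.k + 2) ^ 2 * (I.n + I.m + 1)) ∧ I.Good Z s' := by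
  have hpos : 1 ≤ (I.k + 2) ^ 2 * (I.n + I.m + 1) := Nat.mul_pos (by positivity) (by omega)
  refine wp_ite (fun h1 => ?_) fun h1 => wp_ite (fun h2 => ?_) fun h2 => wp_skip ⟨?_, h⟩
  · simp only [RamTest.Holds, eval, h.static.pairs] at h1
    refine wp_mono (h.wp_toggle h1) ?_
    rintro t s' - ⟨ht, hg, -⟩
    exact ⟨by simp only [RamTest.cost, cost]; omega, hg⟩
  · refine wp_mono h.wp_refine ?_
    rintro t s' - ⟨ht, hg, -⟩
    exact ⟨by simp only [RamTest.cost, cost]; omega, hg⟩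
  · simp only [RamTest.cost, cost]; omega

/-- A state from which the cut `C` can still be found. -/
structure Ready (I : MBCut) (Z C : Finset (Fin I.m)) (s : RamState) : Prop where
  good : I.Good Z s
  disj : Disjoint C (I.und s)
  free : Disjoint I.X (I.visited s)

variable (I) in
/-- The set of pairs that should be guessed. -/
def target (C : Finset (Fin I.m)) (s : RamState) : Finset ℕ :=
  pairs C (I.arcs aLab s) (I.visited s)ᶜ

variable (I) in
/-- A bound for the number of symbols needed for finding `C`. -/
def potential (C : Finset (Fin I.m)) (s : RamState) : ℕ :=
  (I.k - (I.val (I.arcs aFlow s)).toNat) * (3 * I.k + 3) +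
    (symmDiff (I.pairSet s) (I.target C s)).card + 2 * (I.target C s).card + 2

variable (I) in
/-- The cut `C` has been found. -/
def Done (C : Finset (Fin I.m)) (s : RamState) : Prop := C = I.outArcs (I.visited s)ᶜ

theorem card_symmDiff_of_subset {s t : Finset ℕ} (h : s ⊆ t) :
    (symmDiff t s).card = t.card - s.card := by
  rw [← Finset.card_sdiff_of_subset h]
  congr 1
  ext q
  have := @h q
  simp only [Finset.mem_symmDiff, Finset.mem_sdiff]
  tauto

theorem symmDiff_symmDiff_singleton {s t : Finset ℕ} {p : ℕ} (hp : p ∈ symmDiff s t) :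
    symmDiff (symmDiff s {p}) t = (symmDiff s t).erase p := by
  ext q
  simp only [Finset.mem_symmDiff, Finset.mem_singleton, Finset.mem_erase] at hp ⊢
  by_cases hq : q = p
  · subst hq; tauto
  · tauto

/-- If a guessed pair is wrong, toggling it lowers the symmetric difference. If the guess is right,
refinement is safe for `C`. When the flow is unchanged and the target loses `d ≥ 1` pairs, the
symmetric difference rises from `0` to `d` while twice the target size falls by `2 * d`. When the
flow value grows, the first summand pays at least `3 * k + 3`, which exceeds the rest of the new
potential, at most `k + 2 * k + 2`. When neither happens, the cut has been found. -/
theorem Ready.progress (hZ : Z ⊆ I.colored) {C : Finset (Fin I.m)} (hC : I.Important Z C)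
    (h : I.Ready Z C s) : ∃ a < I.k * I.numColors + 2, step.wp (s.setReg rSym a) fun _ s' =>
      I.Ready Z C s' ∧ (I.Done C s' ∨ I.potential C s' < I.potential C s) := by
  have hg : ∀ a, I.Good Z (s.setReg rSym a) := fun a =>
    h.good.congr (h.good.static.setReg (by norm_num)) (by simp) rfl rfl rfl rfl
  by_cases hU : I.pairSet s = I.target C s
  · refine ⟨I.k * I.numColors, by omega, ?_⟩
    have hpr := (hg 0).static.pairs
    refine wp_ite (fun h1 => ?_) fun _ => wp_ite (fun h2 => ?_) fun h2 => ?_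
    · simp [RamTest.Holds, eval, h.good.static.pairs] at h1
    swap
    · simp [RamTest.Holds, eval, h.good.static.pairs] at h2
    refine wp_mono (hg _).wp_refine ?_
    rintro t s' - ⟨-, hg', hund, hres, hfin⟩
    simp only [arcs_setReg, RamState.setReg_arr] at hund hres
    have hund' : ∀ e, e ∈ I.und s' ↔ e ∈ I.und s ∨ (I.src e ∉ I.visited s ∧
        I.arcs aLab s e < I.k ∧ ∃ c : Fin I.numColors, e ∈ I.color c ∧
          s.arr aSet (I.arcs aLab s e * I.numColors + c) = 0) := hund
    have hres' : (I.arcs aFlow s' = I.arcs aFlow s ∧ I.arcs aLab s' = I.arcs aLab s ∧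
          I.pairSet s' = I.pairSet s) ∨
        (I.val (I.arcs aFlow s) + 1 ≤ I.val (I.arcs aFlow s') ∧ I.pairSet s' = ∅) := hres
    have hcard := card_le_of_subset_colored hC.1.2.2
    -- An arc of `C` in front of the cut contributes all its pairs to the target, which is the
    -- guessed set, so refinement spares it.
    have hdisj : Disjoint C (I.und s') := by
      refine Finset.disjoint_left.2 fun e he hu => ?_
      rcases (hund' e).1 hu with hu | ⟨hv, hl, c, hc, hset⟩
      · exact Finset.disjoint_left.1 h.disj he hu
      · have : I.arcs aLab s e * I.numColors + c ∈ I.target C s :=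
          mem_pairs.2 ⟨e, he, Finset.mem_compl.2 hv, hl, c, hc, rfl⟩
        rw [← hU, pairSet, Finset.mem_filter] at this
        exact this.2 hset
    -- As `C` remains a cut of deletable arcs, the value is at most `k`, so the cut-off in the
    -- augmentation is not reached and the flow is maximum.
    have hval : I.val (I.arcs aFlow s') ≤ C.card := hg'.flow.val_le_card hC.1.1.1 hdisj
    have hfree : Disjoint I.X (I.visited s') := hfin.resolve_right fun h' => by omega
    refine ⟨⟨hg', hdisj, hfree⟩, ?_⟩
    have hT' : (I.target C s').card ≤ I.k := pairs_card hC.1.2.2 _ _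
    rcases hres' with ⟨a, b, c⟩ | ⟨a, b⟩
    · have hsub : I.visited s ⊆ I.visited s' := by
        refine h.good.least _ ?_
        have := hg'.closed
        rw [a] at this
        exact ⟨this.Y_sub, fun e ht hc => this.fwd e ht (hc.imp_left fun h' =>
          (hund' e).2 (.inl h')), this.bwd⟩
      have hTT : I.target C s' ⊆ I.target C s := by
        rw [target, b]
        exact pairs_mono (Finset.compl_subset_compl.2 hsub)
      by_cases hEq : I.target C s' = I.target C s
      · left
        refine hC.eq_of_pairs hZ hg'.flow hg'.closed hfree hdisj hg'.und_Z hg'.labOK ?_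
        intro e he hv hl i hi
        change _ ∈ I.target C s'
        rw [hEq, ← hU, pairSet, Finset.mem_filter, Finset.mem_range]
        rw [b] at hl ⊢
        -- This arc is still deletable, so refinement has passed it over; as it lay in front of the
        -- old cut and has a label below `k`, all its pairs were guessed.
        have hs : s.arr aSet (I.arcs aLab s e * I.numColors + i) ≠ 0 := fun h0 =>
          he ((hund' e).2 (.inr ⟨fun h' => hv (hsub h'), hl, i, hi, h0⟩))
        refine ⟨?_, hs⟩
        have := i.2
        calc _ < I.arcs aLab s e * I.numColors + I.numColors := by omega
          _ = (I.arcs aLab s e + 1) * I.numColors := by ring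
          _ ≤ _ := Nat.mul_le_mul_right _ hl
      · right
        have hss := Finset.card_lt_card (Finset.ssubset_iff_subset_ne.2 ⟨hTT, hEq⟩)
        have h1 : (symmDiff (I.pairSet s') (I.target C s')).card =
            (I.target C s).card - (I.target C s').card := by
          rw [c, hU]; exact card_symmDiff_of_subset hTT
        have h2 : (symmDiff (I.pairSet s) (I.target C s)).card = 0 := by rw [hU]; simp
        rw [potential, potential, h1, h2, a]
        have := Finset.card_le_card hTT
        clear * - hss this
        omega
    · right
      have h1 : (symmDiff (I.pairSet s') (I.target C s')).card = (I.target C s').card := by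
        rw [b, ← Finset.bot_eq_empty, bot_symmDiff]
      have h0 := h.good.nonneg
      rw [potential, potential, h1]
      -- The subtraction `k - value` is not truncated here, because the new value is at most `k` and
      -- the old one is nonnegative.
      have h3 : (I.k - (I.val (I.arcs aFlow s')).toNat) + 1 ≤
          I.k - (I.val (I.arcs aFlow s)).toNat := by
        clear * - hval hcard h0 a
        omega
      have h4 := Nat.mul_le_mul_right (3 * I.k + 3) h3
      rw [add_mul, one_mul] at h4
      clear * - h4 hT'
      omega
  -- The guess differs from the target in some pair, and toggling it removes it from the symmetric
  -- difference. Flow, labels and visited set stay the same, hence so does the target.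
  · obtain ⟨p, hp⟩ : ∃ p, p ∈ symmDiff (I.pairSet s) (I.target C s) := by
      by_contra hne
      push Not at hne
      exact hU (symmDiff_eq_bot.1 (Finset.eq_empty_of_forall_notMem hne))
    have hlt : p < I.k * I.numColors := by
      rcases Finset.mem_symmDiff.1 hp with h' | h'
      · exact Finset.mem_range.1 (Finset.mem_filter.1 h'.1).1
      · exact pairs_lt h'.1
    refine ⟨p, by omega, ?_⟩
    refine wp_ite (fun h1 => ?_) fun h1 => ?_
    swap
    · simp [RamTest.Holds, eval, h.good.static.pairs] at h1
      omega
    refine wp_mono ((hg p).wp_toggle (by simpa using hlt)) ?_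
    rintro t s' - ⟨-, hg', a1, a2, a3, a4, a5⟩
    have a1 : I.und s' = I.und s := a1
    have a2 : I.visited s' = I.visited s := a2
    have a3 : I.arcs aFlow s' = I.arcs aFlow s := a3
    have a4 : I.arcs aLab s' = I.arcs aLab s := a4
    have a5 : I.pairSet s' = symmDiff (I.pairSet s) {p} := by
      rw [RamState.setReg_reg, if_pos rfl] at a5
      exact a5
    refine ⟨⟨hg', a1 ▸ h.disj, a2 ▸ h.free⟩, .inr ?_⟩
    have hT : I.target C s' = I.target C s := by rw [target, a4, a2]; rfl
    have hD : symmDiff (I.pairSet s') (I.target C s') =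
        (symmDiff (I.pairSet s) (I.target C s)).erase p := by
      rw [a5, hT]; exact symmDiff_symmDiff_singleton hp
    have := Finset.card_erase_lt_of_mem hp
    rw [potential, potential, hD, hT, a3]
    clear * - this
    omega

end MBCut

/-! ### Executing an advice word, resetting the working memory, and the start state -/

namespace RamProg

/-- Execute the advice word. -/
def runWord : RamProg :=
  loop (.lt (reg rPos) (reg rLen))
    (set rSym (get aAdv (reg rPos)) ;; step ;; set rPos (succ (reg rPos)))

def clearRow : ℕ → RamProg
  | 0 => skip
  | j + 1 => clearRow j ;; gst (10 + j) (reg rI) (lit 0)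

def clearRegs : ℕ → RamProg
  | 0 => skip
  | j + 1 => clearRegs j ;; set (9 + j) (lit 0)

/-- Reset the working memory. -/
def clear : RamProg := forLoop rI (reg rBound) (clearRow 10) ;; clearRegs 18

/-- Start with the arcs outside `Z` undeletable. -/
def start : RamProg :=
  forLoop rI (reg rM) (ite (.eq (get aZ (reg rI)) (lit 1)) skip (gst aUnd (reg rI) (lit 1))) ;;
    reflow

end RamProg

namespace MBCut

variable {I : MBCut} {Z : Finset (Fin I.m)} {s s' b : RamState}

theorem Good.setReg (h : I.Good Z s) {r v : ℕ} (hr : 9 ≤ r) (hr' : r ≠ rFound) :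
    I.Good Z (s.setReg r v) :=
  h.congr (h.static.setReg hr) (by simp [hr'.symm]) rfl rfl rfl rfl

theorem Ready.setReg {C : Finset (Fin I.m)} (h : I.Ready Z C s) {r v : ℕ} (hr : 9 ≤ r)
    (hr' : r ≠ rFound) : I.Ready Z C (s.setReg r v) :=
  ⟨h.good.setReg hr hr', h.disj, h.free⟩

/-- Once the cut is found, the idle symbol `k * numColors + 1` preserves it. In this way shorter
successful words are padded to the common length. -/
theorem Ready.exists_symbol (hZ : Z ⊆ I.colored) {C : Finset (Fin I.m)} (hC : I.Important Z C)
    (h : I.Ready Z C s) : ∃ a < I.k * I.numColors + 2, step.wp (s.setReg rSym a) fun _ s' =>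
      I.Ready Z C s' ∧ (I.Done C s' ∨ (¬ I.Done C s ∧ I.potential C s' < I.potential C s)) := by
  by_cases hd : I.Done C s
  · refine ⟨I.k * I.numColors + 1, by omega, wp_ite (fun h1 => ?_) fun h1 =>
      wp_ite (fun h2 => ?_) fun h2 => wp_skip ⟨h.setReg (by norm_num) (by norm_num), .inl hd⟩⟩
    · simp [RamTest.Holds, eval, h.good.static.pairs] at h1
    · simp [RamTest.Holds, eval, h.good.static.pairs] at h2
  · obtain ⟨a, ha, hw⟩ := h.progress hZ hC
    exact ⟨a, ha, wp_mono hw fun t s' _ h' => ⟨h'.1, h'.2.imp_right fun h'' => ⟨hd, h''⟩⟩⟩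

/-- The word is built symbol by symbol by induction on the number of positions left. Since a step
does not mention the advice array, the state reached does not depend on it, and the run exists for
every advice content that agrees with the word at the remaining positions. -/
theorem Ready.cover (hZ : Z ⊆ I.colored) {C : Finset (Fin I.m)} (hC : I.Important Z C) (r : ℕ) :
    ∀ s, I.Ready Z C s → s.reg rPos + r = s.reg rLen → (I.Done C s ∨ I.potential C s ≤ r) →
      ∃ w : ℕ → ℕ, (∀ i, w i < I.k * I.numColors + 2) ∧ ∃ s',
        (∀ x o, (∀ i, s.reg rPos ≤ i → i < s.reg rLen → x i = w i) →
          ∃ t, runWord.Runs (s.plug aAdv x o) t (s'.plug aAdv x o)) ∧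
        I.Ready Z C s' ∧ I.Done C s' ∧ s'.out = s.out := by
  induction r with
  | zero =>
    intro s hs hl hd
    -- With no symbol left the cut must have been found already, since the potential is at least
    -- `2`.
    refine ⟨fun _ => 0, fun _ => Nat.succ_pos _, s, fun x o _ => ⟨_, .loop_false ?_⟩, hs,
      hd.resolve_right ?_, rfl⟩
    · simp only [RamTest.Holds, eval, RamState.plug]
      omega
    · rw [potential]
      omega
  | succ r ih =>
    intro s hs hl hd
    obtain ⟨a, ha, t₁, s₁, hr₁, hs₁, hd₁⟩ := hs.exists_symbol hZ hC
    have hp₁ : s₁.reg rPos = s.reg rPos := by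
      rw [hr₁.frame.reg rPos rfl]
      simp
    have hl₁ : s₁.reg rLen = s.reg rLen := by
      rw [hr₁.frame.reg rLen rfl]
      simp
    have ho₁ : s₁.out = s.out := hr₁.frame.out rfl
    have hs₂ : I.Ready Z C (s₁.setReg rPos (s.reg rPos + 1)) :=
      hs₁.setReg (by norm_num) (by norm_num)
    obtain ⟨w, hw, s₃, hr₃, hs₃, hd₃, ho₃⟩ := ih _ hs₂ (by simp [hl₁]; omega)
      (hd₁.imp_right fun ⟨h1, h2⟩ => by
        have := hd.resolve_left h1
        change I.potential C s₁ ≤ r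
        omega)
    refine ⟨Function.update w (s.reg rPos) a, fun i => ?_, s₃, fun x o hx => ?_, hs₃, hd₃,
      ho₃.trans ho₁⟩
    · by_cases hi : i = s.reg rPos
      · subst hi; simpa using ha
      · rw [Function.update_of_ne hi]; exact hw i
    · have e1 := Runs.set rSym (get aAdv (reg rPos)) (s.plug aAdv x o)
      have hx' : x (s.reg rPos) = a := by
        rw [hx _ le_rfl (by omega), Function.update_self]
      have h1 : (RamExpr.get aAdv (reg rPos)).eval (s.plug aAdv x o) = a := by
        simp [eval, RamState.plug, hx']
      rw [h1] at e1
      have e2 : step.Runs _ t₁ _ := hr₁.plug (a := aAdv) rfl x o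
      have e3 := Runs.set rPos (succ (reg rPos)) (s₁.plug aAdv x o)
      have h3 : (RamExpr.succ (reg rPos)).eval (s₁.plug aAdv x o) = s.reg rPos + 1 := by
        simp [eval, RamState.plug, hp₁]
      rw [h3] at e3
      obtain ⟨t₃, hr₃⟩ := hr₃ x o fun i hi hi' => by
        simp only [RamState.setReg_reg] at hi hi'
        rw [if_neg (by norm_num), hl₁] at hi'
        rw [if_true] at hi
        rw [hx i (by omega) hi', Function.update_of_ne (by omega)]
      refine ⟨_, .loop_true ?_ (e1.seq (e2.seq e3)) hr₃⟩
      simp only [RamTest.Holds, eval, RamState.plug]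
      omega

theorem Good.wp_runWord (h : I.Good Z s) (hp : s.reg rPos = 0) :
    runWord.wp s fun t s' =>
      t ≤ 3 * (I.k + 1) ^ 2 * (900 * ((I.k + 2) ^ 2 * (I.n + I.m + 1)) + 10) + 3 ∧ I.Good Z s' := by
  set B := 900 * ((I.k + 2) ^ 2 * (I.n + I.m + 1)) with hB
  refine wp_mono (wp_loop (fun φ s' => I.Good Z s' ∧ s'.reg rPos ≤ 3 * (I.k + 1) ^ 2 ∧
    φ = (3 * (I.k + 1) ^ 2 - s'.reg rPos) * (B + 10)) (3 * (I.k + 1) ^ 2 * (B + 10))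
    ⟨h, by omega, by rw [hp]; simp⟩ ?_) ?_
  · rintro φ s₁ - ⟨hg, hle, rfl⟩ hlt
    simp only [RamTest.Holds, eval, hg.static.len] at hlt
    refine wp_seq (wp_set (wp_seq (wp_mono
      (hg.setReg (by norm_num) (by norm_num)).wp_step ?_)))
    rintro t s₂ hF ⟨ht, hg₂⟩
    have hp₂ : s₂.reg rPos = s₁.reg rPos := by
      rw [hF.reg rPos rfl]; simp
    refine wp_set ⟨_, ⟨hg₂.setReg (by norm_num) (by norm_num), ?_, rfl⟩, ?_⟩
    · simp [eval, hp₂]; omega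
    · simp only [eval, hp₂, RamState.setReg_reg, if_true, RamTest.cost, cost]
      obtain ⟨d, hd⟩ : ∃ d, 3 * (I.k + 1) ^ 2 = s₁.reg rPos + 1 + d :=
        ⟨_, (Nat.add_sub_cancel' hlt).symm⟩
      rw [hd, show s₁.reg rPos + 1 + d - (s₁.reg rPos + 1) = d by omega,
        show s₁.reg rPos + 1 + d - s₁.reg rPos = d + 1 by omega, Nat.add_mul]
      omega
  · rintro t s' - ⟨ht, -, φ, hg, -⟩
    exact ⟨by simpa [RamTest.cost, cost] using ht, hg⟩

/-- The state after resetting the working memory of `b`. -/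
def canon (b : RamState) : RamState where
  reg r := if 9 ≤ r ∧ r < 27 then 0 else b.reg r
  arr a i := if 10 ≤ a ∧ a < 20 ∧ i < b.reg rBound then 0 else b.arr a i
  out := []

/-- `s` agrees with `b` except for the working memory and the advice word. -/
structure Like (b s : RamState) : Prop where
  reg : ∀ r, ¬ (9 ≤ r ∧ r < 27) → s.reg r = b.reg r
  arr : ∀ a i, a ≠ aAdv → ¬ (10 ≤ a ∧ a < 20 ∧ i < b.reg rBound) → s.arr a i = b.arr a i

theorem Like.static (h : Like b s) (hb : I.Static Z b) : I.Static Z s :=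
  hb.congr (fun r hr => h.reg r (by omega)) fun a ha => funext fun i =>
    h.arr a i (by omega) (by omega)

theorem wp_clearRow (j : ℕ) (hb : s.reg rI < s.reg rBound) :
    (clearRow j).wp s fun t s' => t ≤ 6 * j + 1 ∧ s'.reg = s.reg ∧ s'.out = s.out ∧
      ∀ a i, s'.arr a i = if 10 ≤ a ∧ a < 10 + j ∧ i = s.reg rI then 0 else s.arr a i := by
  induction j with
  | zero => exact wp_skip ⟨by simp, rfl, rfl, fun a i => by rw [if_neg]; omega⟩
  | succ j ih =>
    refine wp_seq (wp_mono ih ?_)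
    rintro t₁ s₁ - ⟨ht, hr, ho, ha⟩
    refine wp_gst (by simpa [eval, hr] using hb) ⟨by simp [cost]; omega, hr, ho, fun a i => ?_⟩
    simp only [eval, RamState.write_arr, hr]
    by_cases h1 : a = 10 + j
    · subst h1
      rw [if_pos rfl]
      by_cases h2 : i = s.reg rI
      · subst h2
        rw [Function.update_self, if_pos ⟨by omega, by omega, rfl⟩]
      · rw [Function.update_of_ne h2, ha, if_neg (by omega), if_neg (by omega)]
    · rw [if_neg h1, ha]
      exact if_congr (by omega) rfl rfl

theorem wp_clearRegs (j : ℕ) :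
    (clearRegs j).wp s fun t s' => t ≤ 2 * j + 1 ∧ s'.arr = s.arr ∧ s'.out = s.out ∧
      ∀ r, s'.reg r = if 9 ≤ r ∧ r < 9 + j then 0 else s.reg r := by
  induction j with
  | zero => exact wp_skip ⟨by simp, rfl, rfl, fun r => by rw [if_neg]; omega⟩
  | succ j ih =>
    refine wp_seq (wp_mono ih ?_)
    rintro t₁ s₁ - ⟨ht, ha, ho, hr⟩
    refine wp_set ⟨by simp [cost]; omega, ha, ho, fun r => ?_⟩
    simp only [eval, RamState.setReg_reg]
    by_cases h1 : r = 9 + j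
    · rw [if_pos h1, if_pos (by omega)]
    · rw [if_neg h1, hr]
      exact if_congr (by omega) rfl rfl

/-- Everything in which `s` may differ from `b` is reset, apart from the advice array and the
output. So the new state is the fixed state `canon b` with these two plugged in. -/
theorem Like.wp_clear (h : Like b s) :
    clear.wp s fun t s' => t ≤ 70 * (b.reg rBound + 2) ∧
      s' = (canon b).plug aAdv (s.arr aAdv) s.out := by
  have hB : s.reg rBound = b.reg rBound := h.reg _ (by norm_num)
  refine wp_seq (wp_mono (wp_for (b.reg rBound) 61 (fun j s' => s'.reg rBound = b.reg rBound ∧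
    s'.out = s.out ∧ (∀ r, ¬ (9 ≤ r ∧ r < 27) → s'.reg r = s.reg r) ∧
    ∀ a i, s'.arr a i = if 10 ≤ a ∧ a < 20 ∧ i < j then 0 else s.arr a i) rfl ?_ ?_ ?_ ?_) ?_)
  · intro s' hF
    rw [eval, hF.reg rBound rfl, hB]
  · rintro j s' v ⟨h1, h2, h3, h4⟩
    exact ⟨by simpa using h1, h2, fun r hr => by simpa [show r ≠ 9 by omega] using h3 r hr, h4⟩
  · exact ⟨hB, rfl, fun _ _ => rfl, fun a i => by rw [if_neg]; omega⟩
  · rintro j s₁ hj hF hj₁ ⟨h1, h2, h3, h4⟩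
    refine wp_mono (wp_clearRow 10 (by omega)) ?_
    rintro t s₂ - ⟨ht, hr, ho, ha⟩
    refine ⟨by omega, by rw [hr, h1], by rw [ho, h2], fun r hr' => by rw [hr, h3 r hr'],
      fun a i => ?_⟩
    rw [ha, hj₁, h4]
    split_ifs <;> first | rfl | omega
  · rintro t s₁ - ⟨ht, h1, h2, h3, h4⟩
    refine wp_mono (wp_clearRegs 18) ?_
    rintro t' s₂ - ⟨ht', ha, ho, hr⟩
    refine ⟨by simp only [cost] at ht; omega, ?_⟩
    have e1 : s₂.reg = (canon b).reg := by
      funext r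
      rw [hr, canon]
      simp only
      by_cases hh : 9 ≤ r ∧ r < 27
      · rw [if_pos hh, if_pos (by omega)]
      · rw [if_neg hh, if_neg (by omega), h3 r hh, h.reg r hh]
    have e2 : s₂.arr = Function.update (canon b).arr aAdv (s.arr aAdv) := by
      funext a i
      rw [ha, h4]
      by_cases h9 : a = aAdv
      · subst h9
        simp
      · rw [Function.update_of_ne h9, canon]
        simp only
        by_cases hh : 10 ≤ a ∧ a < 20 ∧ i < b.reg rBound
        · rw [if_pos hh, if_pos hh]
        · rw [if_neg hh, if_neg hh, h.arr a i h9 hh]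
    have e3 : s₂.out = s.out ++ (canon b).out := by rw [ho, h2]; simp [canon]
    cases s₂
    simp only at e1 e2 e3
    simp only [RamState.plug, e1, e2, e3]

theorem canon_static (hb : I.Static Z b) : I.Static Z (canon b) :=
  hb.congr (fun r hr => by simp only [canon]; rw [if_neg]; omega) fun a ha => funext fun i => by
    simp only [canon]; rw [if_neg]; omega

/-- A cut saturated by the zero flow has no arcs at all, so the initial labels do not matter. -/
theorem labOK_zero (lab : Fin I.m → ℕ) : I.LabOK (fun _ => 0) lab := by
  intro A hA _
  have : ∀ e, e ∉ I.outArcs A := fun e he => by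
    have := mem_outArcs.1 he
    simpa using hA.out e this.1 this.2
  exact ⟨fun e he => absurd he (this e), fun e he => absurd he (this e)⟩

theorem wp_start (hb : I.Static Z s) (h0 : ∀ a i, 10 ≤ a → a < 20 → i < s.reg rBound →
    s.arr a i = 0) :
    start.wp s fun t s' => t ≤ 830 * ((I.k + 2) ^ 2 * (I.n + I.m + 1)) ∧ I.Good Z s' ∧
      I.und s' = Zᶜ ∧ I.pairSet s' = ∅ ∧
      (Disjoint I.X (I.visited s') ∨ (I.k : ℤ) + 1 ≤ I.val (I.arcs aFlow s')) := by
  have hB := hb.bound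
  refine wp_seq (wp_mono (wp_for I.m 10 (fun j s' => ∀ e : Fin I.m, s'.arr aUnd e =
    if (e : ℕ) < j ∧ e ∉ Z then 1 else 0) rfl ?_ (fun _ _ _ h => h) ?_ ?_) ?_)
  · intro s' hF
    rw [eval, hF.reg rM rfl, hb.m]
  · intro e
    rw [if_neg (by omega)]
    exact h0 _ _ (by norm_num) (by norm_num) (by omega)
  · intro j s₁ hj hF hj₁ hinv
    have h₁ : I.Static Z s₁ := hb.frame hF ⟨by decide, by decide⟩
    have hz := h₁.z ⟨j, hj⟩
    simp only at hz
    refine wp_ite (fun h1 => wp_skip ⟨by simp [RamTest.cost, cost], fun e => ?_⟩)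
      fun h1 => wp_gst ?_ ⟨by simp [RamTest.cost, cost], fun e => ?_⟩
    · simp only [RamTest.Holds, eval, hj₁, hz] at h1
      rw [hinv]
      refine if_congr ?_ rfl rfl
      by_cases he : (e : ℕ) = j
      · have : e = ⟨j, hj⟩ := Fin.ext he
        subst this
        have : (⟨j, hj⟩ : Fin I.m) ∈ Z := by
          by_contra hc
          simp [hc] at h1
        simp [this]
      · have : (e : ℕ) < j + 1 ↔ (e : ℕ) < j := by omega
        rw [this]
    · simp only [eval, hj₁, h₁.bound]; omega
    · simp only [RamTest.Holds, eval, hj₁, hz] at h1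
      simp only [eval, hj₁, RamState.write_arr, if_true]
      by_cases he : (e : ℕ) = j
      · have : e = ⟨j, hj⟩ := Fin.ext he
        subst this
        rw [Function.update_self, if_pos ⟨Nat.lt_succ_self _, fun hc => h1 (by rw [if_pos hc])⟩]
      · rw [Function.update_of_ne he, hinv]
        have : (e : ℕ) < j + 1 ↔ (e : ℕ) < j := by omega
        exact if_congr (and_congr_left fun _ => this.symm) rfl rfl
  · intro t₁ s₁ hF₁ ⟨ht₁, hinv⟩
    have h₁ : I.Static Z s₁ := hb.frame hF₁ ⟨by decide, by decide⟩
    have hund : I.und s₁ = Zᶜ := by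
      ext e
      rw [mem_und, hinv, Finset.mem_compl]
      simp
    have hflow : I.arcs aFlow s₁ = fun _ => 0 := by
      funext e
      rw [arcs, hF₁.arr aFlow rfl]
      exact h0 _ _ (by norm_num) (by norm_num) (by omega)
    have hex : ∀ v, I.excess (fun _ => 0) v = 0 := fun v => by simp [excess]
    have hset : ∀ p < I.k * I.numColors, s₁.arr aSet p = 0 := fun p hp => by
      rw [hF₁.arr aSet rfl]
      exact h0 _ _ (by norm_num) (by norm_num) (by omega)
    refine wp_mono (h₁.wp_reflow ?_ ?_ ?_ ?_) ?_
    · rw [hflow]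
      exact ⟨fun _ _ => by norm_num, fun v _ _ => hex v⟩
    · rw [hflow]
      simp [val, hex]
    · intro e he
      simpa [hund] using he
    · rw [hflow]
      exact labOK_zero _
    · rintro t₂ s₂ - ⟨ht₂, hg, hu, hres, hfin⟩
      refine ⟨?_, hg, hu.trans hund, ?_, hfin⟩
      · have : 1 * (I.n + I.m + 1) ≤ (I.k + 2) ^ 2 * (I.n + I.m + 1) :=
          Nat.mul_le_mul_right _ (Nat.one_le_pow _ _ (by omega))
        simp only [cost] at ht₁
        omega
      · refine Finset.filter_eq_empty_iff.2 fun p hp => ?_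
        have hp := Finset.mem_range.1 hp
        rcases hres with ⟨-, -, h'⟩ | ⟨-, h'⟩
        · simpa [h'] using hset p hp
        · simpa using h' p hp

end MBCut

/-! ### Checking and printing the current cut -/

namespace RamProg

/-- Mark the arcs of the current cut and count them. -/
def markCut : RamProg :=
  set rCnt (lit 0) ;;
    forLoop rI (reg rM)
      (ite (.eq (get aVis (get aSrc (reg rI))) (lit 1)) (gst aCut (reg rI) (lit 0))
        (ite (.eq (get aVis (get aTgt (reg rI))) (lit 1))
          (gst aCut (reg rI) (lit 1) ;; set rCnt (succ (reg rCnt)))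
          (gst aCut (reg rI) (lit 0))))

/-- Check that the marked arcs respect the budgets. -/
def checkBudgets : RamProg :=
  set rGood (lit 1) ;; set rQ (reg rCol) ;;
    forLoop rI (reg rL)
      (set rP (get aIn (reg rQ)) ;; set rQ (succ (reg rQ)) ;;
        forLoop rE (reg rM)
          (ite (.eq (get aIn (reg rQ)) (lit 1))
              (ite (.eq (get aCut (reg rE)) (lit 1))
                (ite (.eq (reg rP) (lit 0)) (set rGood (lit 0)) (set rP (pred (reg rP)))) skip)
              skip ;;
            set rQ (succ (reg rQ))))

def emitCut : RamProg :=
  emit (reg rCnt) ;; forLoop rI (reg rM) (ite (.eq (get aCut (reg rI)) (lit 1)) (emit (reg rI)) skip)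

/-- Output the current cut if it is admissible. -/
def output : RamProg :=
  ite (.eq (reg rFound) (lit 0))
    (markCut ;; checkBudgets ;; ite (.eq (reg rGood) (lit 1)) emitCut skip) skip

end RamProg

namespace MBCut

variable {I : MBCut} {Z : Finset (Fin I.m)} {s s' b : RamState}

/-- The elements of `C` with index less than `x`. -/
def below (C : Finset (Fin I.m)) (x : ℕ) : Finset (Fin I.m) := C.filter fun e => (e : ℕ) < x

theorem below_zero (C : Finset (Fin I.m)) : below C 0 = ∅ := by simp [below]

theorem below_m (C : Finset (Fin I.m)) : below C I.m = C :=
  Finset.filter_true_of_mem fun e _ => e.2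

theorem card_below_succ (C : Finset (Fin I.m)) {x : ℕ} (hx : x < I.m) :
    (below C (x + 1)).card = (below C x).card + if ⟨x, hx⟩ ∈ C then 1 else 0 := by
  by_cases h : (⟨x, hx⟩ : Fin I.m) ∈ C
  · have : below C (x + 1) = insert ⟨x, hx⟩ (below C x) := by
      ext e
      simp only [below, Finset.mem_filter, Finset.mem_insert, Fin.ext_iff]
      constructor
      · rintro ⟨h1, h2⟩
        by_cases h3 : (e : ℕ) = x
        · exact .inl h3
        · exact .inr ⟨h1, by omega⟩
      · rintro (h1 | ⟨h1, h2⟩)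
        · refine ⟨?_, by omega⟩
          rwa [show e = ⟨x, hx⟩ from Fin.ext h1]
        · exact ⟨h1, by omega⟩
    rw [this, Finset.card_insert_of_notMem (by simp [below]), if_pos h]
  · rw [if_neg h, Nat.add_zero]
    congr 1
    ext e
    simp only [below, Finset.mem_filter]
    refine and_congr_right fun he => ?_
    have : (e : ℕ) ≠ x := fun h' => h (by rwa [show e = ⟨x, hx⟩ from Fin.ext h'] at he)
    omega

theorem safe_markCut : markCut.Safe := ⟨by decide, by decide⟩
theorem safe_checkBudgets : checkBudgets.Safe := ⟨by decide, by decide⟩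

theorem Static.wp_markCut (h : I.Static Z s) :
    markCut.wp s fun t s' => t ≤ 30 * (I.m + 1) ∧
      s'.reg rCnt = (I.outArcs (I.visited s)ᶜ).card ∧
      ∀ e : Fin I.m, s'.arr aCut e = if e ∈ I.outArcs (I.visited s)ᶜ then 1 else 0 := by
  set C := I.outArcs (I.visited s)ᶜ with hC
  refine wp_seq (wp_set (wp_mono (wp_for I.m 20 (fun j s' => s'.reg rCnt = (below C j).card ∧
    ∀ e : Fin I.m, (e : ℕ) < j → s'.arr aCut e = if e ∈ C then 1 else 0) rfl ?_ ?_ ?_ ?_) ?_))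
  · intro s' hF
    rw [eval, hF.reg rM rfl]
    simpa using h.m
  · intro j s' v h
    simpa using h
  · exact ⟨by simp [eval, below_zero], fun e he => absurd he (Nat.not_lt_zero _)⟩
  · rintro j s₁ hj hF₁ hj₁ ⟨hcnt, hinv⟩
    have h₁ : I.Static Z s₁ := (h.setReg (by norm_num)).frame hF₁ ⟨by decide, by decide⟩
    have hvis : s₁.arr aVis = s.arr aVis := hF₁.arr aVis rfl
    set e₀ : Fin I.m := ⟨j, hj⟩ with he₀
    have hsrc : s₁.arr aSrc j = I.src e₀ := h₁.srcF e₀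
    have htgt : s₁.arr aTgt j = I.tgt e₀ := h₁.tgtF e₀
    have hb : j < s₁.reg rBound := by rw [h₁.bound]; omega
    have hmem : e₀ ∈ C ↔ s.arr aVis (I.src e₀) ≠ 1 ∧ s.arr aVis (I.tgt e₀) = 1 := by
      simp [hC, mem_outArcs, mem_visited]
    have hupd : ∀ v : ℕ, v = (if e₀ ∈ C then 1 else 0) → ∀ e : Fin I.m, (e : ℕ) < j + 1 →
        Function.update (s₁.arr aCut) j v e = if e ∈ C then 1 else 0 := by
      intro v hv e he
      by_cases h' : (e : ℕ) = j
      · rw [h', Function.update_self, hv, show e = e₀ from Fin.ext h']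
      · rw [Function.update_of_ne h']
        exact hinv e (by omega)
    refine wp_ite (fun a1 => wp_gst ?_ ?_) fun a1 => wp_ite (fun a2 => wp_seq (wp_gst ?_ (wp_set ?_)))
      fun a2 => wp_gst ?_ ?_
    all_goals simp only [eval, hj₁]
    any_goals exact hb
    all_goals simp only [RamTest.Holds, eval, hj₁, hsrc, hvis] at a1
    · have hn : e₀ ∉ C := fun h' => (hmem.1 h').1 a1
      refine ⟨by simp [RamTest.cost, cost], ?_, by simpa using hupd 0 (by rw [if_neg hn])⟩
      rw [card_below_succ C hj, if_neg hn]
      simpa using hcnt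
    · simp only [RamTest.Holds, eval, hj₁, htgt, hvis] at a2
      have hn : e₀ ∈ C := hmem.2 ⟨a1, a2⟩
      refine ⟨by simp [RamTest.cost, cost], ?_, by simpa using hupd 1 (by rw [if_pos hn])⟩
      rw [card_below_succ C hj, if_pos hn]
      simpa using hcnt
    · simp only [RamTest.Holds, eval, hj₁, htgt, hvis] at a2
      have hn : e₀ ∉ C := fun h' => a2 (hmem.1 h').2
      refine ⟨by simp [RamTest.cost, cost], ?_, by simpa using hupd 0 (by rw [if_neg hn])⟩
      rw [card_below_succ C hj, if_neg hn]
      simpa using hcnt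
  · rintro t s' hF ⟨ht, hcnt, hinv⟩
    refine ⟨?_, by rw [hcnt, below_m], fun e => hinv e e.2⟩
    simp only [cost] at ht ⊢
    omega

theorem Static.wp_checkBudgets (h : I.Static Z s) {C : Finset (Fin I.m)}
    (hcut : ∀ e : Fin I.m, s.arr aCut e = if e ∈ C then 1 else 0) :
    checkBudgets.wp s fun t s' => t ≤ 60 * ((I.k + 1) * (I.m + 1)) ∧
      (s'.reg rGood = 1 ↔ ∀ i, (C ∩ I.color i).card ≤ I.budget i) := by
  refine wp_seq (wp_set (wp_seq (wp_set (wp_mono (wp_for I.numColors ((I.m + 1) * 26 + 10)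
    (fun i s' => s'.reg rQ = s.reg rCol + i * (I.m + 1) ∧ (s'.reg rGood = 1 ↔
      ∀ c : Fin I.numColors, (c : ℕ) < i → (C ∩ I.color c).card ≤ I.budget c))
    rfl ?_ ?_ ?_ ?_) ?_))))
  · intro s' hF
    rw [eval, hF.reg rL rfl]
    simpa using h.l
  · intro j s' v h
    simpa using h
  · exact ⟨by simp [eval], iff_of_true (by simp [eval]) fun c hc => absurd hc (Nat.not_lt_zero _)⟩
  · rintro i s₁ hi hF₁ hi₁ ⟨hq₁, hgood₁⟩
    have h₁ : I.Static Z s₁ := ((h.setReg (by norm_num)).setReg (by norm_num)).frame hF₁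
      ⟨by decide, by decide⟩
    have hcol₁ : s₁.reg rCol = s.reg rCol := by rw [hF₁.reg rCol rfl]; simp
    have hcut₁ : s₁.arr aCut = s.arr aCut := hF₁.arr aCut rfl
    set c₀ : Fin I.numColors := ⟨i, hi⟩ with hc₀
    have hbud : s₁.arr aIn (s.reg rCol + i * (I.m + 1)) = I.budget c₀ := hcol₁ ▸ h₁.budget c₀
    -- The register `rP` counts the budget down. With truncated subtraction its value stays correct
    -- after the budget is exceeded, and the overrun is remembered in `rGood`.
    refine wp_seq (wp_set (wp_seq (wp_set (wp_mono (wp_for I.m 20 (fun x s' =>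
      s'.reg rQ = s.reg rCol + i * (I.m + 1) + 1 + x ∧
      s'.reg rP = I.budget c₀ - (below (C ∩ I.color c₀) x).card ∧ (s'.reg rGood = 1 ↔
        (∀ c : Fin I.numColors, (c : ℕ) < i → (C ∩ I.color c).card ≤ I.budget c) ∧
        (below (C ∩ I.color c₀) x).card ≤ I.budget c₀)) rfl ?_ ?_ ?_ ?_) ?_))))
    · intro s' hF
      rw [eval, hF.reg rM rfl]
      simpa using h₁.m
    · intro j s' v h
      simpa using h
    · refine ⟨by simp [eval, hq₁], by simp [eval, hq₁, hbud, below_zero], ?_⟩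
      simpa [below_zero] using hgood₁
    · rintro x s₂ hx hF₂ hx₂ ⟨hq₂, hp₂, hgood₂⟩
      have h₂ : I.Static Z s₂ := ((h₁.setReg (by norm_num)).setReg (by norm_num)).frame hF₂
        ⟨by decide, by decide⟩
      have hcol₂ : s₂.reg rCol = s.reg rCol := by rw [hF₂.reg rCol rfl]; simpa using hcol₁
      have hcut₂ : s₂.arr aCut = s.arr aCut := by rw [hF₂.arr aCut rfl]; exact hcut₁
      set e₀ : Fin I.m := ⟨x, hx⟩ with he₀
      have hce : s₂.arr aIn (s.reg rCol + i * (I.m + 1) + 1 + x) =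
          if e₀ ∈ I.color c₀ then 1 else 0 := hcol₂ ▸ h₂.color c₀ e₀
      have hcx : s.arr aCut x = if e₀ ∈ C then 1 else 0 := hcut e₀
      have hsucc := card_below_succ (C ∩ I.color c₀) hx
      rw [← he₀] at hsucc
      refine wp_seq (wp_ite (fun a1 => wp_ite (fun a2 => wp_ite (fun a3 => wp_set ?_)
        fun a3 => wp_set ?_) fun a2 => wp_skip ?_) fun a1 => wp_skip ?_)
      all_goals refine wp_set ⟨by simp [RamTest.cost, cost], by simp [eval, hq₂]; omega, ?_⟩
      all_goals simp only [RamTest.Holds, eval, hq₂, hce, ite_eq_left_iff, zero_ne_one, imp_false,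
        not_not] at a1
      · simp only [RamTest.Holds, eval, hx₂, hcut₂, hcx, ite_eq_left_iff, zero_ne_one,
          imp_false, not_not] at a2
        rw [if_pos (Finset.mem_inter.2 ⟨a2, a1⟩)] at hsucc
        simp [RamTest.Holds, eval] at a3
        simp [eval, hsucc]
        omega
      · simp only [RamTest.Holds, eval, hx₂, hcut₂, hcx, ite_eq_left_iff, zero_ne_one,
          imp_false, not_not] at a2
        rw [if_pos (Finset.mem_inter.2 ⟨a2, a1⟩)] at hsucc
        simp [RamTest.Holds, eval] at a3
        refine ⟨by simp [eval, hsucc, hp₂]; omega, ?_⟩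
        simp only [eval, RamState.setReg_reg, show rGood ≠ rQ by norm_num,
          show rGood ≠ rP by norm_num, if_false, hgood₂, hsucc]
        exact and_congr_right fun _ => by omega
      · simp only [RamTest.Holds, eval, hx₂, hcut₂, hcx, ite_eq_left_iff, zero_ne_one,
          imp_false, not_not] at a2
        rw [if_neg (by simp [a2])] at hsucc
        simp [eval, hsucc, hp₂, hgood₂]
      · rw [if_neg (by simp [a1])] at hsucc
        simp [eval, hsucc, hp₂, hgood₂]
    · rintro t₂ s₂ hF₂ ⟨ht₂, hq₂, -, hgood₂⟩
      refine ⟨?_, by rw [hq₂]; ring, ?_⟩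
      · simp only [cost] at ht₂ ⊢; omega
      · rw [hgood₂, below_m]
        constructor
        · rintro ⟨g1, g2⟩ c hc
          by_cases hci : (c : ℕ) = i
          · rw [show c = c₀ from Fin.ext hci]; exact g2
          · exact g1 c (by omega)
        · exact fun g => ⟨fun c hc => g c (by omega), g c₀ (Nat.lt_succ_self _)⟩
  · rintro t₁ s₁ hF₁ ⟨ht₁, -, hgood₁⟩
    refine ⟨?_, by rw [hgood₁]; exact ⟨fun g c => g c c.2, fun g c _ => g c⟩⟩
    have hl := numColors_le_k (I := I)
    simp only [cost] at ht₁ ⊢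
    have h1 : (I.numColors + 1) * ((I.m + 1) * 26 + 10 + 1 + 5) ≤
        (I.k + 1) * ((I.m + 1) * 42) := Nat.mul_le_mul (by omega) (by omega)
    have h2 : 1 ≤ (I.k + 1) * (I.m + 1) := Nat.mul_pos (by omega) (by omega)
    have h3 : (I.k + 1) * ((I.m + 1) * 42) = 42 * ((I.k + 1) * (I.m + 1)) := by ring
    omega

theorem Static.wp_emitCut (h : I.Static Z s) {C : Finset (Fin I.m)}
    (hcut : ∀ e : Fin I.m, s.arr aCut e = if e ∈ C then 1 else 0) (hcnt : s.reg rCnt = C.card) :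
    emitCut.wp s fun t s' => t ≤ 20 * (I.m + 1) ∧
      ∃ D : List (Fin I.m), D.Nodup ∧ D.toFinset = C ∧ s'.out = s.out ++ I.encodeFamily [D] := by
  have hnd : ((List.finRange I.m).filter (· ∈ C)).Nodup := (List.nodup_finRange _).filter _
  have hfin : ((List.finRange I.m).filter (· ∈ C)).toFinset = C := by ext e; simp
  refine wp_seq (wp_emit (wp_mono (wp_for I.m 8 (fun x s' => s'.out = s.out ++ C.card ::
    (((List.finRange I.m).take x).filter (· ∈ C)).map fun e => (e : ℕ)) rfl ?_ ?_ ?_ ?_) ?_))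
  · intro s' hF
    rw [eval, hF.reg rM rfl]
    simpa using h.m
  · intro j s' v h
    simpa using h
  · simp [eval, hcnt]
  · intro x s₁ hx hF₁ hx₁ hout
    have hc : s₁.arr aCut x = if (⟨x, hx⟩ : Fin I.m) ∈ C then 1 else 0 := by
      rw [hF₁.arr aCut rfl]; exact hcut ⟨x, hx⟩
    have htake : (List.finRange I.m).take (x + 1) = (List.finRange I.m).take x ++ [⟨x, hx⟩] := by
      rw [List.take_add_one, List.getElem?_eq_getElem (by simpa using hx)]
      simp
    rw [htake]
    refine wp_ite (fun a1 => wp_emit ⟨by simp [RamTest.cost, cost], ?_⟩)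
      fun a1 => wp_skip ⟨by simp [RamTest.cost, cost], ?_⟩
    all_goals simp only [RamTest.Holds, eval, hx₁, hc, ite_eq_left_iff, zero_ne_one, imp_false,
      not_not] at a1
    · simp [eval, hx₁, hout, a1]
    · simp [hout, a1]
  · intro t s' hF ⟨ht, hout⟩
    refine ⟨by simp only [cost] at ht ⊢; omega, _, hnd, hfin, ?_⟩
    rw [hout, List.take_of_length_le (by simp)]
    simp only [encodeFamily, List.flatMap_cons, List.flatMap_nil, List.append_nil]
    rw [← List.toFinset_card_of_nodup hnd, hfin]

/-- Minimality and containment in `Z` hold for the minimum cut of every state that satisfies the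
invariant and has a maximum flow. Only the budgets have to be checked by the machine. -/
theorem Good.admissible (hZ : Z ⊆ I.colored) (h : I.Good Z s) (hX : Disjoint I.X (I.visited s))
    (hb : ∀ i, (I.outArcs (I.visited s)ᶜ ∩ I.color i).card ≤ I.budget i) :
    I.Admissible Z (I.outArcs (I.visited s)ᶜ) := by
  have hsat := h.closed.satCut h.flow hX
  have hdis := h.closed.outArcs_disjoint
  have hsub : I.outArcs (I.visited s)ᶜ ⊆ Z := fun e he =>
    h.und_Z e (Finset.disjoint_left.1 hdis he)
  exact ⟨hsat.isMinimalCut h.flow hdis, hsub, hsub.trans hZ, hb⟩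

theorem Good.wp_output (hZ : Z ⊆ I.colored) (h : I.Good Z s) :
    output.wp s fun t s' => t ≤ 130 * ((I.k + 1) * (I.m + 1)) ∧
      ∃ F : List (List (Fin I.m)), F.length ≤ 1 ∧ s'.out = s.out ++ I.encodeFamily F ∧
        (∀ D ∈ F, D.Nodup ∧ I.Admissible Z D.toFinset) ∧
        ∀ C, I.Admissible Z C → Disjoint I.X (I.visited s) → I.Done C s →
          ∃ D ∈ F, D.toFinset = C := by
  have hpos : I.m + 1 ≤ (I.k + 1) * (I.m + 1) := Nat.le_mul_of_pos_left _ (by omega)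
  refine wp_ite (fun a1 => ?_) fun a1 => wp_skip ⟨?_, [], by simp, by simp [encodeFamily], by simp,
    fun C _ hX _ => absurd (h.found.2 hX) a1⟩
  swap
  · simp only [RamTest.cost, cost]; omega
  have hX := h.found.1 a1
  refine wp_seq (wp_mono h.static.wp_markCut ?_)
  rintro t₁ s₁ hF₁ ⟨ht₁, hcnt₁, hcut₁⟩
  have h₁ := h.static.frame hF₁ safe_markCut
  refine wp_seq (wp_mono (h₁.wp_checkBudgets hcut₁) ?_)
  rintro t₂ s₂ hF₂ ⟨ht₂, hgood⟩
  have h₂ := h₁.frame hF₂ safe_checkBudgets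
  have hout : s₂.out = s.out := (hF₂.out rfl).trans (hF₁.out rfl)
  refine wp_ite (fun a2 => ?_) fun a2 => wp_skip ⟨?_, [], by simp, by simp [encodeFamily, hout],
    by simp, fun C hC _ hd => ?_⟩
  · refine wp_mono (h₂.wp_emitCut (C := I.outArcs (I.visited s)ᶜ)
      (by rw [hF₂.arr aCut rfl]; exact hcut₁) (by rw [hF₂.reg rCnt rfl]; exact hcnt₁)) ?_
    rintro t₃ s₃ - ⟨ht₃, D, hnd, hD, ho⟩
    refine ⟨?_, [D], by simp, by rw [ho, hout], ?_, fun C _ _ hd => ⟨D, by simp, hD.trans hd.symm⟩⟩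
    · simp only [RamTest.cost, cost]; omega
    · intro D' hD'
      obtain rfl := List.mem_singleton.1 hD'
      exact ⟨hnd, by rw [hD]; exact h.admissible hZ hX (hgood.1 a2)⟩
  · simp only [RamTest.cost, cost]; omega
  · refine absurd (hgood.2 fun i => ?_) a2
    rw [Done] at hd
    rw [← hd]
    exact hC.2.2.2 i

end MBCut

/-! ### Enumerating the advice words -/

namespace RamProg

/-- Reset the working memory and execute the advice word. -/
def prepare : RamProg := clear ;; start ;; runWord

def tryWord : RamProg := prepare ;; output

/-- Pass to the next advice word. -/
def increment : RamProg :=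
  set rI (lit 0) ;;
    loop (.eq (get aAdv (reg rI)) (succ (reg rPairs)))
      (store aAdv (reg rI) (lit 0) ;; set rI (succ (reg rI))) ;;
    store aAdv (reg rI) (succ (get aAdv (reg rI)))

/-- Try all advice words. -/
def enumerate : RamProg := loop (.eq (get aAdv (reg rLen)) (lit 0)) (tryWord ;; increment)

theorem guarded_tryWord : Guarded tryWord := by
  unfold tryWord prepare clear clearRow clearRow clearRow clearRow clearRow clearRow clearRow
    clearRow clearRow clearRow clearRow clearRegs clearRegs clearRegs clearRegs clearRegs clearRegs
    clearRegs clearRegs clearRegs clearRegs clearRegs clearRegs clearRegs clearRegs clearRegs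
    clearRegs clearRegs clearRegs clearRegs start runWord step toggle refineUnd reflow augment
    relabel attempt clearSet flagsResidual flagsUncovered search initVisited scanList findX trace
    output markCut checkBudgets emitCut
  repeat' first
    | exact Guarded.gst | exact Guarded.skip | exact Guarded.emit
    | refine Guarded.set (by norm_num) | refine Guarded.forLoop (by norm_num) ?_
    | refine Guarded.seq ?_ ?_ | refine Guarded.ite ?_ ?_ | refine Guarded.loop ?_

theorem wr_tryWord {r : ℕ} (h : ¬ (9 ≤ r ∧ r < 27)) : tryWord.wr r = false := by
  rw [not_and_or] at h
  simp [tryWord, prepare, clear, clearRow, clearRegs, start, runWord, step, toggle, refineUnd, reflow,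
    augment, relabel, attempt, clearSet, flagsResidual, flagsUncovered, search, initVisited,
    scanList, findX, trace, output, markCut, checkBudgets, emitCut, forLoop, gst, wr]
  omega

theorem wa_tryWord {a : ℕ} (h : ¬ (10 ≤ a ∧ a < 20)) : tryWord.wa a = false := by
  rw [not_and_or] at h
  simp [tryWord, prepare, clear, clearRow, clearRegs, start, runWord, step, toggle, refineUnd, reflow,
    augment, relabel, attempt, clearSet, flagsResidual, flagsUncovered, search, initVisited,
    scanList, findX, trace, output, markCut, checkBudgets, emitCut, forLoop, gst, wa]
  omega

end RamProg

namespace MBCut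

variable {I : MBCut} {Z : Finset (Fin I.m)} {s s' b : RamState}

/-- Its writes concern only working registers and entries of working arrays below the bound, exactly
those on which `Like` imposes nothing. -/
theorem Like.after_tryWord {t : ℕ} (h : Like b s) (hr : tryWord.Runs s t s') : Like b s' := by
  have hF := hr.frame
  obtain ⟨-, hg⟩ := guarded_tryWord.arr_eq hr
  refine ⟨fun r h' => (hF.reg r (wr_tryWord h')).trans (h.reg r h'), fun a i ha h' => ?_⟩
  refine Eq.trans ?_ (h.arr a i ha h')
  by_cases h1 : 10 ≤ a ∧ a < 20
  · refine hg a i ?_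
    have : s.reg 8 = b.reg 8 := h.reg _ (by norm_num)
    omega
  · rw [hF.arr a (wa_tryWord h1)]

theorem Like.wp_prepare (hb : I.Static Z b) (h : Like b s) :
    prepare.wp s fun t s' => t ≤ 4000 * ((I.k + 2) ^ 4 * (I.n + I.m + 1)) ∧ I.Good Z s' := by
  have hB : b.reg rBound = _ := hb.bound
  refine wp_seq (wp_mono h.wp_clear ?_)
  rintro t₁ s₁ - ⟨ht₁, rfl⟩
  have hst : I.Static Z ((canon b).plug aAdv (s.arr aAdv) s.out) :=
    (canon_static hb).congr (fun _ _ => rfl) fun a ha => by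
      simp [RamState.plug, Function.update_of_ne (show a ≠ aAdv by omega)]
  refine wp_seq (wp_mono (wp_start hst ?_) ?_)
  · intro a i ha ha' hi
    have hi : i < b.reg rBound := hi
    simp [RamState.plug, Function.update_of_ne (show a ≠ aAdv by omega), canon, ha, ha', hi]
  · rintro t₂ s₂ hF ⟨ht₂, hg, -⟩
    refine wp_mono (hg.wp_runWord ?_) ?_
    · rw [hF.reg rPos rfl]; rfl
    · rintro t₃ s₃ - ⟨ht₃, hg₃⟩
      refine ⟨?_, hg₃⟩
      have hl := numColors_le_k (I := I)
      generalize hN : I.n + I.m + 1 = N at *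
      have hN1 : 1 ≤ N := by omega
      have e1 : b.reg rBound + 2 ≤ 3 * ((I.k + 2) ^ 4 * N) := by
        have h1 : I.k * I.numColors ≤ I.k * I.k := Nat.mul_le_mul_left _ hl
        have h2 : I.k * I.k + 3 ≤ (I.k + 2) ^ 4 := by nlinarith [sq_nonneg I.k]
        have h3 : (I.k * I.k + 3) * 1 ≤ (I.k + 2) ^ 4 * N := Nat.mul_le_mul h2 hN1
        have h4 : 1 * N ≤ (I.k + 2) ^ 4 * N := Nat.mul_le_mul_right _ (Nat.one_le_pow _ _ (by omega))
        omega
      have e2 : (I.k + 2) ^ 2 * N ≤ (I.k + 2) ^ 4 * N :=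
        Nat.mul_le_mul_right _ (Nat.pow_le_pow_right (by omega) (by norm_num))
      have e3 : 3 * (I.k + 1) ^ 2 * (900 * ((I.k + 2) ^ 2 * N) + 10) + 3 ≤
          2740 * ((I.k + 2) ^ 4 * N) := by
        have h1 : 900 * ((I.k + 2) ^ 2 * N) + 10 ≤ 910 * ((I.k + 2) ^ 2 * N) := by
          have := Nat.mul_pos (Nat.pow_pos (n := 2) (show 0 < I.k + 2 by omega)) hN1
          omega
        have h2 : (I.k + 1) ^ 2 ≤ (I.k + 2) ^ 2 := Nat.pow_le_pow_left (by omega) _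
        have h3 : 1 ≤ (I.k + 2) ^ 4 * N := Nat.mul_pos (by positivity) hN1
        calc _ ≤ 3 * (I.k + 2) ^ 2 * (910 * ((I.k + 2) ^ 2 * N)) + 3 := by gcongr
          _ = 2730 * ((I.k + 2) ^ 4 * N) + 3 := by ring
          _ ≤ _ := by omega
      omega

/-- Executing the advice word leads to the cut `C`. -/
def Wins (I : MBCut) (b : RamState) (w : ℕ → ℕ) (C : Finset (Fin I.m)) : Prop :=
  ∀ s, Like b s → (∀ i < 3 * (I.k + 1) ^ 2, s.arr aAdv i = w i) →
    prepare.wp s fun _ s' => Disjoint I.X (I.visited s') ∧ I.Done C s'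

theorem visited_plug (s : RamState) (x : ℕ → ℕ) (o : List ℕ) :
    I.visited (s.plug aAdv x o) = I.visited s := by
  simp [visited, RamState.plug]

/-- The word is constructed for the run from `canon b`. Clearing turns every admissible start into
this state with other advice and output, and both parts of the run are transported by plugging these
in. -/
theorem exists_wins (hZ : Z ⊆ I.colored) (hb : I.Static Z b) {C : Finset (Fin I.m)}
    (hC : I.Important Z C) :
    ∃ w : ℕ → ℕ, (∀ i, w i < I.k * I.numColors + 2) ∧ I.Wins b w C := by
  obtain ⟨t₁, s₁, hr₁, -, hg, hund, hset, hfin⟩ := wp_start (canon_static hb)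
    fun a i ha ha' hi => by
      have hi : i < b.reg rBound := hi
      simp [canon, ha, ha', hi]
  have hdis : Disjoint C (I.und s₁) := by
    rw [hund]
    exact Finset.disjoint_left.2 fun e he h => Finset.mem_compl.1 h (hC.1.2.1 he)
  have hval := hg.flow.val_le_card hC.1.1.1 hdis
  have hcard := card_le_of_subset_colored hC.1.2.2
  have hready : I.Ready Z C s₁ := ⟨hg, hdis, hfin.resolve_right fun h => by omega⟩
  have hpos : s₁.reg rPos = 0 := by rw [hr₁.frame.reg rPos rfl]; rfl
  -- The set of pairs is empty at the start, so the potential is at most `k * (3 * k + 3) + k + 2 *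
  -- k + 2`, one less than the word length.
  have hpot : I.potential C s₁ ≤ 3 * (I.k + 1) ^ 2 := by
    have hT : (I.target C s₁).card ≤ I.k := pairs_card hC.1.2.2 _ _
    rw [potential, hset, ← Finset.bot_eq_empty, bot_symmDiff]
    have h1 : (I.k - (I.val (I.arcs aFlow s₁)).toNat) * (3 * I.k + 3) ≤ I.k * (3 * I.k + 3) :=
      Nat.mul_le_mul_right _ (Nat.sub_le _ _)
    have h2 : 3 * (I.k + 1) ^ 2 = I.k * (3 * I.k + 3) + 3 * I.k + 3 := by ring
    omega
  obtain ⟨w, hw, s₂, hrun, hr₂, hd, -⟩ := Ready.cover hZ hC (3 * (I.k + 1) ^ 2) s₁ hready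
    (by rw [hpos, hg.static.len, zero_add]) (.inr hpot)
  refine ⟨w, hw, fun s hs hadv => ?_⟩
  refine wp_seq (wp_mono hs.wp_clear ?_)
  rintro t s' - ⟨-, rfl⟩
  obtain ⟨t₂, hrun⟩ := hrun (s.arr aAdv) s.out fun i _ hi =>
    hadv i (by rwa [hg.static.len] at hi)
  refine wp_seq ⟨_, _, hr₁.plug (a := aAdv) rfl _ _, _, _, hrun, ?_, ?_⟩
  · rw [visited_plug]; exact hr₂.free
  · rw [Done, visited_plug]; exact hd

theorem Like.wp_tryWord (hZ : Z ⊆ I.colored) (hb : I.Static Z b) (h : Like b s) :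
    tryWord.wp s fun t s' => t ≤ 4130 * ((I.k + 2) ^ 4 * (I.n + I.m + 1)) ∧ Like b s' ∧
      ∃ F : List (List (Fin I.m)), F.length ≤ 1 ∧ s'.out = s.out ++ I.encodeFamily F ∧
        (∀ D ∈ F, D.Nodup ∧ I.Admissible Z D.toFinset) ∧
        ∀ C, I.Admissible Z C →
          (prepare.wp s fun _ s₁ => Disjoint I.X (I.visited s₁) ∧ I.Done C s₁) →
          ∃ D ∈ F, D.toFinset = C := by
  obtain ⟨t₁, s₁, hr₁, ht₁, hg⟩ := h.wp_prepare hb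
  obtain ⟨t₂, s₂, hr₂, ht₂, F, hlen, hout, hadm, hC⟩ := hg.wp_output hZ
  have hr : tryWord.Runs s (t₁ + t₂) s₂ := hr₁.seq hr₂
  refine ⟨_, s₂, hr, ?_, h.after_tryWord hr, F, hlen, ?_, hadm, fun C hCa hw => ?_⟩
  · have : (I.k + 1) * (I.m + 1) ≤ (I.k + 2) ^ 4 * (I.n + I.m + 1) := by
      refine Nat.mul_le_mul ?_ (by omega)
      calc I.k + 1 ≤ (I.k + 2) ^ 1 := by rw [pow_one]; omega
        _ ≤ _ := Nat.pow_le_pow_right (by omega) (by norm_num)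
    omega
  · rw [hout, hr₁.frame.out rfl]
  · obtain ⟨t₃, s₃, hr₃, hX, hd⟩ := hw
    -- The run that finds the cut is, by determinism, the run whose final state has just been
    -- output.
    obtain ⟨-, rfl⟩ := hr₁.det hr₃
    exact hC C hCa hX hd

/-- The advice array is the number `V` in base `K`, lowest digit first. After `j` carries the power
`K ^ j` divides `V + 1`, and as `V < K ^ L`, at most `L` carries occur. -/
theorem wp_increment {K L V : ℕ} (hK : s.reg rPairs + 2 = K) (hV : V < K ^ L)
    (hs : ∀ i, s.arr aAdv i = V / K ^ i % K) :
    increment.wp s fun t s' => t ≤ 15 * (L + 1) ∧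
      ∀ i, s'.arr aAdv i = (V + 1) / K ^ i % K := by
  have hK1 : 1 < K := by omega
  have hpow : ∀ i, K ^ i ∣ V + 1 → i ≤ L := fun i hi => by
    by_contra hlt
    have h1 := Nat.le_of_dvd (by omega) hi
    have h2 := Nat.pow_lt_pow_right hK1 (show L < i by omega)
    omega
  -- A further carry is needed exactly if the next digit is the maximal one, `K - 1`.
  have hdvd : ∀ j, K ^ j ∣ V + 1 → (K ^ (j + 1) ∣ V + 1 ↔ V / K ^ j % K + 1 = K) := by
    intro j hj
    have h1 : (V + 1) / K ^ j = V / K ^ j + 1 := by rw [Nat.succ_div, if_pos hj]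
    rw [pow_succ, ← Nat.dvd_div_iff_mul_dvd hj, h1, Nat.dvd_iff_mod_eq_zero, Nat.add_mod]
    have h2 := Nat.mod_lt (V / K ^ j) (show 0 < K by omega)
    rw [Nat.mod_eq_of_lt hK1]
    constructor
    · intro h
      by_contra hne
      rw [Nat.mod_eq_of_lt (by omega)] at h
      omega
    · intro h
      rw [h, Nat.mod_self]
  refine wp_seq (wp_set (wp_seq (wp_mono (wp_loop (fun φ s' => ∃ j, s'.reg rI = j ∧
    s'.reg rPairs + 2 = K ∧ K ^ j ∣ V + 1 ∧ φ + 15 * j = 15 * L ∧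
    ∀ i, s'.arr aAdv i = if i < j then 0 else V / K ^ i % K) (15 * L) ?_ ?_) ?_)))
  · refine ⟨0, by simp [eval], by simpa using hK, by simp, by simp, fun i => ?_⟩
    rw [if_neg (by omega)]
    exact hs i
  · rintro φ s₁ - ⟨j, hj, hp, hd, hφ, ha⟩ hc
    simp only [RamTest.Holds, eval, hj, ha, lt_irrefl, if_false] at hc
    have hd' := (hdvd j hd).2 (by omega)
    have := hpow _ hd'
    refine wp_seq (wp_store (wp_set ⟨φ - 15, ⟨j + 1, by simp [eval, hj], by simpa using hp, hd',
      by omega, fun i => ?_⟩, ?_⟩))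
    · simp only [eval, hj, RamState.setReg_arr, RamState.write_arr, if_true]
      by_cases hij : i = j
      · subst hij
        rw [Function.update_self, if_pos (Nat.lt_succ_self _)]
      · rw [Function.update_of_ne hij, ha]
        exact if_congr (by omega) rfl rfl
    · simp only [RamTest.cost, cost]
      omega
  · rintro t s₁ - ⟨ht, hc, φ, j, hj, hp, hd, hφ, ha⟩
    simp only [RamTest.Holds, eval, hj, ha, lt_irrefl, if_false] at hc
    have hd' : ¬ K ^ (j + 1) ∣ V + 1 := fun h => hc (by have := (hdvd j hd).1 h; omega)
    refine wp_store ⟨by simp only [RamTest.cost, cost] at ht ⊢; omega, fun i => ?_⟩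
    simp only [eval, hj, RamState.write_arr, if_true]
    rcases lt_trichotomy i j with hij | hij | hij
    · rw [Function.update_of_ne hij.ne, ha, if_pos hij]
      have h1 : K ^ (i + 1) ∣ V + 1 := (pow_dvd_pow K hij).trans hd
      symm
      rw [← Nat.dvd_iff_mod_eq_zero, Nat.dvd_div_iff_mul_dvd ((pow_dvd_pow K hij.le).trans hd),
        ← pow_succ]
      exact h1
    · subst hij
      rw [Function.update_self, ha, if_neg (lt_irrefl _), Nat.succ_div, if_pos hd]
      have h1 := (hdvd i hd).not.1 hd'
      have h2 := Nat.mod_lt (V / K ^ i) (show 0 < K by omega)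
      rw [Nat.add_mod, Nat.mod_eq_of_lt hK1,
        Nat.mod_eq_of_lt (show V / K ^ i % K + 1 < K by omega)]
    · rw [Function.update_of_ne hij.ne', ha, if_neg (by omega), Nat.succ_div, if_neg, Nat.add_zero]
      exact fun h => hd' ((pow_dvd_pow K hij).trans h)

theorem exists_digits {K : ℕ} (L : ℕ) (w : ℕ → ℕ) (hw : ∀ i, w i < K) :
    ∃ V < K ^ L, ∀ i < L, V / K ^ i % K = w i := by
  induction L generalizing w with
  | zero => exact ⟨0, by simp, fun i hi => absurd hi (Nat.not_lt_zero _)⟩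
  | succ L ih =>
    obtain ⟨V, hV, hd⟩ := ih (fun i => w (i + 1)) fun i => hw _
    have h0 := hw 0
    refine ⟨w 0 + K * V, ?_, fun i hi => ?_⟩
    · calc w 0 + K * V < K * (V + 1) := by rw [Nat.mul_add]; omega
        _ ≤ K * K ^ L := Nat.mul_le_mul_left _ hV
        _ = K ^ (L + 1) := by ring
    · cases i with
      | zero => rw [pow_zero, Nat.div_one, Nat.add_mul_mod_self_left, Nat.mod_eq_of_lt h0]
      | succ i =>
        rw [pow_succ', ← Nat.div_div_eq_div_mul, Nat.add_mul_div_left _ _ (by omega),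
          Nat.div_eq_of_lt h0, zero_add]
        exact hd i (by omega)

theorem encodeFamily_append (F G : List (List (Fin I.m))) :
    I.encodeFamily (F ++ G) = I.encodeFamily F ++ I.encodeFamily G := by
  simp [encodeFamily]

/-- The invariant says that the words with numbers below `V` have been tried, each having
contributed at most one cut. The digit at position `L`, just behind the word, serves as overflow
flag: it is nonzero precisely when `V` reaches `K ^ L`. -/
theorem wp_enumerate (hZ : Z ⊆ I.colored) (hb : I.Static Z b) (hadv : b.arr aAdv = fun _ => 0)
    (hout : b.out = []) :
    enumerate.wp b fun t s' =>
      t ≤ (I.k * I.numColors + 2) ^ (3 * (I.k + 1) ^ 2) *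
        (5000 * ((I.k + 2) ^ 4 * (I.n + I.m + 1))) + 4 ∧
      ∃ F : List (List (Fin I.m)), F.length ≤ (I.k * I.numColors + 2) ^ (3 * (I.k + 1) ^ 2) ∧
        s'.out = I.encodeFamily F ∧ (∀ D ∈ F, D.Nodup ∧ I.Admissible Z D.toFinset) ∧
        ∀ C, I.Important Z C → ∃ D ∈ F, D.toFinset = C := by
  set L := 3 * (I.k + 1) ^ 2 with hL
  set K := I.k * I.numColors + 2 with hK
  set R := 5000 * ((I.k + 2) ^ 4 * (I.n + I.m + 1)) with hR
  have hK1 : 1 < K := by omega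
  refine wp_mono (wp_loop (fun φ s' => ∃ V ≤ K ^ L, Like b s' ∧
    (∀ i, s'.arr aAdv i = V / K ^ i % K) ∧ φ = (K ^ L - V) * R ∧
    ∃ F : List (List (Fin I.m)), F.length ≤ V ∧ s'.out = I.encodeFamily F ∧
      (∀ D ∈ F, D.Nodup ∧ I.Admissible Z D.toFinset) ∧
      ∀ V' < V, ∀ C, I.Admissible Z C → I.Wins b (fun i => V' / K ^ i % K) C →
        ∃ D ∈ F, D.toFinset = C) (K ^ L * R) ?_ ?_) ?_
  · exact ⟨0, Nat.zero_le _, ⟨fun _ _ => rfl, fun _ _ _ _ => rfl⟩, fun i => by simp [hadv],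
      by simp, [], by simp, by simp [hout, encodeFamily], by simp,
      fun V' hV' => absurd hV' (Nat.not_lt_zero _)⟩
  · rintro φ s₁ - ⟨V, hV, hlike, hdig, rfl, F, hlen, hout, hadm, hcov⟩ hc
    have hst := hlike.static hb
    simp only [RamTest.Holds, eval, hst.len, hdig] at hc
    -- At `V = K ^ L` the digit at position `L` would be `1` and the loop would have stopped.
    have hlt : V < K ^ L := by
      refine lt_of_le_of_ne hV ?_
      rintro rfl
      rw [← hL, Nat.div_self (by positivity), Nat.mod_eq_of_lt hK1] at hc
      exact one_ne_zero hc
    refine wp_seq (wp_mono (hlike.wp_tryWord hZ hb) ?_)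
    rintro t₂ s₂ hF₂ ⟨ht₂, hlike₂, G, hGlen, hGout, hGadm, hGcov⟩
    have hst₂ := hlike₂.static hb
    have hadv₂ : s₂.arr aAdv = s₁.arr aAdv := hF₂.arr aAdv (wa_tryWord (by norm_num))
    refine wp_mono (wp_increment (K := K) (L := L) (V := V) (by rw [hst₂.pairs]) hlt
      (by rw [hadv₂]; exact hdig)) ?_
    rintro t₃ s₃ hF₃ ⟨ht₃, hdig₃⟩
    have hlike₃ : Like b s₃ := by
      refine ⟨fun r hr => ?_, fun a i ha h' => ?_⟩
      · rw [hF₃.reg r (by simp [increment, wr]; omega)]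
        exact hlike₂.reg r hr
      · rw [hF₃.arr a (by simp [increment, wa]; omega)]
        exact hlike₂.arr a i ha h'
    refine ⟨_, ⟨V + 1, hlt, hlike₃, hdig₃, rfl, F ++ G, ?_, ?_, ?_, ?_⟩, ?_⟩
    · rw [List.length_append]; omega
    · rw [hF₃.out rfl, hGout, hout, encodeFamily_append]
    · intro D hD
      exact (List.mem_append.1 hD).elim (hadm D) (hGadm D)
    · intro V' hV' C hC hw
      rcases Nat.lt_succ_iff_lt_or_eq.1 hV' with h' | rfl
      · obtain ⟨D, hD, e⟩ := hcov V' h' C hC hw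
        exact ⟨D, List.mem_append_left _ hD, e⟩
      · obtain ⟨D, hD, e⟩ := hGcov C hC (hw s₁ hlike fun i _ => hdig i)
        exact ⟨D, List.mem_append_right _ hD, e⟩
    · obtain ⟨d, hd⟩ : ∃ d, K ^ L = V + 1 + d := ⟨_, (Nat.add_sub_cancel' hlt).symm⟩
      rw [hd, show V + 1 + d - (V + 1) = d by omega, show V + 1 + d - V = d + 1 by omega,
        Nat.add_mul]
      have h1 : L ≤ 3 * ((I.k + 2) ^ 4 * (I.n + I.m + 1)) := by
        rw [hL]
        refine Nat.mul_le_mul_left _ ?_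
        calc (I.k + 1) ^ 2 ≤ (I.k + 2) ^ 2 := Nat.pow_le_pow_left (by omega) _
          _ ≤ (I.k + 2) ^ 4 := Nat.pow_le_pow_right (by omega) (by norm_num)
          _ ≤ _ := Nat.le_mul_of_pos_right _ (by omega)
      have h2 : 1 ≤ (I.k + 2) ^ 4 * (I.n + I.m + 1) := Nat.mul_pos (by positivity) (by omega)
      simp only [RamTest.cost, cost]
      omega
  · rintro t s₁ - ⟨ht, hc, φ, V, hV, hlike, hdig, -, F, hlen, hout, hadm, hcov⟩
    have hst := hlike.static hb
    simp only [RamTest.Holds, eval, hst.len, hdig, ← hL] at hc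
    -- Conversely, that digit is `0` as long as `V < K ^ L`, so all words have been tried when the
    -- loop ends.
    have hVe : V = K ^ L := by
      refine le_antisymm hV (not_lt.1 fun hlt => hc ?_)
      rw [Nat.div_eq_of_lt hlt, Nat.zero_mod]
    refine ⟨by simpa [RamTest.cost, cost] using ht, F, hlen.trans hV, hout, hadm, fun C hC => ?_⟩
    obtain ⟨w, hw, hwin⟩ := exists_wins hZ hb hC
    obtain ⟨V', hV', hd⟩ := exists_digits L w hw
    exact hcov V' (hVe ▸ hV') C hC.1 fun s hs ha => hwin s hs fun i hi => (ha i hi).trans (hd i hi)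

end MBCut

/-! ### Reading the input and preparing the data structures -/

namespace MBCut

variable {I : MBCut} {Z : Finset (Fin I.m)} {s s' : RamState}

theorem length_flatten_ofFn {N b : ℕ} (f : Fin N → List ℕ) (hf : ∀ i, (f i).length = b) :
    (List.ofFn f).flatten.length = N * b := by
  rw [List.length_flatten, List.map_ofFn, show List.length ∘ f = fun _ => b from funext hf]
  simp

theorem getD_skip {l r : List ℕ} {i j : ℕ} (h : i = l.length + j) :
    (l ++ r).getD i 0 = r.getD j 0 := by
  subst h
  rw [List.getD_append_right _ _ _ _ (Nat.le_add_right _ _), Nat.add_sub_cancel_left]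

theorem getD_flatten_ofFn {N b : ℕ} (f : Fin N → List ℕ) (hf : ∀ i, (f i).length = b) (i : Fin N)
    {j : ℕ} (hj : j < b) : (List.ofFn f).flatten.getD (i * b + j) 0 = (f i).getD j 0 := by
  induction N with
  | zero => exact i.elim0
  | succ N ih =>
    rw [List.ofFn_succ, List.flatten_cons]
    induction i using Fin.cases with
    | zero => rw [List.getD_append _ _ _ _ (by rw [hf]; simpa using hj)]; simp
    | succ i =>
      rw [getD_skip (j := i * b + j) (by rw [hf, Fin.val_succ]; ring)]
      exact ih (fun i => f i.succ) (fun i => hf _) i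

theorem getD_ofFn {N : ℕ} (f : Fin N → ℕ) (i : Fin N) : (List.ofFn f).getD i 0 = f i := by
  rw [List.getD_eq_getElem _ _ (by simp)]
  simp

/-- The array `a` starts with the input word. -/
structure Input (I : MBCut) (Z : Finset (Fin I.m)) (a : ℕ → ℕ) : Prop where
  n : a 0 = I.n
  m : a 1 = I.m
  l : a 2 = I.numColors
  src : ∀ e : Fin I.m, a (3 + 2 * e) = I.src e
  tgt : ∀ e : Fin I.m, a (3 + 2 * e + 1) = I.tgt e
  x : ∀ v : Fin I.n, a (3 + 2 * I.m + v) = if v ∈ I.X then 1 else 0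
  y : ∀ v : Fin I.n, a (3 + 2 * I.m + I.n + v) = if v ∈ I.Y then 1 else 0
  budget : ∀ i : Fin I.numColors, a (3 + 2 * I.m + 2 * I.n + i * (I.m + 1)) = I.budget i
  color : ∀ (i : Fin I.numColors) (e : Fin I.m),
    a (3 + 2 * I.m + 2 * I.n + i * (I.m + 1) + 1 + e) = if e ∈ I.color i then 1 else 0
  z : ∀ e : Fin I.m, a (3 + 2 * I.m + 2 * I.n + I.numColors * (I.m + 1) + e) =
    if e ∈ Z then 1 else 0

theorem input_encode (I : MBCut) (Z : Finset (Fin I.m)) :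
    Input I Z fun i => (I.encode Z).getD i 0 := by
  have l1 : (List.ofFn fun e : Fin I.m => [(I.src e : ℕ), (I.tgt e : ℕ)]).flatten.length =
      I.m * 2 := length_flatten_ofFn _ fun _ => rfl
  have hlen : ∀ i : Fin I.numColors, (I.budget i ::
      List.ofFn fun e : Fin I.m => if e ∈ I.color i then 1 else 0).length = I.m + 1 := by simp
  have l2 := length_flatten_ofFn _ hlen
  have harc := getD_flatten_ofFn (fun e : Fin I.m => [(I.src e : ℕ), (I.tgt e : ℕ)]) (b := 2)
    fun _ => rfl
  have hcol := getD_flatten_ofFn _ hlen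
  have hb := fun (i : Fin I.numColors) (j : ℕ) (hj : j < I.m + 1) =>
    Nat.add_lt_of_lt_sub (show i * (I.m + 1) + j < I.numColors * (I.m + 1) - 0 by
      calc i * (I.m + 1) + j < (i + 1) * (I.m + 1) := by rw [Nat.add_mul]; omega
        _ ≤ I.numColors * (I.m + 1) := Nat.mul_le_mul_right _ i.2)
  constructor
  all_goals simp only [encode, List.append_assoc, List.cons_append, List.nil_append]
  · rfl
  · rfl
  · rfl
  · intro e
    have := e.2
    rw [show 3 + 2 * (e : ℕ) = (e * 2 + 0) + 1 + 1 + 1 by ring]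
    simp only [List.getD_cons_succ]
    rw [List.getD_append _ _ _ _ (by omega)]
    exact harc e (j := 0) (by norm_num)
  · intro e
    have := e.2
    rw [show 3 + 2 * (e : ℕ) + 1 = (e * 2 + 1) + 1 + 1 + 1 by ring]
    simp only [List.getD_cons_succ]
    rw [List.getD_append _ _ _ _ (by omega), harc e (by norm_num)]
    rfl
  · intro v
    rw [show 3 + 2 * I.m + (v : ℕ) = (I.m * 2 + v) + 1 + 1 + 1 by ring]
    simp only [List.getD_cons_succ]
    rw [getD_skip (by rw [l1]), List.getD_append _ _ _ _ (by simp), getD_ofFn]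
  · intro v
    rw [show 3 + 2 * I.m + I.n + (v : ℕ) = (I.m * 2 + (I.n + v)) + 1 + 1 + 1 by ring]
    simp only [List.getD_cons_succ]
    rw [getD_skip (by rw [l1]), getD_skip (by rw [List.length_ofFn]),
      List.getD_append _ _ _ _ (by simp), getD_ofFn]
  · intro i
    rw [show 3 + 2 * I.m + 2 * I.n + i * (I.m + 1) =
      (I.m * 2 + (I.n + (I.n + (i * (I.m + 1) + 0)))) + 1 + 1 + 1 by ring]
    simp only [List.getD_cons_succ]
    rw [getD_skip (by rw [l1]), getD_skip (by rw [List.length_ofFn]),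
      getD_skip (by rw [List.length_ofFn]),
      List.getD_append _ _ _ _ (by rw [l2]; simp), hcol i (by omega)]
    rfl
  · intro i e
    rw [show 3 + 2 * I.m + 2 * I.n + i * (I.m + 1) + 1 + e =
      (I.m * 2 + (I.n + (I.n + (i * (I.m + 1) + (e + 1))))) + 1 + 1 + 1 by ring]
    simp only [List.getD_cons_succ]
    rw [getD_skip (by rw [l1]), getD_skip (by rw [List.length_ofFn]),
      getD_skip (by rw [List.length_ofFn]),
      List.getD_append _ _ _ _ (by rw [l2]; simpa using hb i (e + 1) (by omega)),
      hcol i (by omega), List.getD_cons_succ, getD_ofFn]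
  · intro e
    rw [show 3 + 2 * I.m + 2 * I.n + I.numColors * (I.m + 1) + e =
      (I.m * 2 + (I.n + (I.n + (I.numColors * (I.m + 1) + e)))) + 1 + 1 + 1 by ring]
    simp only [List.getD_cons_succ]
    rw [getD_skip (by rw [l1]), getD_skip (by rw [List.length_ofFn]),
      getD_skip (by rw [List.length_ofFn]), getD_skip (by rw [l2]), getD_ofFn]

end MBCut

namespace RamProg

/-- Read a block of the input into the array `a`. -/
def copyIn (a : ℕ) (N : RamExpr) : RamProg :=
  forLoop rI N (store a (reg rI) (get aIn (reg rQ)) ;; set rQ (succ (reg rQ)))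

/-- Add `N` to the register `r`. -/
def addTo (r i : ℕ) (N : RamExpr) : RamProg := forLoop i N (set r (succ (reg r)))

def readSizes : RamProg :=
  set rN (get aIn (lit 0)) ;; set rM (get aIn (lit 1)) ;; set rL (get aIn (lit 2)) ;;
    set rQ (lit 3) ;; set rHalf (lit 0)

def readArcs : RamProg :=
  forLoop rI (reg rM)
    (store aSrc (reg rI) (get aIn (reg rQ)) ;; set rQ (succ (reg rQ)) ;;
      store aTgt (reg rI) (get aIn (reg rQ)) ;; set rQ (succ (reg rQ)) ;;
      set rHalf (succ (succ (reg rHalf))))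

def mirrorArcs : RamProg :=
  set rMe (reg rM) ;;
    forLoop rI (reg rM)
      (store aSrc (reg rMe) (get aTgt (reg rI)) ;; store aTgt (reg rMe) (get aSrc (reg rI)) ;;
        store aArc (reg rMe) (reg rI) ;; set rMe (succ (reg rMe)))

/-- Compute the total budget. -/
def sumBudgets : RamProg :=
  set rCol (reg rQ) ;; set rK (lit 0) ;;
    forLoop rI (reg rL)
      (addTo rK rJ (get aIn (reg rQ)) ;; addTo rQ rE (succ (reg rM)))

def computeSizes : RamProg :=
  set rPairs (lit 0) ;; forLoop rI (reg rK) (addTo rPairs rJ (reg rL)) ;;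
    set rLen (lit 0) ;;
    forLoop rI (succ (reg rK))
      (addTo rLen rJ (succ (reg rK)) ;; addTo rLen rJ (succ (reg rK)) ;;
        addTo rLen rJ (succ (reg rK))) ;;
    set rBound (succ (reg rHalf)) ;; addTo rBound rI (reg rN) ;; addTo rBound rI (reg rPairs)

/-- Build the lists of half arcs with a given head. -/
def buildLists : RamProg :=
  forLoop rI (reg rHalf)
    (store aNext (reg rI) (get aHead (get aTgt (reg rI))) ;;
      store aHead (get aTgt (reg rI)) (succ (reg rI)))

def parse : RamProg :=
  readSizes ;; readArcs ;; mirrorArcs ;; copyIn aX (reg rN) ;; copyIn aY (reg rN) ;;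
    sumBudgets ;; copyIn aZ (reg rM) ;; computeSizes ;; buildLists

variable {s s' : RamState}

theorem wp_copyIn {a n q : ℕ} {N : RamExpr} (ha : a ≠ aIn)
    (hN : ∀ s', Frame (copyIn a N) s s' → N.eval s' = n) (hq : s.reg rQ = q) :
    (copyIn a N).wp s fun t s' => t ≤ (n + 1) * (N.cost + 13) ∧ s'.reg rQ = q + n ∧
      ∀ i < n, s'.arr a i = s.arr aIn (q + i) := by
  refine wp_mono (wp_for n 8 (fun j s' => s'.reg rQ = q + j ∧
    ∀ i < j, s'.arr a i = s.arr aIn (q + i)) rfl hN ?_ ?_ ?_) ?_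
  · intro j s' v h
    simpa using h
  · exact ⟨hq, fun i hi => absurd hi (Nat.not_lt_zero _)⟩
  · rintro j s₁ hj hF hj₁ ⟨hq₁, ha₁⟩
    have hin : s₁.arr aIn = s.arr aIn := hF.arr aIn (by simpa [forLoop, wa] using ha)
    refine wp_seq (wp_store (wp_set ⟨by simp [cost], by simp [eval, hq₁]; omega, fun i hi => ?_⟩))
    simp only [eval, hj₁, hq₁, hin, RamState.setReg_arr, RamState.write_arr, if_true]
    by_cases h : i = j
    · subst h; rw [Function.update_self]
    · rw [Function.update_of_ne h]; exact ha₁ i (by omega)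
  · rintro t s' - ⟨ht, h⟩
    exact ⟨ht.trans (Nat.mul_le_mul_left _ (by omega)), h⟩

theorem wp_addTo {r i n : ℕ} {N : RamExpr} (hri : r ≠ i)
    (hN : ∀ s', Frame (addTo r i N) s s' → N.eval s' = n) :
    (addTo r i N).wp s fun t s' => t ≤ (n + 1) * (N.cost + 8) ∧ s'.reg r = s.reg r + n := by
  refine wp_mono (wp_for n 3 (fun j s' => s'.reg r = s.reg r + j) (by simpa [wr] using hri) hN
    ?_ rfl ?_) ?_
  · intro j s' v h
    simpa [hri] using h
  · rintro j s₁ hj - - h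
    exact wp_set ⟨by simp [cost], by simp [eval, h]; omega⟩
  · rintro t s' - ⟨ht, h⟩
    exact ⟨ht.trans (Nat.mul_le_mul_left _ (by omega)), h⟩

theorem wp_readArcs {m : ℕ} (hm : s.reg rM = m) (hq : s.reg rQ = 3) (hh : s.reg rHalf = 0) :
    readArcs.wp s fun t s' => t ≤ (m + 1) * 30 ∧ s'.reg rQ = 3 + 2 * m ∧ s'.reg rHalf = 2 * m ∧
      (∀ e < m, s'.arr aSrc e = s.arr aIn (3 + 2 * e)) ∧
      ∀ e < m, s'.arr aTgt e = s.arr aIn (3 + 2 * e + 1) := by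
  refine wp_mono (wp_for m 22 (fun j s' => s'.reg rQ = 3 + 2 * j ∧ s'.reg rHalf = 2 * j ∧
      (∀ e < j, s'.arr aSrc e = s.arr aIn (3 + 2 * e)) ∧
      ∀ e < j, s'.arr aTgt e = s.arr aIn (3 + 2 * e + 1)) rfl ?_ ?_ ?_ ?_) ?_
  · intro s' hF
    rw [eval, hF.reg rM rfl, hm]
  · intro j s' v h
    simpa using h
  · exact ⟨hq, hh, fun i hi => absurd hi (Nat.not_lt_zero _), fun i hi => absurd hi (Nat.not_lt_zero _)⟩
  · rintro j s₁ hj hF hj₁ ⟨hq₁, hh₁, h1, h2⟩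
    have hin : s₁.arr aIn = s.arr aIn := hF.arr aIn rfl
    refine wp_seq (wp_store (wp_seq (wp_set (wp_seq (wp_store (wp_seq (wp_set (wp_set
      ⟨by simp [cost], by simp [eval, hq₁]; omega, by simp [eval, hh₁]; omega, fun i hi => ?_,
        fun i hi => ?_⟩))))))))
    · by_cases h : i = j
      · subst h; simp [eval, hj₁, hq₁, hin]
      · simpa [eval, hj₁, Function.update_of_ne h] using h1 i (by omega)
    · by_cases h : i = j
      · subst h; simp [eval, hj₁, hq₁, hin]
      · simpa [eval, hj₁, Function.update_of_ne h] using h2 i (by omega)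
  · rintro t s' - ⟨ht, h⟩
    exact ⟨ht.trans (Nat.mul_le_mul_left _ (by simp [cost])), h⟩

theorem wp_mirrorArcs {m : ℕ} (hm : s.reg rM = m) :
    mirrorArcs.wp s fun t s' => t ≤ (m + 1) * 32 ∧
      (∀ e < m, s'.arr aSrc e = s.arr aSrc e) ∧ (∀ e < m, s'.arr aTgt e = s.arr aTgt e) ∧
      (∀ e < m, s'.arr aSrc (m + e) = s.arr aTgt e) ∧
      (∀ e < m, s'.arr aTgt (m + e) = s.arr aSrc e) ∧ ∀ e < m, s'.arr aArc (m + e) = e := by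
  refine wp_seq (wp_set (wp_mono (wp_for m 22 (fun j s' => s'.reg rMe = m + j ∧
      (∀ e < m, s'.arr aSrc e = s.arr aSrc e) ∧ (∀ e < m, s'.arr aTgt e = s.arr aTgt e) ∧
      (∀ e < j, s'.arr aSrc (m + e) = s.arr aTgt e) ∧
      (∀ e < j, s'.arr aTgt (m + e) = s.arr aSrc e) ∧ ∀ e < j, s'.arr aArc (m + e) = e)
      rfl ?_ ?_ ?_ ?_) ?_))
  · intro s' hF
    rw [eval, hF.reg rM rfl]
    simpa using hm
  · intro j s' v h
    simpa using h
  · exact ⟨by simp [eval, hm], fun _ _ => rfl, fun _ _ => rfl,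
      fun i hi => absurd hi (Nat.not_lt_zero _), fun i hi => absurd hi (Nat.not_lt_zero _),
      fun i hi => absurd hi (Nat.not_lt_zero _)⟩
  · rintro j s₁ hj hF hj₁ ⟨hq₁, h1, h2, h3, h4, h5⟩
    refine wp_seq (wp_store (wp_seq (wp_store (wp_seq (wp_store (wp_set
      ⟨by simp [cost], by simp [eval, hq₁]; omega, fun i hi => ?_, fun i hi => ?_, fun i hi => ?_,
        fun i hi => ?_, fun i hi => ?_⟩))))))
    · simpa [eval, hq₁, Function.update_of_ne (show i ≠ m + j by omega)] using h1 i hi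
    · simpa [eval, hq₁, Function.update_of_ne (show i ≠ m + j by omega)] using h2 i hi
    · by_cases h : i = j
      · subst h; simpa [eval, hj₁, hq₁] using h2 i hj
      · simpa [eval, hq₁, Function.update_of_ne (show m + i ≠ m + j by omega)]
          using h3 i (by omega)
    · by_cases h : i = j
      · subst h
        simpa [eval, hj₁, hq₁, Function.update_of_ne (show i ≠ m + i by omega)] using h1 i hj
      · simpa [eval, hq₁, Function.update_of_ne (show m + i ≠ m + j by omega)]
          using h4 i (by omega)
    · by_cases h : i = j
      · subst h; simp [eval, hj₁, hq₁]
      · simpa [eval, hq₁, Function.update_of_ne (show m + i ≠ m + j by omega)]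
          using h5 i (by omega)
  · rintro t s' - ⟨ht, -, h⟩
    refine ⟨?_, h⟩
    simp only [cost] at ht ⊢
    omega

/-- Each half arc is pushed to the front of the list of its head. Links are stored increased by one,
so the initial zeros are empty lists. -/
theorem wp_buildLists {n M : ℕ} (hM : s.reg rHalf = M) (h0 : ∀ v, s.arr aHead v = 0) :
    buildLists.wp s fun t s' => t ≤ (M + 1) * 20 ∧
      ∀ v < n, Chain (s'.arr aNext) (s'.arr aHead v) (adj (s'.arr aTgt) M v) := by
  refine wp_mono (wp_for M 11 (fun j s' =>
    ∀ v, Chain (s'.arr aNext) (s'.arr aHead v) (adj (s'.arr aTgt) j v)) rfl ?_ ?_ ?_ ?_) ?_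
  · intro s' hF
    rw [eval, hF.reg rHalf rfl, hM]
  · intro j s' v h
    simpa using h
  · intro v
    rw [h0]
    rfl
  · intro j s₁ hj hF hj₁ h
    refine wp_seq (wp_store (wp_store ⟨by simp [cost], fun v => ?_⟩))
    simp only [eval, hj₁, RamState.write_arr, RamState.write_reg, if_true,
      show (aHead = aNext) = False by norm_num,
      show (aNext = aHead) = False by norm_num, show (aTgt = aHead) = False by norm_num,
      show (aTgt = aNext) = False by norm_num, if_false]
    have hmem : j ∉ adj (s₁.arr aTgt) j v := fun h' => lt_irrefl _ (mem_adj.1 h').1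
    rw [adj_succ]
    split_ifs with hv
    · subst hv
      rw [Function.update_self]
      exact ⟨rfl, by rw [Function.update_self]; exact (h _).update hmem⟩
    · rw [Function.update_of_ne (Ne.symm hv)]
      exact (h v).update hmem
  · rintro t s' - ⟨ht, h⟩
    exact ⟨ht.trans (Nat.mul_le_mul_left _ (by simp [cost])), fun v _ => h v⟩

end RamProg

namespace RamProg

variable {s s' : RamState}

/-- The machine can only count up, so a budget is added in time proportional to its value. This is
affordable because it is later applied with `B = k`. -/
theorem wp_sumBudgets {m l q B : ℕ} (hm : s.reg rM = m) (hl : s.reg rL = l) (hq : s.reg rQ = q)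
    (hB : ∀ i < l, s.arr aIn (q + i * (m + 1)) ≤ B) :
    sumBudgets.wp s fun t s' => t ≤ (l + 1) * (10 * (B + m) + 50) + 4 ∧ s'.reg rCol = q ∧
      s'.reg rQ = q + l * (m + 1) ∧
      s'.reg rK = ∑ i ∈ Finset.range l, s.arr aIn (q + i * (m + 1)) := by
  refine wp_seq (wp_set (wp_seq (wp_set (wp_mono (wp_for l ((B + 1) * 10 + (m + 2) * 10)
    (fun j s' => s'.reg rQ = q + j * (m + 1) ∧
      s'.reg rK = ∑ i ∈ Finset.range j, s.arr aIn (q + i * (m + 1))) rfl ?_ ?_ ?_ ?_) ?_))))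
  · intro s' hF
    rw [eval, hF.reg rL rfl]
    simpa using hl
  · intro j s' v h
    simpa using h
  · simp [eval, hq]
  · rintro j s₁ hj hF hj₁ ⟨hq₁, hk₁⟩
    have hin : s₁.arr aIn = s.arr aIn := hF.arr aIn rfl
    have hm₁ : s₁.reg rM = m := by rw [hF.reg rM rfl]; simpa using hm
    refine wp_seq (wp_mono (wp_addTo (n := s.arr aIn (q + j * (m + 1))) (by norm_num) ?_) ?_)
    · intro s' hF'
      simp only [eval]
      rw [hF'.arr aIn rfl, hF'.reg rQ rfl, hin, hq₁]
    · rintro t₂ s₂ hF₂ ⟨ht₂, hk₂⟩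
      refine wp_mono (wp_addTo (n := m + 1) (by norm_num) ?_) ?_
      · intro s' hF'
        simp only [eval]
        rw [hF'.reg rM rfl, hF₂.reg rM rfl, hm₁]
      · rintro t₃ s₃ hF₃ ⟨ht₃, hq₃⟩
        refine ⟨?_, ?_, ?_⟩
        · have := hB j hj
          simp only [cost] at ht₂ ht₃
          omega
        · rw [hq₃, hF₂.reg rQ rfl, hq₁]; ring
        · rw [hF₃.reg rK rfl, hk₂, hk₁, Finset.sum_range_succ]
  · rintro t s' hF ⟨ht, hq', hk'⟩
    refine ⟨?_, ?_, hq', hk'⟩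
    · simp only [cost] at ht ⊢
      have : (l + 1) * ((B + 1) * 10 + (m + 2) * 10 + 1 + 5) ≤ (l + 1) * (10 * (B + m) + 50) :=
        Nat.mul_le_mul_left _ (by omega)
      omega
    · rw [hF.reg rCol rfl]
      simpa [eval] using hq

theorem wp_computeSizes {n m k l : ℕ} (hn : s.reg rN = n) (hh : s.reg rHalf = 2 * m)
    (hk : s.reg rK = k) (hl : s.reg rL = l) (hlk : l ≤ k) :
    computeSizes.wp s fun t s' => t ≤ 120 * ((k + 2) ^ 2 * (n + m + 1)) ∧ s'.reg rPairs = k * l ∧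
      s'.reg rLen = 3 * (k + 1) ^ 2 ∧ s'.reg rBound = n + 2 * m + k * l + 1 := by
  refine wp_seq (wp_set (wp_seq (wp_mono (wp_for k ((l + 1) * 9)
    (fun j s' => s'.reg rPairs = j * l) rfl ?_ ?_ ?_ ?_) ?_)))
  · intro s' hF
    rw [eval, hF.reg rK rfl]
    simpa using hk
  · intro j s' v h
    simpa using h
  · simp [eval]
  · intro j s₁ hj hF hj₁ hp
    refine wp_mono (wp_addTo (n := l) (by norm_num) ?_) ?_
    · intro s' hF'
      rw [eval, hF'.reg rL rfl, hF.reg rL rfl]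
      simpa using hl
    · rintro t₂ s₂ - ⟨ht₂, hp₂⟩
      exact ⟨ht₂, by rw [hp₂, hp]; ring⟩
  rintro t₁ s₁ hF₁ ⟨ht₁, hp₁⟩
  have hk₁ : s₁.reg rK = k := by rw [hF₁.reg rK rfl]; simpa using hk
  have hn₁ : s₁.reg rN = n := by rw [hF₁.reg rN rfl]; simpa using hn
  have hh₁ : s₁.reg rHalf = 2 * m := by rw [hF₁.reg rHalf rfl]; simpa using hh
  refine wp_seq (wp_set (wp_seq (wp_mono (wp_for (k + 1) (30 * (k + 2))
    (fun j s' => s'.reg rLen = j * (3 * (k + 1))) rfl ?_ ?_ ?_ ?_) ?_)))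
  · intro s' hF
    rw [eval, eval, hF.reg rK rfl]
    simpa using hk₁
  · intro j s' v h
    simpa using h
  · simp [eval]
  · intro j s₂ hj hF hj₁ hp
    have hk₂ : s₂.reg rK = k := by rw [hF.reg rK rfl]; simpa using hk₁
    refine wp_seq (wp_mono (wp_addTo (n := k + 1) (by norm_num) ?_) ?_)
    · intro s' hF'
      rw [eval, eval, hF'.reg rK rfl, hk₂]
    rintro t₃ s₃ hF₃ ⟨ht₃, hp₃⟩
    refine wp_seq (wp_mono (wp_addTo (n := k + 1) (by norm_num) ?_) ?_)
    · intro s' hF'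
      rw [eval, eval, hF'.reg rK rfl, hF₃.reg rK rfl, hk₂]
    rintro t₄ s₄ hF₄ ⟨ht₄, hp₄⟩
    refine wp_mono (wp_addTo (n := k + 1) (by norm_num) ?_) ?_
    · intro s' hF'
      rw [eval, eval, hF'.reg rK rfl, hF₄.reg rK rfl, hF₃.reg rK rfl, hk₂]
    rintro t₅ s₅ hF₅ ⟨ht₅, hp₅⟩
    refine ⟨by simp only [cost] at ht₃ ht₄ ht₅; omega, by rw [hp₅, hp₄, hp₃, hp]; ring⟩
  rintro t₂ s₂ hF₂ ⟨ht₂, hlen₂⟩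
  have hn₂ : s₂.reg rN = n := by rw [hF₂.reg rN rfl]; simpa using hn₁
  have hh₂ : s₂.reg rHalf = 2 * m := by rw [hF₂.reg rHalf rfl]; simpa using hh₁
  have hp₂ : s₂.reg rPairs = k * l := by rw [hF₂.reg rPairs rfl]; simpa using hp₁
  refine wp_seq (wp_set (wp_seq (wp_mono (wp_addTo (n := n) (by norm_num) ?_) ?_)))
  · intro s' hF
    rw [eval, hF.reg rN rfl]
    simpa using hn₂
  rintro t₃ s₃ hF₃ ⟨ht₃, hb₃⟩
  refine wp_mono (wp_addTo (n := k * l) (by norm_num) ?_) ?_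
  · intro s' hF
    rw [eval, hF.reg rPairs rfl, hF₃.reg rPairs rfl]
    simpa using hp₂
  rintro t₄ s₄ hF₄ ⟨ht₄, hb₄⟩
  refine ⟨?_, ?_, ?_, ?_⟩
  · simp only [cost] at *
    have h1 : (k + 1) * ((l + 1) * 9 + 1 + 5) ≤ (k + 2) * ((k + 2) * 15) :=
      Nat.mul_le_mul (by omega) (by omega)
    have h2 : (k + 1 + 1) * (30 * (k + 2) + (1 + 1) + 5) ≤ (k + 2) * ((k + 2) * 37) :=
      Nat.mul_le_mul_left _ (by omega)
    have h3 : k * l ≤ (k + 2) * (k + 2) := Nat.mul_le_mul (by omega) (by omega)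
    have h4 : (k + 2) ^ 2 * 1 ≤ (k + 2) ^ 2 * (n + m + 1) := Nat.mul_le_mul_left _ (by omega)
    have h5 : 4 * (n + m + 1) ≤ (k + 2) ^ 2 * (n + m + 1) :=
      Nat.mul_le_mul_right _ (by nlinarith)
    have e1 : (k + 2) * ((k + 2) * 15) = 15 * ((k + 2) ^ 2) := by ring
    have e2 : (k + 2) * ((k + 2) * 37) = 37 * ((k + 2) ^ 2) := by ring
    have e3 : (k + 2) * (k + 2) = (k + 2) ^ 2 := by ring
    omega
  · rw [hF₄.reg rPairs rfl, hF₃.reg rPairs rfl]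
    simpa using hp₂
  · rw [hF₄.reg rLen rfl, hF₃.reg rLen rfl, RamState.setReg_reg, if_neg (by norm_num), hlen₂]
    ring
  · rw [hb₄, hb₃]
    simp [eval, hh₂]
    ring

end RamProg

namespace MBCut

variable {I : MBCut} {Z : Finset (Fin I.m)} {s s' : RamState}

theorem parse_time {n m k l : ℕ} (hlk : l ≤ k) :
    (l + 1) * (10 * (k + m) + 50) + 40 * (n + m + 1) ≤ 60 * ((k + 2) ^ 2 * (n + m + 1)) := by
  have h1 : (l + 1) * (10 * (k + m) + 50) ≤ 50 * ((k + 2) ^ 2 * (n + m + 1)) := by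
    calc _ ≤ (k + 2) * (50 * ((k + 2) * (m + 1))) := Nat.mul_le_mul (by omega) (by nlinarith)
      _ = 50 * ((k + 2) ^ 2 * (m + 1)) := by ring
      _ ≤ _ := Nat.mul_le_mul_left _ (Nat.mul_le_mul_left _ (by omega))
  have h2 : 4 * (n + m + 1) ≤ (k + 2) ^ 2 * (n + m + 1) := Nat.mul_le_mul_right _ (by nlinarith)
  omega

theorem wp_parse (hI : Input I Z (s.arr aIn)) (h0 : ∀ v, s.arr aHead v = 0) :
    parse.wp s fun t s' => t ≤ 500 * ((I.k + 2) ^ 2 * (I.n + I.m + 1)) ∧ I.Static Z s' := by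
  have hbk : ∀ i, I.budget i ≤ I.k := fun i =>
    Finset.single_le_sum (f := I.budget) (fun _ _ => Nat.zero_le _) (Finset.mem_univ i)
  have hlk := numColors_le_k (I := I)
  refine wp_seq (wp_seq (wp_set (wp_seq (wp_set (wp_seq (wp_set (wp_seq (wp_set (wp_set ?_)))))))))
  simp only [eval, RamState.setReg_arr, hI.n, hI.m, hI.l, cost]
  generalize hs₀ : ((((s.setReg rN I.n).setReg rM I.m).setReg rL I.numColors).setReg rQ 3).setReg
    rHalf 0 = s₀
  have hn₀ : s₀.reg rN = I.n := by subst hs₀; simp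
  have hm₀ : s₀.reg rM = I.m := by subst hs₀; simp
  have hl₀ : s₀.reg rL = I.numColors := by subst hs₀; simp
  have hin₀ : s₀.arr = s.arr := by subst hs₀; simp
  refine wp_seq (wp_mono (wp_readArcs hm₀ (by subst hs₀; simp) (by subst hs₀; simp)) ?_)
  rintro t₁ s₁ hF₁ ⟨ht₁, hq₁, hh₁, hsrc₁, htgt₁⟩
  have hm₁ : s₁.reg rM = I.m := (hF₁.reg rM rfl).trans hm₀
  refine wp_seq (wp_mono (wp_mirrorArcs hm₁) ?_)
  rintro t₂ s₂ hF₂ ⟨ht₂, hsrc₂, htgt₂, hsrcB₂, htgtB₂, harc₂⟩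
  have hn₂ : s₂.reg rN = I.n := (hF₂.reg rN rfl).trans ((hF₁.reg rN rfl).trans hn₀)
  have hin₂ : s₂.arr aIn = s.arr aIn :=
    (hF₂.arr aIn rfl).trans ((hF₁.arr aIn rfl).trans (congrFun hin₀ _))
  refine wp_seq (wp_mono (wp_copyIn (n := I.n) (by norm_num) (fun s' hF => by
    rw [eval, hF.reg rN rfl, hn₂]) ((hF₂.reg rQ rfl).trans hq₁)) ?_)
  rintro t₃ s₃ hF₃ ⟨ht₃, hq₃, hx₃⟩
  refine wp_seq (wp_mono (wp_copyIn (n := I.n) (by norm_num) (fun s' hF => by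
    rw [eval, hF.reg rN rfl, hF₃.reg rN rfl, hn₂]) hq₃) ?_)
  rintro t₄ s₄ hF₄ ⟨ht₄, hq₄, hy₄⟩
  have hin₄ : s₄.arr aIn = s.arr aIn := (hF₄.arr aIn rfl).trans ((hF₃.arr aIn rfl).trans hin₂)
  have hm₄ : s₄.reg rM = I.m :=
    (hF₄.reg rM rfl).trans ((hF₃.reg rM rfl).trans ((hF₂.reg rM rfl).trans hm₁))
  have hl₄ : s₄.reg rL = I.numColors := (hF₄.reg rL rfl).trans ((hF₃.reg rL rfl).trans
    ((hF₂.reg rL rfl).trans ((hF₁.reg rL rfl).trans hl₀)))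
  have hq₄' : s₄.reg rQ = 3 + 2 * I.m + 2 * I.n := by rw [hq₄]; ring
  refine wp_seq (wp_mono (wp_sumBudgets (B := I.k) hm₄ hl₄ hq₄' fun i hi => ?_) ?_)
  · rw [hin₄]
    exact (hI.budget ⟨i, hi⟩).le.trans (hbk _)
  rintro t₅ s₅ hF₅ ⟨ht₅, hcol₅, hq₅, hk₅⟩
  have hk₅' : s₅.reg rK = I.k := by
    rw [hk₅, k, hin₄, Finset.sum_range]
    exact Finset.sum_congr rfl fun i _ => hI.budget i
  have hin₅ : s₅.arr aIn = s.arr aIn := (hF₅.arr aIn rfl).trans hin₄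
  have hm₅ : s₅.reg rM = I.m := (hF₅.reg rM rfl).trans hm₄
  refine wp_seq (wp_mono (wp_copyIn (n := I.m) (by norm_num) (fun s' hF => by
    rw [eval, hF.reg rM rfl, hm₅]) hq₅) ?_)
  rintro t₆ s₆ hF₆ ⟨ht₆, -, hz₆⟩
  have hn₆ : s₆.reg rN = I.n := (hF₆.reg rN rfl).trans ((hF₅.reg rN rfl).trans
    ((hF₄.reg rN rfl).trans ((hF₃.reg rN rfl).trans hn₂)))
  have hm₆ : s₆.reg rM = I.m := (hF₆.reg rM rfl).trans hm₅
  have hl₆ : s₆.reg rL = I.numColors := (hF₆.reg rL rfl).trans ((hF₅.reg rL rfl).trans hl₄)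
  have hk₆ : s₆.reg rK = I.k := (hF₆.reg rK rfl).trans hk₅'
  have hh₆ : s₆.reg rHalf = 2 * I.m := (hF₆.reg rHalf rfl).trans ((hF₅.reg rHalf rfl).trans
    ((hF₄.reg rHalf rfl).trans ((hF₃.reg rHalf rfl).trans ((hF₂.reg rHalf rfl).trans hh₁))))
  refine wp_seq (wp_mono (wp_computeSizes hn₆ hh₆ hk₆ hl₆ hlk) ?_)
  rintro t₇ s₇ hF₇ ⟨ht₇, hp₇, hlen₇, hb₇⟩
  have hh₇ : s₇.reg rHalf = 2 * I.m := (hF₇.reg rHalf rfl).trans hh₆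
  have hhead : ∀ v, s₇.arr aHead v = 0 := fun v => by
    rw [hF₇.arr aHead rfl, hF₆.arr aHead rfl, hF₅.arr aHead rfl, hF₄.arr aHead rfl,
      hF₃.arr aHead rfl, hF₂.arr aHead rfl, hF₁.arr aHead rfl, hin₀]
    exact h0 v
  refine wp_mono (wp_buildLists (n := I.n) hh₇ hhead) ?_
  rintro t₈ s₈ hF₈ ⟨ht₈, hch₈⟩
  have hsrc : s₈.arr aSrc = s₂.arr aSrc := by
    rw [hF₈.arr aSrc rfl, hF₇.arr aSrc rfl, hF₆.arr aSrc rfl, hF₅.arr aSrc rfl, hF₄.arr aSrc rfl,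
      hF₃.arr aSrc rfl]
  have htgt : s₈.arr aTgt = s₂.arr aTgt := by
    rw [hF₈.arr aTgt rfl, hF₇.arr aTgt rfl, hF₆.arr aTgt rfl, hF₅.arr aTgt rfl, hF₄.arr aTgt rfl,
      hF₃.arr aTgt rfl]
  have harc : s₈.arr aArc = s₂.arr aArc := by
    rw [hF₈.arr aArc rfl, hF₇.arr aArc rfl, hF₆.arr aArc rfl, hF₅.arr aArc rfl, hF₄.arr aArc rfl,
      hF₃.arr aArc rfl]
  have hin : s₈.arr aIn = s.arr aIn := by
    rw [hF₈.arr aIn rfl, hF₇.arr aIn rfl, hF₆.arr aIn rfl, hin₅]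
  have hcol : s₈.reg rCol = 3 + 2 * I.m + 2 * I.n := by
    rw [hF₈.reg rCol rfl, hF₇.reg rCol rfl, hF₆.reg rCol rfl, hcol₅]
  have hS : ∀ e : Fin I.m, s₁.arr aSrc e = I.src e := fun e => by
    rw [hsrc₁ e e.2, hin₀]; exact hI.src e
  have hT : ∀ e : Fin I.m, s₁.arr aTgt e = I.tgt e := fun e => by
    rw [htgt₁ e e.2, hin₀]; exact hI.tgt e
  refine ⟨?_, ?_⟩
  · simp only [cost] at ht₃ ht₄ ht₆
    have := parse_time (n := I.n) (m := I.m) hlk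
    clear * - this ht₁ ht₂ ht₃ ht₄ ht₅ ht₆ ht₇ ht₈
    omega
  · constructor
    · rw [hF₈.reg rN rfl, hF₇.reg rN rfl, hn₆]
    · rw [hF₈.reg rM rfl, hF₇.reg rM rfl, hm₆]
    · rw [hF₈.reg rL rfl, hF₇.reg rL rfl, hl₆]
    · rw [hF₈.reg rK rfl, hF₇.reg rK rfl, hk₆]
    · rw [hF₈.reg rHalf rfl, hh₇]
    · rw [hF₈.reg rPairs rfl, hp₇]
    · rw [hF₈.reg rLen rfl, hlen₇]
    · rw [hF₈.reg rBound rfl, hb₇]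
    · intro e; rw [hsrc, hsrc₂ e e.2, hS]
    · intro e; rw [hsrc, hsrcB₂ e e.2, hT]
    · intro e; rw [htgt, htgt₂ e e.2, hT]
    · intro e; rw [htgt, htgtB₂ e e.2, hS]
    · intro e; rw [harc, harc₂ e e.2]
    · exact hch₈
    · intro v
      rw [hF₈.arr aX rfl, hF₇.arr aX rfl, hF₆.arr aX rfl, hF₅.arr aX rfl, hF₄.arr aX rfl,
        hx₃ v v.2, hin₂]
      exact hI.x v
    · intro v
      rw [hF₈.arr aY rfl, hF₇.arr aY rfl, hF₆.arr aY rfl, hF₅.arr aY rfl, hy₄ v v.2,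
        hF₃.arr aIn rfl, hin₂]
      exact hI.y v
    · intro e
      rw [hF₈.arr aZ rfl, hF₇.arr aZ rfl, hz₆ e e.2, hin₅]
      exact hI.z e
    · intro i
      rw [hin, hcol]
      exact hI.budget i
    · intro i e
      rw [hin, hcol]
      exact hI.color i e

end MBCut

/-! ### Numerical bounds and the final theorem -/

namespace MBCut

theorem pow_bound {k : ℕ} (hk : 2 ≤ k) :
    (k * k + 2) ^ (3 * (k + 1) ^ 2) * (k + 2) ^ 4 ≤ k ^ (29 * k ^ 2) := by
  have h1 : k * k + 2 ≤ k ^ 3 := by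
    calc k * k + 2 ≤ 2 * (k * k) := by nlinarith
      _ ≤ k * (k * k) := Nat.mul_le_mul_right _ hk
      _ = k ^ 3 := by ring
  have h2 : 3 * (k + 1) ^ 2 ≤ 7 * k ^ 2 := by nlinarith
  have h3 : k + 2 ≤ k ^ 2 := by nlinarith
  have h4 : 8 ≤ 8 * k ^ 2 := by nlinarith
  calc (k * k + 2) ^ (3 * (k + 1) ^ 2) * (k + 2) ^ 4
      ≤ (k ^ 3) ^ (3 * (k + 1) ^ 2) * (k ^ 2) ^ 4 :=
        Nat.mul_le_mul (Nat.pow_le_pow_left h1 _) (Nat.pow_le_pow_left h3 _)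
    _ ≤ (k ^ 3) ^ (7 * k ^ 2) * k ^ (8 * k ^ 2) := by
        refine Nat.mul_le_mul (Nat.pow_le_pow_right (by positivity) h2) ?_
        rw [← pow_mul]
        exact Nat.pow_le_pow_right (by omega) h4
    _ = k ^ (29 * k ^ 2) := by rw [← pow_mul, ← pow_add]; ring_nf

/-- For `k ≥ 2` everything except the factor `12000` is at most `k ^ (29 * k ^ 2)`. The constant `10
^ 12` is dictated by `k = 1`. -/
theorem word_bound (k : ℕ) :
    (((k * k + 2) ^ (3 * (k + 1) ^ 2) * (12000 * (k + 2) ^ 4) : ℕ) : ℝ) ≤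
      ((10 ^ 12 : ℕ) : ℝ) *
        (2 : ℝ) ^ (((10 ^ 12 : ℕ) : ℝ) * (k : ℝ) ^ 2 * Real.logb 2 (k : ℝ)) := by
  rcases Nat.lt_or_ge k 2 with hk | hk
  -- For `k = 0` and `k = 1` the exponent is `0`, so the constant alone must suffice; for `k = 1`
  -- the left side is `3 ^ 12 * 12000 * 81`, about `5.2 * 10 ^ 11`.
  · interval_cases k <;> norm_num
  · have hk0 : (0 : ℝ) < k := by positivity
    have hlog : 0 ≤ Real.logb 2 (k : ℝ) :=
      Real.logb_nonneg (by norm_num) (by exact_mod_cast (by omega : 1 ≤ k))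
    have h1 : ((k ^ (29 * k ^ 2) : ℕ) : ℝ) = (2 : ℝ) ^ (29 * (k : ℝ) ^ 2 * Real.logb 2 (k : ℝ)) := by
      rw [mul_comm (29 * (k : ℝ) ^ 2), Real.rpow_mul (by norm_num),
        Real.rpow_logb (by norm_num) (by norm_num) hk0]
      push_cast
      rw [← Real.rpow_natCast]
      push_cast
      rfl
    have h2 : (2 : ℝ) ^ (29 * (k : ℝ) ^ 2 * Real.logb 2 (k : ℝ)) ≤
        (2 : ℝ) ^ (((10 ^ 12 : ℕ) : ℝ) * (k : ℝ) ^ 2 * Real.logb 2 (k : ℝ)) := by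
      refine Real.rpow_le_rpow_of_exponent_le (by norm_num) ?_
      gcongr
      norm_num
    have h3 : (k * k + 2) ^ (3 * (k + 1) ^ 2) * (12000 * (k + 2) ^ 4) ≤
        12000 * k ^ (29 * k ^ 2) := by
      have := pow_bound hk
      calc _ = 12000 * ((k * k + 2) ^ (3 * (k + 1) ^ 2) * (k + 2) ^ 4) := by ring
        _ ≤ _ := Nat.mul_le_mul_left _ this
    calc (((k * k + 2) ^ (3 * (k + 1) ^ 2) * (12000 * (k + 2) ^ 4) : ℕ) : ℝ)
        ≤ ((12000 * k ^ (29 * k ^ 2) : ℕ) : ℝ) := by exact_mod_cast h3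
      _ = 12000 * ((k ^ (29 * k ^ 2) : ℕ) : ℝ) := by push_cast; ring
      _ ≤ ((10 ^ 12 : ℕ) : ℝ) *
        (2 : ℝ) ^ (((10 ^ 12 : ℕ) : ℝ) * (k : ℝ) ^ 2 * Real.logb 2 (k : ℝ)) := by
          rw [h1]
          exact mul_le_mul (by norm_num) h2 (by positivity) (by positivity)

end MBCut

theorem mainTheorem3 :
    ∃ (P : RamProg) (c : ℕ), ∀ (I : MBCut) (Z : Finset (Fin I.m)), Z ⊆ I.colored →
      ∃ (F : List (List (Fin I.m))) (t : ℕ) (s : RamState),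
        P.Runs (RamState.init (I.encode Z)) t s ∧
        s.out = I.encodeFamily F ∧
        (t : ℝ) ≤ (c : ℝ) * (2 : ℝ) ^ ((c : ℝ) * (I.k : ℝ) ^ 2 * Real.logb 2 (I.k : ℝ))
          * (max 1 (I.n + I.m) : ℕ) ∧
        (F.length : ℝ) ≤ (c : ℝ) * (2 : ℝ) ^ ((c : ℝ) * (I.k : ℝ) ^ 2 * Real.logb 2 (I.k : ℝ)) ∧
        (∀ C ∈ F, C.Nodup ∧ I.Admissible Z C.toFinset) ∧
        (∀ C : Finset (Fin I.m), I.Important Z C → ∃ D ∈ F, D.toFinset = C) := by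
  refine ⟨parse ;; enumerate, 10 ^ 12, fun I Z hZ => ?_⟩
  obtain ⟨t₁, s₁, hr₁, ht₁, hst⟩ := MBCut.wp_parse (I := I) (Z := Z)
    (s := RamState.init (I.encode Z)) (I.input_encode Z) fun _ => rfl
  obtain ⟨t₂, s₂, hr₂, ht₂, F, hlen, hout, hadm, hF⟩ := MBCut.wp_enumerate hZ hst
    ((hr₁.frame.arr aAdv rfl).trans rfl) ((hr₁.frame.out rfl).trans rfl)
  have hbound := MBCut.word_bound I.k
  have hK : (I.k * I.numColors + 2) ^ (3 * (I.k + 1) ^ 2) ≤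
      (I.k * I.k + 2) ^ (3 * (I.k + 1) ^ 2) :=
    Nat.pow_le_pow_left (Nat.add_le_add_right (Nat.mul_le_mul_left _ MBCut.numColors_le_k) _) _
  set W := (I.k * I.numColors + 2) ^ (3 * (I.k + 1) ^ 2) with hW
  set W' := (I.k * I.k + 2) ^ (3 * (I.k + 1) ^ 2) with hW'
  refine ⟨F, t₁ + t₂, s₂, hr₁.seq hr₂, hout, ?_, ?_, hadm, hF⟩
  · have ht : t₁ + t₂ ≤ W' * (12000 * (I.k + 2) ^ 4) * max 1 (I.n + I.m) := by
      -- The constants in the running times refer to `n + m + 1`; passing to `max 1 (n + m)` doubles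
      -- `6000` to `12000`.
      have hN : I.n + I.m + 1 ≤ 2 * max 1 (I.n + I.m) := by omega
      have hW1 : 1 ≤ W' := Nat.one_le_pow _ _ (by omega)
      have h1 : (I.k + 2) ^ 2 * (I.n + I.m + 1) ≤ (I.k + 2) ^ 4 * (I.n + I.m + 1) :=
        Nat.mul_le_mul_right _ (Nat.pow_le_pow_right (by omega) (by norm_num))
      have h2 : 1 * ((I.k + 2) ^ 4 * (I.n + I.m + 1)) ≤ W' * ((I.k + 2) ^ 4 * (I.n + I.m + 1)) :=
        Nat.mul_le_mul_right _ hW1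
      have h3 : 1 ≤ (I.k + 2) ^ 4 * (I.n + I.m + 1) := Nat.mul_pos (by positivity) (by omega)
      have h4 : W * (5000 * ((I.k + 2) ^ 4 * (I.n + I.m + 1))) ≤
          5000 * (W' * ((I.k + 2) ^ 4 * (I.n + I.m + 1))) := by
        calc _ ≤ W' * (5000 * ((I.k + 2) ^ 4 * (I.n + I.m + 1))) := Nat.mul_le_mul_right _ hK
          _ = _ := by ring
      calc t₁ + t₂ ≤ 6000 * (W' * ((I.k + 2) ^ 4 * (I.n + I.m + 1))) := by omega
        _ ≤ 6000 * (W' * ((I.k + 2) ^ 4 * (2 * max 1 (I.n + I.m)))) := by gcongr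
        _ = _ := by ring
    calc ((t₁ + t₂ : ℕ) : ℝ) ≤ ((W' * (12000 * (I.k + 2) ^ 4) * max 1 (I.n + I.m) : ℕ) : ℝ) := by
          exact_mod_cast ht
      _ = ((W' * (12000 * (I.k + 2) ^ 4) : ℕ) : ℝ) * (max 1 (I.n + I.m) : ℕ) := by push_cast; ring
      _ ≤ _ := mul_le_mul_of_nonneg_right hbound (by positivity)
  · refine le_trans ?_ hbound
    have : F.length ≤ W' * (12000 * (I.k + 2) ^ 4) :=
      (hlen.trans hK).trans (Nat.le_mul_of_pos_right _ (by positivity))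
    exact_mod_cast this
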